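/- **Setting.** Let $K\ge 1$, $n\ge 1$ and $0<\lambda_1\le\lambda_2\le\dots\le\lambda_K$. A single machine has to process $nK$ jobs, $n$ of each of $K$ types. The sizes $P^k_i$ ($k\in[K]$, $i\in[n]$) are independent random variables, $P_i^k$ being exponential with mean $\lambda_k$. The cost (flow time) $C$ of a schedule is the sum of the completion times of all jobs. FTPP executes the jobs type by type in the order $1,\dots,K$ (increasing mean size); OPT executes them in increasing order of the realized sizes. A non-preemptive algorithm repeatedly selects a type among the set $\mathcal U$ of types with at least one remaining job and runs the next job of this type to completion, until $\mathcal U=\emptyset$. Let $m_k$ be the number of jobs of type $k$ completed so far. Ties in the selections below are broken by an arbitrary deterministic rule, which may depend on the sequence of jobs run so far. *ETC-U.* For $m\ge1$ put $$\hat r^{\,m}_{k,\ell}=\frac1m\sum_{i=1}^m \mathbf 1\{P_i^k<P_i^\ell\},\qquad \delta^{m}=\sqrt{\frac{\log(2n^2K^3)}{2m}},$$ and $\hat r^{\,0}_{k,\ell}=\delta^0=0$. Say that $k$ eliminates $\ell\neq k$ if $\hat r_{k,\ell}^{\,m}-\delta^{m}>\frac12$ for $m=\min(m_k,m_\ell)$.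 A candidate set $\mathcal A$, initially empty, is maintained. In each iteration: if $\mathcal A=\emptyset$, it is replaced by the set of those types of $\mathcal U$ that no other type of $\mathcal U$ eliminates (by $\mathcal U$ itself, if this set is empty); a job of a type $k\in\mathcal A$ with minimal $m_k$ is run and $m_k$ is increased by one; then all types that are eliminated by another type of $\mathcal A$, and all types with no remaining job, are removed (simultaneously) from $\mathcal A$. *UCB-U.* Each iteration runs a job of a type $k\in\mathcal U$ of minimal index $$\underline\lambda_k^{m_k}=\frac{2\sum_{i=1}^{m_k}P_i^k}{\chi^2_{2m_k}\!\left(1-\frac1{2n^2K^2}\right)},\qquad \underline\lambda_k^0=0,$$ where $\chi^2_d(\alpha)$ is the quantile of level $\alpha$ of the $\chi^2$ distribution with $d$ degrees of freedom. **Proposition.** The costs $C_{\mathrm{FTPP}},C_{\mathrm{OPT}},C_{\mathrm{ETC\text-U}},C_{\mathrm{UCB\text-U}}$ are integrable, and $$\mathbb E[C_{\mathrm{ETC\text-U}}]\le \mathbb E[C_{\mathrm{FTPP}}]+\frac1n\mathbb E[C_{\mathrm{OPT}}]+\sum_{k=1}^K\Big[\tfrac12(k-1)(2K-k)+(K-k)^2\Big]\lambda_k\,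 n\sqrt{8n\log(2n^2K^3)},$$ $$\mathbb E[C_{\mathrm{ETC\text-U}}]\le \mathbb E[C_{\mathrm{FTPP}}]+\frac1n\mathbb E[C_{\mathrm{OPT}}]+\sum_{\substack{1\le\ell<k\le K\\ \lambda_\ell<\lambda_k}}(K-\ell)\frac{(\lambda_k+\lambda_\ell)^2}{\lambda_k-\lambda_\ell}\,8n\log(2n^2K^3),$$ $$\mathbb E[C_{\mathrm{UCB\text-U}}]\le \mathbb E[C_{\mathrm{FTPP}}]+n(K-1)\sqrt{3n\ln(2n^2K^2)}\sum_{k=1}^K\lambda_k+\frac2n\mathbb E[C_{\mathrm{OPT}}],$$ $$\mathbb E[C_{\mathrm{UCB\text-U}}]\le \mathbb E[C_{\mathrm{FTPP}}]+\sum_{\substack{1\le\ell<k\le K\\ \lambda_\ell<\lambda_k}}\frac{(\lambda_k+\lambda_\ell)^2}{\lambda_k-\lambda_\ell}\,3n\ln(2n^2K^2)+\frac2n\mathbb E[C_{\mathrm{OPT}}].$$ -/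

import Mathlib

open MeasureTheory ProbabilityTheory

noncomputable section

open Classical in
/-- The members of `S` at which `f` is minimal over `S`. -/
def argminSet {K : ℕ} (S : Finset (Fin K)) (f : Fin K → ℝ) : Finset (Fin K) :=
  S.filter (fun k => ∀ j ∈ S, f k ≤ f j)

/-! ### Jobs, schedules and flow time

A job is a pair `(k, i)`: the `i`-th job of type `k`, with `k : Fin K` and `i = 0, …, n - 1`.
Its size is `p k i`. A non-preemptive schedule is the list of the jobs in the order in which
they are executed, back to back, starting at time `0`. -/

/-- Sum of the completion times of the jobs of a schedule that is started at time `t`. -/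
def flowTimeFrom {K : ℕ} (p : Fin K → ℕ → ℝ) : ℝ → List (Fin K × ℕ) → ℝ
  | _, [] => 0
  | t, (k, i) :: L => (t + p k i) + flowTimeFrom p (t + p k i) L

/-- The flow time (sum of all completion times) of a schedule. -/
def flowTime {K : ℕ} (p : Fin K → ℕ → ℝ) (L : List (Fin K × ℕ)) : ℝ := flowTimeFrom p 0 L

/-- All jobs, type after type: all jobs of type `0`, then all jobs of type `1`, and so on. -/
def allJobs (K n : ℕ) : List (Fin K × ℕ) := (List.finRange K) ×ˢ (List.range n)

/-- Cost of FTPP. The types are numbered by increasing mean size, so that FTPP executes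
the types one after the other in the order of their numbers. -/
def costFTPP (K n : ℕ) (p : Fin K → ℕ → ℝ) : ℝ := flowTime p (allJobs K n)

open Classical in
/-- Cost of OPT, which executes the jobs by increasing realized sizes. -/
def costOPT (K n : ℕ) (p : Fin K → ℕ → ℝ) : ℝ :=
  flowTime p ((allJobs K n).insertionSort (fun a b => p a.1 a.2 ≤ p b.1 b.2))

/-- `m_k`: the number of jobs of type `k` in the list `h` of the jobs completed so far. -/
def numDone {K : ℕ} (h : List (Fin K × ℕ)) (k : Fin K) : ℕ := h.countP (fun j => j.1 = k)

/-- `𝒰`: the types with at least one remaining job. -/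
def remaining {K : ℕ} (n : ℕ) (h : List (Fin K × ℕ)) : Finset (Fin K) :=
  Finset.univ.filter (fun k => numDone h k < n)

/-- Run the next job of type `k` to completion. -/
def runNext {K : ℕ} (h : List (Fin K × ℕ)) (k : Fin K) : List (Fin K × ℕ) :=
  h ++ [(k, numDone h k)]

/-! A tie-breaking rule `tie : List (Fin K × ℕ) → Finset (Fin K) → Fin K` picks the type to be run
among the minimizers of a selection criterion; it may depend on the jobs run so far. -/

/-! ### ETC-U -/

open Classical in
/-- `r̂_{k,ℓ}^m`: the fraction of the first `m` comparisons in which the job of type `k` is the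
shorter one (`0` for `m = 0`). -/
def rHat {K : ℕ} (p : Fin K → ℕ → ℝ) (k l : Fin K) (m : ℕ) : ℝ :=
  (((Finset.range m).filter (fun i => p k i < p l i)).card : ℝ) / (m : ℝ)

/-- `δ^m = √(log (2 n² K³) / (2 m))` (`0` for `m = 0`). -/
def confWidth (K n m : ℕ) : ℝ :=
  √(Real.log (2 * (n : ℝ) ^ 2 * (K : ℝ) ^ 3) / (2 * (m : ℝ)))

/-- After the jobs `h`, type `k` eliminates type `ℓ`. -/
def Eliminates {K : ℕ} (n : ℕ) (p : Fin K → ℕ → ℝ) (h : List (Fin K × ℕ)) (k l : Fin K) : Prop :=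
  1 / 2 < rHat p k l (min (numDone h k) (numDone h l))
    - confWidth K n (min (numDone h k) (numDone h l))

open Classical in
/-- The types of `S` that no other type of `S` eliminates. -/
def uneliminated {K : ℕ} (n : ℕ) (p : Fin K → ℕ → ℝ) (h : List (Fin K × ℕ))
    (S : Finset (Fin K)) : Finset (Fin K) :=
  S.filter (fun l => ∀ k ∈ S, k ≠ l → ¬ Eliminates n p h k l)

open Classical in
/-- The candidate set with which an iteration starts. An empty candidate set is refilled with the
uneliminated types of `𝒰`, or with all of `𝒰` if the types of `𝒰` eliminate each other in
a cycle, so that none of them is left. -/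
def refill {K : ℕ} (n : ℕ) (p : Fin K → ℕ → ℝ) (h : List (Fin K × ℕ))
    (A : Finset (Fin K)) : Finset (Fin K) :=
  if A.Nonempty then A
  else if (uneliminated n p h (remaining n h)).Nonempty then uneliminated n p h (remaining n h)
  else remaining n h

/-- One iteration of ETC-U on the pair (jobs completed so far, candidate set `𝒜`): run a job of a
candidate type with the fewest completed jobs, then remove from `𝒜` the types that
are eliminated by a type of `𝒜` and those that have no job left. -/
def etcuStep {K : ℕ} (n : ℕ) (tie : List (Fin K × ℕ) → Finset (Fin K) → Fin K)
    (p : Fin K → ℕ → ℝ) (s : List (Fin K × ℕ) × Finset (Fin K)) :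
    List (Fin K × ℕ) × Finset (Fin K) :=
  let A := refill n p s.1 s.2
  let h := runNext s.1 (tie s.1 (argminSet A (fun k => (numDone s.1 k : ℝ))))
  (h, uneliminated n p h A ∩ remaining n h)

/-- ETC-U after `t` iterations. -/
def etcuRun {K : ℕ} (n : ℕ) (tie : List (Fin K × ℕ) → Finset (Fin K) → Fin K)
    (p : Fin K → ℕ → ℝ) : ℕ → List (Fin K × ℕ) × Finset (Fin K)
  | 0 => ([], ∅)
  | t + 1 => etcuStep n tie p (etcuRun n tie p t)

/-- Cost of ETC-U. Every iteration completes one job, so `𝒰` is empty after `K * n` of them. -/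
def costETCU (K n : ℕ) (tie : List (Fin K × ℕ) → Finset (Fin K) → Fin K)
    (p : Fin K → ℕ → ℝ) : ℝ :=
  flowTime p (etcuRun n tie p (K * n)).1

/-! ### UCB-U -/

/-- The `χ²` distribution with `d ≥ 1` degrees of freedom: the Gamma distribution of shape `d / 2`
and rate `1 / 2`. -/
def chiSqMeasure (d : ℕ) : Measure ℝ := gammaMeasure ((d : ℝ) / 2) (1 / 2)

/-- The quantile of level `α` of the `χ²` distribution with `d` degrees of freedom. -/
def chiSqQuantile (d : ℕ) (α : ℝ) : ℝ := sInf {x : ℝ | α ≤ cdf (chiSqMeasure d) x}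

/-- The index of type `k` after `m` completed jobs of this type (`0` for `m = 0`, which is below
the index of every type that has been sampled). -/
def ucbuIndex {K : ℕ} (n : ℕ) (p : Fin K → ℕ → ℝ) (k : Fin K) (m : ℕ) : ℝ :=
  2 * (∑ i ∈ Finset.range m, p k i)
    / chiSqQuantile (2 * m) (1 - 1 / (2 * (n : ℝ) ^ 2 * (K : ℝ) ^ 2))

/-- One iteration of UCB-U: run a job of a remaining type of minimal index. -/
def ucbuStep {K : ℕ} (n : ℕ) (tie : List (Fin K × ℕ) → Finset (Fin K) → Fin K)
    (p : Fin K → ℕ → ℝ) (h : List (Fin K × ℕ)) : List (Fin K × ℕ) :=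
  runNext h (tie h (argminSet (remaining n h) (fun k => ucbuIndex n p k (numDone h k))))

/-- UCB-U after `t` iterations. -/
def ucbuRun {K : ℕ} (n : ℕ) (tie : List (Fin K × ℕ) → Finset (Fin K) → Fin K)
    (p : Fin K → ℕ → ℝ) : ℕ → List (Fin K × ℕ)
  | 0 => []
  | t + 1 => ucbuStep n tie p (ucbuRun n tie p t)

/-- Cost of UCB-U. Every iteration completes one job, so `𝒰` is empty after `K * n` of them. -/
def costUCBU (K n : ℕ) (tie : List (Fin K × ℕ) → Finset (Fin K) → Fin K)
    (p : Fin K → ℕ → ℝ) : ℝ :=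
  flowTime p (ucbuRun n tie p (K * n))

end

/-! ### Flow time of a list of jobs -/

/-! Of two jobs, the one run first delays the other by its size: the smaller of the two sizes, plus
the excess of the first size over the second. So the flow time is an order-independent sum of
pairwise minima plus `excess` (`two_mul_flowTime`), and sorting makes the excess vanish. A
non-anticipating algorithm places a job before seeing its size, so the position of a job is
independent of its size, and the expected cost is unchanged when sizes are replaced by their means
along the random order (`integral_flowTime_jobLaw`). For the means FTPP is a sorted schedule; hence
the expected cost of an algorithm is that of FTPP plus the expected excess of its run computed with
the means (`integral_run_jobLaw`). It remains to bound that excess. A job of type `k` that is run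
while type `l` is unfinished adds at most `n * max (lam k - lam l) 0` for `l`
(`IsAlgorithm.excess_run_le`).

UCB-U: type `k` is run before an unfinished `l < k` only if the index of `l` exceeds `lam l`, or the
index of `k` is at most `lam l`. The quantile in the index makes the first event rare, and Gamma
tail bounds make the second rare once `k` has about `separationBound 3` completed jobs.

ETC-U: by Hoeffding's inequality all comparisons are accurate with high probability. Then no type
eliminates an earlier one, so the first remaining type leads the candidates (`IsLed`). A later
candidate `k` is run only while its leader `l` has not eliminated it, which ends after about
`separationBound 8` comparisons. The charge then covers the `k - l` types from `l` up to `k`.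

Both analyses charge a pair at most `N ≤ min n s` times, with `s` the separation bound, up to rare
events. Bounding `N` by `s` gives the gap-dependent estimates, and bounding `N ^ 2` by `n * s` the
gap-free ones. The rare events cost a multiple of `(n + 3) * ∑ k, lam k`, which is absorbed by the
expected cost of OPT, at least `n * (n + 3) / 4 * ∑ k, lam k` (`integral_costOPT_jobLaw`). -/

theorem flowTimeFrom_eq {K : ℕ} (p : Fin K → ℕ → ℝ) (L : List (Fin K × ℕ)) (t : ℝ) :
    flowTimeFrom p t L = L.length * t + flowTime p L := by
  induction L generalizing t with
  | nil => simp [flowTimeFrom, flowTime]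
  | cons a L ih =>
    obtain ⟨k, i⟩ := a
    simp only [flowTime, flowTimeFrom, zero_add, List.length_cons, Nat.cast_add, Nat.cast_one]
    rw [ih (t + p k i), ih (p k i)]
    ring

theorem flowTime_cons {K : ℕ} (p : Fin K → ℕ → ℝ) (a : Fin K × ℕ) (L : List (Fin K × ℕ)) :
    flowTime p (a :: L) = (L.length + 1) * p a.1 a.2 + flowTime p L := by
  obtain ⟨k, i⟩ := a
  rw [flowTime, flowTimeFrom, flowTimeFrom_eq]
  ring

theorem flowTime_congr {K : ℕ} {p p' : Fin K → ℕ → ℝ} {L : List (Fin K × ℕ)}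
    (h : ∀ a ∈ L, p a.1 a.2 = p' a.1 a.2) : flowTime p L = flowTime p' L := by
  induction L with
  | nil => rfl
  | cons a L ih =>
    rw [flowTime_cons, flowTime_cons, h a (by simp), ih fun b hb => h b (by simp [hb])]

/-- Total amount by which the jobs of a list are longer than jobs that are run after them. -/
def excess {K : ℕ} (p : Fin K → ℕ → ℝ) : List (Fin K × ℕ) → ℝ
  | [] => 0
  | a :: L => (L.map fun b => max (p a.1 a.2 - p b.1 b.2) 0).sum + excess p L

/-- The sum of the minima over all pairs of jobs of a list, plus the sum of the jobs. -/
def pairMinSum {K : ℕ} (p : Fin K → ℕ → ℝ) (L : List (Fin K × ℕ)) : ℝ :=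
  (L.map fun a => (L.map fun b => min (p a.1 a.2) (p b.1 b.2)).sum).sum
    + (L.map fun a => p a.1 a.2).sum

/-- A pair of jobs contributes the size of the job run first, which is the minimum of the two sizes
plus the positive part of their difference. The double sum in `pairMinSum` counts each pair twice
and each job once on the diagonal; the extra single sum completes twice the total size. -/
theorem two_mul_flowTime {K : ℕ} (p : Fin K → ℕ → ℝ) (L : List (Fin K × ℕ)) :
    2 * flowTime p L = pairMinSum p L + 2 * excess p L := by
  induction L with
  | nil => simp [flowTime, flowTimeFrom, pairMinSum, excess]
  | cons a L ih =>
    rw [flowTime_cons, mul_add, ih]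
    have h1 : (L.map fun b => max (p a.1 a.2 - p b.1 b.2) 0).sum
        = L.length * p a.1 a.2 - (L.map fun b => min (p a.1 a.2) (p b.1 b.2)).sum := by
      clear ih
      induction L with
      | nil => simp
      | cons b L ih =>
        simp only [List.map_cons, List.sum_cons, ih, List.length_cons, Nat.cast_add, Nat.cast_one]
        rcases le_total (p a.1 a.2) (p b.1 b.2) with h | h
        · rw [min_eq_left h, max_eq_right (by linarith)]; ring
        · rw [min_eq_right h, max_eq_left (by linarith)]; ring
    have h2 : (L.map fun b => min (p b.1 b.2) (p a.1 a.2)).sum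
        = (L.map fun b => min (p a.1 a.2) (p b.1 b.2)).sum := by
      simp only [min_comm]
    simp only [pairMinSum, excess, List.map_cons, List.sum_cons, min_self, List.sum_map_add, h1, h2]
    ring

theorem pairMinSum_perm {K : ℕ} (p : Fin K → ℕ → ℝ) {L L' : List (Fin K × ℕ)} (h : L.Perm L') :
    pairMinSum p L = pairMinSum p L' := by
  have h1 : ∀ f : Fin K × ℕ → ℝ, (L.map f).sum = (L'.map f).sum := fun f => (h.map f).sum_eq
  simp only [pairMinSum, h1]

theorem excess_eq_zero {K : ℕ} (p : Fin K → ℕ → ℝ) {L : List (Fin K × ℕ)}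
    (h : L.Pairwise fun a b => p a.1 a.2 ≤ p b.1 b.2) : excess p L = 0 := by
  induction L with
  | nil => rfl
  | cons a L ih =>
    rw [List.pairwise_cons] at h
    rw [excess, ih h.2, add_zero]
    refine List.sum_eq_zero fun x hx => ?_
    obtain ⟨b, hb, rfl⟩ := List.mem_map.1 hx
    exact max_eq_right (by linarith [h.1 b hb])

theorem excess_le {K : ℕ} (p : Fin K → ℕ → ℝ) (w : Fin K × ℕ → ℝ) (L : List (Fin K × ℕ))
    (h : ∀ L₁ a L₂, L = L₁ ++ a :: L₂ →
      (L₂.map fun b => max (p a.1 a.2 - p b.1 b.2) 0).sum ≤ w a) :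
    excess p L ≤ (L.map w).sum := by
  induction L with
  | nil => simp [excess]
  | cons a L ih =>
    rw [excess, List.map_cons, List.sum_cons]
    refine add_le_add (h [] a L rfl) (ih fun L₁ b L₂ hL => h (a :: L₁) b L₂ ?_)
    rw [hL, List.cons_append]

/-- A job delays itself and everything after it. Jobs of `J` outside the list get coefficient zero,
because `idxOf` then returns the length. The form is linear in the sizes, with weights given by
positions, as the independence argument requires. -/
theorem flowTime_eq_sum {K : ℕ} (p : Fin K → ℕ → ℝ) {L : List (Fin K × ℕ)} (hL : L.Nodup)
    (J : Finset (Fin K × ℕ)) (hJ : ∀ a ∈ L, a ∈ J) :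
    flowTime p L = ∑ a ∈ J, ((L.length : ℝ) - (L.idxOf a : ℝ)) * p a.1 a.2 := by
  induction L with
  | nil => simp [flowTime, flowTimeFrom]
  | cons b L ih =>
    rw [List.nodup_cons] at hL
    rw [flowTime_cons, ih hL.2 fun a ha => hJ a (by simp [ha])]
    have hb : b ∈ J := hJ b (by simp)
    rw [← Finset.add_sum_erase _ _ hb, ← Finset.add_sum_erase (a := b) _ _ hb, ← add_assoc]
    congr 1
    · have : L.idxOf b = L.length := List.idxOf_eq_length_iff.2 hL.1
      simp [this]
    · refine Finset.sum_congr rfl fun a ha => ?_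
      have hne : b ≠ a := (Finset.ne_of_mem_erase ha).symm
      rw [List.idxOf_cons_ne L hne]
      simp

/-! ### The list of all jobs -/

theorem mem_allJobs {K n : ℕ} {a : Fin K × ℕ} : a ∈ allJobs K n ↔ a.2 < n := by
  obtain ⟨k, i⟩ := a
  simp [allJobs]

theorem nodup_allJobs (K n : ℕ) : (allJobs K n).Nodup :=
  (List.nodup_finRange K).product List.nodup_range

theorem sum_map_allJobs {K n : ℕ} (f : Fin K × ℕ → ℝ) :
    ((allJobs K n).map f).sum = ∑ k : Fin K, ∑ i ∈ Finset.range n, f (k, i) := by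
  rw [← List.sum_toFinset _ (nodup_allJobs K n), ← Finset.sum_product']
  refine Finset.sum_congr ?_ fun _ _ => rfl
  ext a
  simp [mem_allJobs]

theorem pairwise_allJobs (K n : ℕ) : (allJobs K n).Pairwise fun a b => a.1 ≤ b.1 := by
  have h : allJobs K n = (List.finRange K).flatMap fun k => (List.range n).map (Prod.mk k) := rfl
  rw [h, List.pairwise_flatMap]
  refine ⟨fun k _ => ?_, ?_⟩
  · rw [List.pairwise_map]
    exact List.nodup_range.imp fun _ => le_rfl
  · refine (List.pairwise_lt_finRange K).imp fun {k l} hkl a ha b hb => ?_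
    obtain ⟨i, -, rfl⟩ := List.mem_map.1 ha
    obtain ⟨j, -, rfl⟩ := List.mem_map.1 hb
    exact hkl.le

/-- Permutations share `pairMinSum`, and the type-by-type order is sorted by mean size, so it has no
excess. -/
theorem flowTime_eq_allJobs_add_excess {K n : ℕ} {lam : Fin K → ℝ} (hmono : Monotone lam)
    {L : List (Fin K × ℕ)} (h : L.Perm (allJobs K n)) :
    flowTime (fun k _ => lam k) L
      = flowTime (fun k _ => lam k) (allJobs K n) + excess (fun k _ => lam k) L := by
  have h1 := two_mul_flowTime (fun k _ => lam k) L
  have h2 := two_mul_flowTime (fun k _ => lam k) (allJobs K n)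
  rw [excess_eq_zero (fun k _ => lam k) ((pairwise_allJobs K n).imp fun h => hmono h)] at h2
  rw [pairMinSum_perm _ h] at h1
  linarith

theorem costOPT_eq {K n : ℕ} (p : Fin K → ℕ → ℝ) :
    costOPT K n p = 1 / 2 * pairMinSum p (allJobs K n) := by
  classical
  have h1 := two_mul_flowTime p
    ((allJobs K n).insertionSort (fun a b => p a.1 a.2 ≤ p b.1 b.2))
  have : Std.Total (fun a b : Fin K × ℕ => p a.1 a.2 ≤ p b.1 b.2) := ⟨fun a b => le_total _ _⟩
  have : IsTrans (Fin K × ℕ) (fun a b => p a.1 a.2 ≤ p b.1 b.2) := ⟨fun a b c => le_trans⟩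
  rw [excess_eq_zero p (List.pairwise_insertionSort _ _),
    pairMinSum_perm p (List.perm_insertionSort _ _)] at h1
  have h2 : costOPT K n p = flowTime p
      ((allJobs K n).insertionSort (fun a b => p a.1 a.2 ≤ p b.1 b.2)) := by
    unfold costOPT
    congr
  rw [h2]
  linarith

/-! ### Histories of non-preemptive algorithms -/

/-- The lists of jobs that can be completed by repeatedly running the next job of
a remaining type. -/
inductive IsHistory {K : ℕ} (n : ℕ) : List (Fin K × ℕ) → Prop
  | nil : IsHistory n []
  | runNext {h : List (Fin K × ℕ)} {k : Fin K} :
      IsHistory n h → k ∈ remaining n h → IsHistory n (runNext h k)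

theorem mem_remaining {K n : ℕ} {h : List (Fin K × ℕ)} {k : Fin K} :
    k ∈ remaining n h ↔ numDone h k < n := by
  simp [remaining]

theorem numDone_append {K : ℕ} (h h' : List (Fin K × ℕ)) (k : Fin K) :
    numDone (h ++ h') k = numDone h k + numDone h' k := by
  simp [numDone]

theorem numDone_cons {K : ℕ} (a : Fin K × ℕ) (h : List (Fin K × ℕ)) (k : Fin K) :
    numDone (a :: h) k = numDone h k + if a.1 = k then 1 else 0 := by
  simp [numDone, List.countP_cons]

theorem numDone_runNext {K : ℕ} (h : List (Fin K × ℕ)) (k l : Fin K) :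
    numDone (runNext h k) l = numDone h l + if k = l then 1 else 0 := by
  rw [runNext, numDone_append, numDone_cons]
  simp [numDone]

theorem numDone_runNext_self {K : ℕ} (h : List (Fin K × ℕ)) (k : Fin K) :
    numDone (runNext h k) k = numDone h k + 1 := by
  simp [numDone_runNext]

theorem numDone_runNext_of_ne {K : ℕ} (h : List (Fin K × ℕ)) {k l : Fin K} (hkl : k ≠ l) :
    numDone (runNext h k) l = numDone h l := by
  simp [numDone_runNext, hkl]

theorem length_eq_sum_numDone {K : ℕ} (h : List (Fin K × ℕ)) :
    h.length = ∑ k, numDone h k := by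
  induction h with
  | nil => simp [numDone]
  | cons a h ih => simp [numDone_cons, Finset.sum_add_distrib, ih]

theorem sum_map_eq_sum_numDone {K : ℕ} (L : List (Fin K × ℕ)) (f : Fin K → ℝ) :
    (L.map fun b => f b.1).sum = ∑ l, numDone L l * f l := by
  induction L with
  | nil => simp [numDone]
  | cons a h ih => simp [numDone_cons, add_mul, Finset.sum_add_distrib, ih, add_comm]

namespace IsHistory

variable {K n : ℕ} {h : List (Fin K × ℕ)}

theorem mem_iff (hh : IsHistory n h) (a : Fin K × ℕ) : a ∈ h ↔ a.2 < numDone h a.1 := by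
  induction hh with
  | nil => simp [numDone]
  | @runNext h k _ _ ih =>
    rw [numDone_runNext, _root_.runNext, List.mem_append, ih, List.mem_singleton]
    obtain ⟨l, i⟩ := a
    by_cases hkl : k = l
    · subst hkl
      simp only [Prod.mk.injEq, true_and, if_true]
      omega
    · simp [hkl, Ne.symm hkl]

theorem nodup (hh : IsHistory n h) : h.Nodup := by
  induction hh with
  | nil => simp
  | @runNext h k hh _ ih =>
    rw [_root_.runNext, List.nodup_append]
    refine ⟨ih, List.nodup_singleton _, fun a ha b hb => ?_⟩
    rw [List.mem_singleton] at hb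
    rintro rfl
    subst hb
    simpa using (hh.mem_iff _).1 ha

theorem numDone_le (hh : IsHistory n h) (k : Fin K) : numDone h k ≤ n := by
  induction hh with
  | nil => simp [numDone]
  | @runNext h l _ hl ih =>
    rw [numDone_runNext]
    split_ifs with hlk
    · subst hlk
      exact mem_remaining.1 hl
    · simpa using ih

theorem numDone_eq_of_length (hh : IsHistory n h) (hlen : h.length = K * n) (k : Fin K) :
    numDone h k = n := by
  have h1 : ∑ k, numDone h k = ∑ _k : Fin K, n := by
    rw [← length_eq_sum_numDone, hlen]; simp
  exact (Finset.sum_eq_sum_iff_of_le fun k _ => hh.numDone_le k).1 h1 k (Finset.mem_univ k)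

theorem perm_allJobs (hh : IsHistory n h) (hlen : h.length = K * n) : h.Perm (allJobs K n) := by
  refine (List.perm_ext_iff_of_nodup hh.nodup (nodup_allJobs K n)).2 fun a => ?_
  rw [hh.mem_iff, mem_allJobs, hh.numDone_eq_of_length hlen]

theorem remaining_nonempty (_hh : IsHistory n h) (hlen : h.length < K * n) :
    (remaining n h).Nonempty := by
  by_contra hne
  rw [Finset.not_nonempty_iff_eq_empty] at hne
  have h1 : ∀ k, n ≤ numDone h k := fun k => by
    by_contra hk
    have : k ∈ remaining n h := mem_remaining.2 (by omega)
    simp [hne] at this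
  have h2 : ∑ _k : Fin K, n ≤ ∑ k, numDone h k := Finset.sum_le_sum fun k _ => h1 k
  rw [← length_eq_sum_numDone] at h2
  simp at h2
  omega

end IsHistory

/-- A non-preemptive, non-anticipating algorithm: `run p t` is the list of the jobs completed
after `t` iterations if the job sizes are `p`. -/
structure IsAlgorithm {K : ℕ} (n : ℕ) (run : (Fin K → ℕ → ℝ) → ℕ → List (Fin K × ℕ)) : Prop where
  zero : ∀ p, run p 0 = []
  step : ∀ p t, t < K * n → ∃ k ∈ remaining n (run p t), run p (t + 1) = runNext (run p t) k
  congr : ∀ p p' t, t < K * n → (∀ a ∈ run p t, p a.1 a.2 = p' a.1 a.2) →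
    run p' (t + 1) = run p (t + 1)

namespace IsAlgorithm

variable {K n : ℕ} {run : (Fin K → ℕ → ℝ) → ℕ → List (Fin K × ℕ)}

theorem isHistory (hrun : IsAlgorithm n run) (p : Fin K → ℕ → ℝ) {t : ℕ} (ht : t ≤ K * n) :
    IsHistory n (run p t) ∧ (run p t).length = t := by
  induction t with
  | zero => simp [hrun.zero, IsHistory.nil]
  | succ t ih =>
    obtain ⟨k, hk, h⟩ := hrun.step p t ht
    obtain ⟨h1, h2⟩ := ih (by omega)
    rw [h]
    exact ⟨h1.runNext hk, by simp [runNext, h2]⟩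

theorem prefix_run (hrun : IsAlgorithm n run) (p : Fin K → ℕ → ℝ) {s t : ℕ} (hst : s ≤ t)
    (ht : t ≤ K * n) : run p s <+: run p t := by
  induction t, hst using Nat.le_induction with
  | base => exact List.prefix_rfl
  | succ t hst ih =>
    obtain ⟨k, -, h⟩ := hrun.step p t ht
    rw [h]
    exact (ih (by omega)).trans (List.prefix_append _ _)

theorem perm_allJobs (hrun : IsAlgorithm n run) (p : Fin K → ℕ → ℝ) :
    (run p (K * n)).Perm (allJobs K n) :=
  (hrun.isHistory p le_rfl).1.perm_allJobs (hrun.isHistory p le_rfl).2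

theorem run_congr (hrun : IsAlgorithm n run) {p p' : Fin K → ℕ → ℝ} {t : ℕ} (ht : t ≤ K * n)
    (h : ∀ k, ∀ i < n, p k i = p' k i) : run p' t = run p t := by
  cases t with
  | zero => simp [hrun.zero]
  | succ t =>
    refine hrun.congr p p' t ht fun a ha => h _ _ ?_
    have h1 := (hrun.isHistory p (t := t) (by omega)).1
    exact ((h1.mem_iff a).1 ha).trans_le (h1.numDone_le _)

/-- The size of a job is revealed only by its completion: two runs that differ only in the size of
`a` coincide until `a` is in the list, and later iterations only append. This is what makes the
position of a job independent of its size. -/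
theorem idxOf_congr (hrun : IsAlgorithm n run) {p p' : Fin K → ℕ → ℝ} {a : Fin K × ℕ} {t : ℕ}
    (ht : t ≤ K * n) (h : ∀ b, b ≠ a → p b.1 b.2 = p' b.1 b.2) :
    (run p' t).idxOf a = (run p t).idxOf a := by
  have key : ∀ t, t ≤ K * n → (a ∉ run p t ∧ run p' t = run p t) ∨
      (∃ s ≤ t, run p' s = run p s ∧ a ∈ run p s) := by
    intro t
    induction t with
    | zero => intro _; left; simp [hrun.zero]
    | succ t ih =>
      intro ht
      rcases ih (by omega) with ⟨h1, h2⟩ | ⟨s, hs, h1⟩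
      · have h3 : run p' (t + 1) = run p (t + 1) :=
          hrun.congr p p' t ht fun b hb => h b fun hba => h1 (hba ▸ hb)
        by_cases ha : a ∈ run p (t + 1)
        · exact Or.inr ⟨t + 1, le_rfl, h3, ha⟩
        · exact Or.inl ⟨ha, h3⟩
      · exact Or.inr ⟨s, by omega, h1⟩
  rcases key t ht with ⟨-, h2⟩ | ⟨s, hs, h1, h2⟩
  · rw [h2]
  · obtain ⟨u, hu⟩ := hrun.prefix_run p hs ht
    obtain ⟨u', hu'⟩ := hrun.prefix_run p' hs ht
    rw [← hu, ← hu', List.idxOf_append_of_mem h2, List.idxOf_append_of_mem (h1 ▸ h2), h1]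

theorem flowTime_run_congr (hrun : IsAlgorithm n run) {p p' : Fin K → ℕ → ℝ}
    (h : ∀ k, ∀ i < n, p k i = p' k i) :
    flowTime p' (run p' (K * n)) = flowTime p (run p (K * n)) := by
  rw [hrun.run_congr le_rfl h]
  refine flowTime_congr fun a ha => ?_
  have := ((hrun.perm_allJobs p).mem_iff).1 ha
  exact (h _ _ (mem_allJobs.1 this)).symm

/-- Each decision is charged when it is made: at most `n` jobs of each remaining type follow, and
none of the finished types. The charge may depend on the history only through a weight `w k i` of
the job that is run. -/
theorem excess_run_le (hrun : IsAlgorithm n run) (p : Fin K → ℕ → ℝ) (lam : Fin K → ℝ)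
    (w : Fin K → ℕ → ℝ)
    (hw : ∀ t < K * n, ∀ k ∈ remaining n (run p t), run p (t + 1) = runNext (run p t) k →
      ∑ l ∈ remaining n (run p t), n * max (lam k - lam l) 0 ≤ w k (numDone (run p t) k)) :
    excess (fun k _ => lam k) (run p (K * n)) ≤ ∑ k, ∑ i ∈ Finset.range n, w k i := by
  refine (excess_le _ (fun a => w a.1 a.2) _ fun L₁ a L₂ hL => ?_).trans ?_
  · obtain ⟨-, hlen⟩ := hrun.isHistory p (le_refl (K * n))
    have ht : L₁.length < K * n := by
      rw [← hlen, hL]; simp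
    have h1 : run p L₁.length = L₁ := by
      have h2 := hrun.prefix_run p ht.le le_rfl
      rw [hL] at h2
      have h3 := (hrun.isHistory p ht.le).2
      have h4 : L₁ <+: L₁ ++ a :: L₂ := List.prefix_append _ _
      exact (List.prefix_of_prefix_length_le h2 h4 h3.le).eq_of_length h3
    obtain ⟨k, hk, hstep⟩ := hrun.step p L₁.length ht
    have ha : a = (k, numDone L₁ k) := by
      have h2 := hrun.prefix_run p (s := L₁.length + 1) ht le_rfl
      rw [hstep, h1, hL, runNext, List.prefix_append_right_inj] at h2
      simpa using (List.cons_prefix_cons.1 h2).1.symm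
    subst ha
    refine le_trans ?_ ((hw _ ht k hk hstep).trans (by rw [h1]))
    rw [sum_map_eq_sum_numDone L₂ fun l => max (lam k - lam l) 0,
      ← Finset.sum_subset (Finset.subset_univ (remaining n (run p L₁.length)))]
    · refine Finset.sum_le_sum fun l _ => ?_
      refine mul_le_mul_of_nonneg_right ?_ (le_max_right _ _)
      have h5 := (hrun.isHistory p le_rfl).1.numDone_le l
      rw [hL, numDone_append, numDone_cons] at h5
      exact_mod_cast (by omega : numDone L₂ l ≤ n)
    · intro l _ hl
      rw [mem_remaining, h1] at hl
      have h5 := (hrun.isHistory p le_rfl).1.numDone_le l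
      rw [hL, numDone_append, numDone_cons] at h5
      have : numDone L₂ l = 0 := by omega
      simp [this]
  · rw [((hrun.perm_allJobs p).map _).sum_eq, sum_map_allJobs]

end IsAlgorithm

/-! ### Selections -/

theorem mem_argminSet {K : ℕ} {S : Finset (Fin K)} {f : Fin K → ℝ} {k : Fin K} :
    k ∈ argminSet S f ↔ k ∈ S ∧ ∀ j ∈ S, f k ≤ f j := by
  simp [argminSet]

theorem argminSet_nonempty {K : ℕ} {S : Finset (Fin K)} (hS : S.Nonempty) (f : Fin K → ℝ) :
    (argminSet S f).Nonempty := by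
  obtain ⟨k, hk, h⟩ := S.exists_min_image f hS
  exact ⟨k, mem_argminSet.2 ⟨hk, h⟩⟩

theorem runNext_injective {K : ℕ} {h : List (Fin K × ℕ)} {k l : Fin K}
    (hkl : runNext h k = runNext h l) : k = l := by
  rw [runNext, runNext, List.append_cancel_left_eq] at hkl
  simp at hkl
  exact hkl.1

theorem refill_subset {K n : ℕ} {p : Fin K → ℕ → ℝ} {h : List (Fin K × ℕ)} {A : Finset (Fin K)}
    (hA : A ⊆ remaining n h) : refill n p h A ⊆ remaining n h := by
  classical
  unfold refill
  split_ifs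
  · exact hA
  · exact Finset.filter_subset _ _
  · exact subset_rfl

theorem refill_nonempty {K n : ℕ} (p : Fin K → ℕ → ℝ) {h : List (Fin K × ℕ)} (A : Finset (Fin K))
    (hr : (remaining n h).Nonempty) : (refill n p h A).Nonempty := by
  classical
  unfold refill
  split_ifs <;> assumption

theorem mem_uneliminated {K n : ℕ} {p : Fin K → ℕ → ℝ} {h : List (Fin K × ℕ)}
    {S : Finset (Fin K)} {l : Fin K} :
    l ∈ uneliminated n p h S ↔ l ∈ S ∧ ∀ k ∈ S, k ≠ l → ¬ Eliminates n p h k l := by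
  simp [uneliminated]

theorem rHat_eq_sum {K : ℕ} (p : Fin K → ℕ → ℝ) (k l : Fin K) (m : ℕ) :
    rHat p k l m = (∑ i ∈ Finset.range m, (Set.Ioi (0 : ℝ)).indicator 1 (p l i - p k i)) / m := by
  classical
  rw [rHat, Finset.card_filter]
  push_cast
  congr 1
  refine Finset.sum_congr rfl fun i _ => ?_
  simp [Set.indicator_apply]

theorem rHat_congr {K : ℕ} {p p' : Fin K → ℕ → ℝ} {k l : Fin K} {m : ℕ}
    (hk : ∀ i < m, p k i = p' k i) (hl : ∀ i < m, p l i = p' l i) :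
    rHat p k l m = rHat p' k l m := by
  rw [rHat_eq_sum, rHat_eq_sum]
  congr 1
  refine Finset.sum_congr rfl fun i hi => ?_
  rw [hk i (Finset.mem_range.1 hi), hl i (Finset.mem_range.1 hi)]

theorem eliminates_congr {K n : ℕ} {p p' : Fin K → ℕ → ℝ} {h : List (Fin K × ℕ)}
    (hp : ∀ k, ∀ i < numDone h k, p k i = p' k i) (k l : Fin K) :
    Eliminates n p h k l ↔ Eliminates n p' h k l := by
  rw [Eliminates, Eliminates, rHat_congr]
  · exact fun i hi => hp k i (lt_min_iff.1 hi).1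
  · exact fun i hi => hp l i (lt_min_iff.1 hi).2

theorem uneliminated_congr {K n : ℕ} {p p' : Fin K → ℕ → ℝ} {h : List (Fin K × ℕ)}
    (hp : ∀ k, ∀ i < numDone h k, p k i = p' k i) (S : Finset (Fin K)) :
    uneliminated n p h S = uneliminated n p' h S := by
  ext l
  simp only [mem_uneliminated, eliminates_congr hp]

theorem refill_congr {K n : ℕ} {p p' : Fin K → ℕ → ℝ} {h : List (Fin K × ℕ)}
    (hp : ∀ k, ∀ i < numDone h k, p k i = p' k i) (A : Finset (Fin K)) :
    refill n p h A = refill n p' h A := by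
  unfold refill
  rw [uneliminated_congr hp]

/-! ### ETC-U is a non-anticipating algorithm -/

section ETC

variable {K n : ℕ} {tie : List (Fin K × ℕ) → Finset (Fin K) → Fin K}

theorem etcuStep_spec (htie : ∀ h S, S.Nonempty → tie h S ∈ S) (p : Fin K → ℕ → ℝ)
    {s : List (Fin K × ℕ) × Finset (Fin K)} (hA : s.2 ⊆ remaining n s.1)
    (hr : (remaining n s.1).Nonempty) :
    ∃ k ∈ argminSet (refill n p s.1 s.2) (fun k => (numDone s.1 k : ℝ)), k ∈ remaining n s.1 ∧
      etcuStep n tie p s = (runNext s.1 k,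
        uneliminated n p (runNext s.1 k) (refill n p s.1 s.2) ∩ remaining n (runNext s.1 k)) := by
  have h1 := htie s.1 _ (argminSet_nonempty (refill_nonempty p s.2 hr)
    (fun k => (numDone s.1 k : ℝ)))
  exact ⟨_, h1, refill_subset hA (mem_argminSet.1 h1).1, rfl⟩

theorem etcuRun_isHistory (htie : ∀ h S, S.Nonempty → tie h S ∈ S) (p : Fin K → ℕ → ℝ) {t : ℕ}
    (ht : t ≤ K * n) :
    IsHistory n (etcuRun n tie p t).1 ∧ (etcuRun n tie p t).1.length = t ∧
      (etcuRun n tie p t).2 ⊆ remaining n (etcuRun n tie p t).1 := by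
  induction t with
  | zero => exact ⟨IsHistory.nil, rfl, Finset.empty_subset _⟩
  | succ t ih =>
    obtain ⟨h1, h2, h3⟩ := ih (by omega)
    obtain ⟨k, -, hk, h4⟩ := etcuStep_spec htie p h3 (h1.remaining_nonempty (by omega))
    rw [etcuRun, h4]
    exact ⟨h1.runNext hk, by simp [runNext, h2], Finset.inter_subset_right⟩

/-- The induction has to carry the candidate set along with the job list, since the next decision
depends on both. -/
theorem etcuRun_congr (htie : ∀ h S, S.Nonempty → tie h S ∈ S) {p p' : Fin K → ℕ → ℝ} {t : ℕ}
    (ht : t ≤ K * n) (hp : ∀ a ∈ (etcuRun n tie p t).1, p a.1 a.2 = p' a.1 a.2) :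
    etcuRun n tie p' t = etcuRun n tie p t := by
  induction t with
  | zero => rfl
  | succ t ih =>
    obtain ⟨h1, h2, h3⟩ := etcuRun_isHistory (n := n) htie p (t := t) (by omega)
    obtain ⟨k, -, hk, h4⟩ := etcuStep_spec htie p h3 (h1.remaining_nonempty (by omega))
    rw [etcuRun, h4] at hp
    have h5 : ∀ k', ∀ i < numDone (runNext (etcuRun n tie p t).1 k) k', p k' i = p' k' i :=
      fun k' i hi => hp (k', i) (((h1.runNext hk).mem_iff _).2 hi)
    have h6 : ∀ k', ∀ i < numDone (etcuRun n tie p t).1 k', p k' i = p' k' i :=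
      fun k' i hi => h5 k' i (hi.trans_le (by rw [numDone_runNext]; omega))
    have h7 := ih (by omega) fun a ha => h6 _ _ ((h1.mem_iff a).1 ha)
    rw [etcuRun, etcuRun, h7]
    have h8 := congrArg Prod.fst h4
    simp only [etcuStep] at h8 ⊢
    rw [← refill_congr h6, h8, uneliminated_congr h5]

theorem isAlgorithm_etcuRun (htie : ∀ h S, S.Nonempty → tie h S ∈ S) :
    IsAlgorithm n (fun p t => (etcuRun n tie p t).1) where
  zero _ := rfl
  step p t ht := by
    obtain ⟨h1, h2, h3⟩ := etcuRun_isHistory htie p (t := t) ht.le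
    obtain ⟨k, -, hk, h4⟩ := etcuStep_spec htie p h3 (h1.remaining_nonempty (by omega))
    exact ⟨k, hk, congrArg Prod.fst h4⟩
  congr p p' t ht hp := by
    obtain ⟨h1, h2, h3⟩ := etcuRun_isHistory htie p (t := t) ht.le
    have h6 : ∀ k', ∀ i < numDone (etcuRun n tie p t).1 k', p k' i = p' k' i :=
      fun k' i hi => hp (k', i) ((h1.mem_iff _).2 hi)
    simp only [etcuRun, etcuStep, etcuRun_congr htie ht.le hp]
    rw [← refill_congr h6]

end ETC

/-! ### UCB-U is a non-anticipating algorithm -/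

section UCB

variable {K n : ℕ} {tie : List (Fin K × ℕ) → Finset (Fin K) → Fin K}

theorem ucbuIndex_congr {p p' : Fin K → ℕ → ℝ} {k : Fin K} {m : ℕ}
    (hp : ∀ i < m, p k i = p' k i) : ucbuIndex n p k m = ucbuIndex n p' k m := by
  rw [ucbuIndex, ucbuIndex, Finset.sum_congr rfl fun i hi => hp i (Finset.mem_range.1 hi)]

theorem ucbuStep_spec (htie : ∀ h S, S.Nonempty → tie h S ∈ S) (p : Fin K → ℕ → ℝ)
    {h : List (Fin K × ℕ)} (hr : (remaining n h).Nonempty) :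
    ∃ k ∈ remaining n h, (∀ l ∈ remaining n h,
        ucbuIndex n p k (numDone h k) ≤ ucbuIndex n p l (numDone h l)) ∧
      ucbuStep n tie p h = runNext h k := by
  have h1 := htie h _ (argminSet_nonempty hr (fun k => ucbuIndex n p k (numDone h k)))
  rw [mem_argminSet] at h1
  exact ⟨_, h1.1, h1.2, rfl⟩

theorem ucbuRun_isHistory (htie : ∀ h S, S.Nonempty → tie h S ∈ S) (p : Fin K → ℕ → ℝ) {t : ℕ}
    (ht : t ≤ K * n) : IsHistory n (ucbuRun n tie p t) ∧ (ucbuRun n tie p t).length = t := by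
  induction t with
  | zero => exact ⟨IsHistory.nil, rfl⟩
  | succ t ih =>
    obtain ⟨h1, h2⟩ := ih (by omega)
    obtain ⟨k, hk, -, h4⟩ := ucbuStep_spec htie p (h1.remaining_nonempty (by omega))
    rw [ucbuRun, h4]
    exact ⟨h1.runNext hk, by simp [runNext, h2]⟩

theorem ucbuStep_congr {p p' : Fin K → ℕ → ℝ} {h : List (Fin K × ℕ)}
    (hp : ∀ k, ∀ i < numDone h k, p k i = p' k i) : ucbuStep n tie p' h = ucbuStep n tie p h := by
  have : (fun k => ucbuIndex n p k (numDone h k)) = fun k => ucbuIndex n p' k (numDone h k) :=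
    funext fun k => ucbuIndex_congr (hp k)
  rw [ucbuStep, ucbuStep, this]

theorem ucbuRun_congr (htie : ∀ h S, S.Nonempty → tie h S ∈ S) {p p' : Fin K → ℕ → ℝ} {t : ℕ}
    (ht : t < K * n) (hp : ∀ a ∈ ucbuRun n tie p t, p a.1 a.2 = p' a.1 a.2) :
    ucbuRun n tie p' (t + 1) = ucbuRun n tie p (t + 1) := by
  obtain ⟨h1, h2⟩ := ucbuRun_isHistory htie p (t := t) ht.le
  have h3 : ucbuRun n tie p' t = ucbuRun n tie p t := by
    cases t with
    | zero => rfl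
    | succ t =>
      refine ucbuRun_congr htie (by omega) fun a ha => hp a ?_
      obtain ⟨h1, h2⟩ := ucbuRun_isHistory (n := n) htie p (t := t) (by omega)
      obtain ⟨k, -, -, h4⟩ := ucbuStep_spec htie p (h1.remaining_nonempty (by omega))
      rw [ucbuRun, h4]
      exact List.mem_append_left _ ha
  rw [ucbuRun, ucbuRun, h3]
  exact ucbuStep_congr fun k i hi => hp (k, i) ((h1.mem_iff _).2 hi)

theorem isAlgorithm_ucbuRun (htie : ∀ h S, S.Nonempty → tie h S ∈ S) :
    IsAlgorithm n (ucbuRun n tie) where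
  zero _ := rfl
  step p t ht := by
    obtain ⟨h1, h2⟩ := ucbuRun_isHistory htie p (t := t) ht.le
    obtain ⟨k, hk, -, h4⟩ := ucbuStep_spec htie p (h1.remaining_nonempty (by omega))
    exact ⟨k, hk, h4⟩
  congr _ _ _ ht hp := ucbuRun_congr htie ht hp

open Classical in
/-- UCB-U only runs a job of a type `k` while a type `l` of smaller mean remains if the index
of `k` is below the mean of `l`, or the index of `l` has once been too large. -/
theorem excess_ucbuRun_le (htie : ∀ h S, S.Nonempty → tie h S ∈ S) (p : Fin K → ℕ → ℝ)
    (lam : Fin K → ℝ) :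
    excess (fun k _ => lam k) (ucbuRun n tie p (K * n)) ≤
      ∑ k, ∑ m ∈ Finset.range n, ∑ l, n * max (lam k - lam l) 0 *
        ((if ucbuIndex n p k m ≤ lam l then 1 else 0)
          + ∑ j ∈ Finset.range n, if lam l < ucbuIndex n p l j then 1 else 0) := by
  refine (isAlgorithm_ucbuRun htie).excess_run_le p lam _ fun t ht k _ hstep => ?_
  obtain ⟨h1, h2⟩ := ucbuRun_isHistory htie p (t := t) ht.le
  obtain ⟨k', hk', hle, h4⟩ := ucbuStep_spec htie p (h1.remaining_nonempty (by omega))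
  obtain rfl : k' = k := runNext_injective (h4.symm.trans hstep)
  refine (Finset.sum_le_sum fun l hl => ?_).trans
    (Finset.sum_le_sum_of_subset_of_nonneg (Finset.subset_univ _) fun l _ _ => ?_)
  -- One of the two indicators fires: if the index of `l` is at most `lam l`, minimality puts the
  -- index of the selected type below `lam l`; otherwise the current count of `l` is one of the `j`
  -- in the sum.
  · refine le_mul_of_one_le_right (by positivity) ?_
    have h5 : (0 : ℝ) ≤ ∑ j ∈ Finset.range n, if lam l < ucbuIndex n p l j then 1 else 0 :=
      Finset.sum_nonneg fun j _ => by split_ifs <;> norm_num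
    by_cases h6 : ucbuIndex n p l (numDone (ucbuRun n tie p t) l) ≤ lam l
    · rw [if_pos ((hle l hl).trans h6)]
      linarith
    · have h7 := Finset.single_le_sum
        (f := fun j => if lam l < ucbuIndex n p l j then (1 : ℝ) else 0)
        (fun j _ => by split_ifs <;> norm_num)
        (Finset.mem_range.2 (mem_remaining.1 hl))
      simp only [if_pos (not_le.1 h6)] at h7
      have : (0 : ℝ) ≤ if ucbuIndex n p k' (numDone (ucbuRun n tie p t) k') ≤ lam l
        then 1 else 0 := by split_ifs <;> norm_num
      linarith
  · refine mul_nonneg (by positivity) (add_nonneg ?_ (Finset.sum_nonneg fun j _ => ?_)) <;>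
      split_ifs <;> norm_num

end UCB

/-! ### ETC-U on the event that all comparisons are accurate -/

/-- Type `k` eliminates type `l` on the basis of the first `m` jobs of each. -/
def EliminatesAt {K : ℕ} (n : ℕ) (p : Fin K → ℕ → ℝ) (k l : Fin K) (m : ℕ) : Prop :=
  1 / 2 < rHat p k l m - confWidth K n m

/-- The estimates of the probability that a job of a type is shorter than one of a later type are
accurate from below. -/
def AccurateComparisons {K : ℕ} (n : ℕ) (lam : Fin K → ℝ) (p : Fin K → ℕ → ℝ) : Prop :=
  ∀ l k, l < k → ∀ m ∈ Finset.Icc 1 n,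
    lam k / (lam k + lam l) - confWidth K n m < rHat p l k m

theorem rHat_add_rHat_le_one {K : ℕ} (p : Fin K → ℕ → ℝ) (k l : Fin K) (m : ℕ) :
    rHat p k l m + rHat p l k m ≤ 1 := by
  rw [rHat_eq_sum, rHat_eq_sum, ← add_div, ← Finset.sum_add_distrib]
  refine div_le_one_of_le₀ ?_ (Nat.cast_nonneg m)
  refine (Finset.sum_le_card_nsmul _ _ 1 fun i _ => ?_).trans (by simp)
  rcases lt_trichotomy (p l i) (p k i) with h | h | h
  · simp [h, h.le]
  · simp [h]
  · simp [h, h.le]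

theorem confWidth_nonneg (K n m : ℕ) : 0 ≤ confWidth K n m := Real.sqrt_nonneg _

theorem not_eliminatesAt_zero {K n : ℕ} (p : Fin K → ℕ → ℝ) (k l : Fin K) :
    ¬ EliminatesAt n p k l 0 := by
  have := confWidth_nonneg K n 0
  simp only [EliminatesAt, rHat]
  simp
  linarith

namespace AccurateComparisons

variable {K n : ℕ} {lam : Fin K → ℝ} {p : Fin K → ℕ → ℝ}

/-- The earlier type wins a comparison with probability at least `1 / 2`, so accuracy gives `rHat p
l k m > 1 / 2 - confWidth K n m`; the two winning fractions add up to at most one. -/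
theorem not_eliminatesAt (hG : AccurateComparisons n lam p) (hpos : ∀ k, 0 < lam k)
    (hmono : Monotone lam) {k l : Fin K} (hlk : l < k) {m : ℕ} (hm : m ≤ n) :
    ¬ EliminatesAt n p k l m := by
  rcases Nat.eq_zero_or_pos m with rfl | hm0
  · exact not_eliminatesAt_zero p k l
  · have h1 := hG l k hlk m (Finset.mem_Icc.2 ⟨hm0, hm⟩)
    have h2 := rHat_add_rHat_le_one p k l m
    have h3 : 1 / 2 ≤ lam k / (lam k + lam l) := by
      rw [div_le_div_iff₀ two_pos (add_pos (hpos k) (hpos l))]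
      linarith [hmono hlk.le]
    rw [EliminatesAt]
    linarith

theorem not_eliminates (hG : AccurateComparisons n lam p) (hpos : ∀ k, 0 < lam k)
    (hmono : Monotone lam) {h : List (Fin K × ℕ)} (hh : IsHistory n h) {k l : Fin K}
    (hlk : l < k) : ¬ Eliminates n p h k l :=
  hG.not_eliminatesAt hpos hmono hlk ((min_le_left _ _).trans (hh.numDone_le k))

end AccurateComparisons

/-- The candidates are led by a type `l` that precedes all remaining types: none of them is
eliminated by `l`, and if `l` is not a candidate any more, then each of them has just one job
left. -/
def IsLed {K : ℕ} (n : ℕ) (p : Fin K → ℕ → ℝ) (h : List (Fin K × ℕ)) (A : Finset (Fin K)) : Prop :=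
  ∃ l, (∀ u ∈ remaining n h, l ≤ u) ∧ (∀ k ∈ A, k ≠ l → ¬ Eliminates n p h l k) ∧
    (l ∈ A ∨ ((∀ k ∈ A, numDone h k + 1 = n) ∧ numDone h l = n))

section ETCGood

variable {K n : ℕ} {lam : Fin K → ℝ} {p : Fin K → ℕ → ℝ} {h : List (Fin K × ℕ)}
  {A : Finset (Fin K)}

/-- The smallest remaining type is eliminated by no other remaining type, so it belongs to the
refilled set and leads it. In particular the fallback to all remaining types never occurs on the
accurate event. -/
theorem isLed_refill (hG : AccurateComparisons n lam p) (hpos : ∀ k, 0 < lam k)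
    (hmono : Monotone lam) (hh : IsHistory n h) (hr : (remaining n h).Nonempty)
    (hA : A.Nonempty → IsLed n p h A) : IsLed n p h (refill n p h A) := by
  classical
  unfold refill
  split_ifs with h1 h2
  · exact hA h1
  all_goals
    obtain ⟨l, hl, hmin⟩ := (remaining n h).exists_min_image id hr
    have hl' : l ∈ uneliminated n p h (remaining n h) :=
      mem_uneliminated.2 ⟨hl, fun k hk hkl =>
        hG.not_eliminates hpos hmono hh (lt_of_le_of_ne (hmin k hk) hkl.symm)⟩
  · exact ⟨l, hmin, fun k hk hkl => (mem_uneliminated.1 hk).2 l hl hkl.symm, Or.inl hl'⟩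
  · exact absurd ⟨l, hl'⟩ h2

/-- Later types cannot eliminate the leader, so it leaves the candidates only by running out of
jobs. Its last job was selected with minimal count `n - 1`, hence every candidate that survives has
exactly one job left. -/
theorem isLed_step (hG : AccurateComparisons n lam p) (hpos : ∀ k, 0 < lam k)
    (hmono : Monotone lam) (hh : IsHistory n h) (hAr : A ⊆ remaining n h)
    (hA : IsLed n p h A) {k : Fin K} (hk : k ∈ argminSet A (fun k => (numDone h k : ℝ))) :
    IsLed n p (runNext h k) (uneliminated n p (runNext h k) A ∩ remaining n (runNext h k)) := by
  obtain ⟨hkA, hkmin⟩ := mem_argminSet.1 hk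
  have hh' := hh.runNext (hAr hkA)
  obtain ⟨l, h1, h2, h3⟩ := hA
  have h4 : ∀ u ∈ remaining n (runNext h k), l ≤ u := fun u hu => by
    refine h1 u ?_
    rw [mem_remaining, numDone_runNext] at hu
    exact mem_remaining.2 (by omega)
  rcases h3 with h3 | ⟨h3, h5⟩
  · refine ⟨l, h4, fun j hj hjl => ?_, ?_⟩
    · exact (mem_uneliminated.1 (Finset.mem_inter.1 hj).1).2 l h3 hjl.symm
    · by_cases hl : l ∈ remaining n (runNext h k)
      · refine Or.inl (Finset.mem_inter.2 ⟨mem_uneliminated.2 ⟨h3, fun j hj hjl => ?_⟩, hl⟩)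
        exact hG.not_eliminates hpos hmono hh' (lt_of_le_of_ne (h1 j (hAr hj)) hjl.symm)
      · have h6 := mem_remaining.1 (hAr h3)
        rw [mem_remaining, numDone_runNext] at hl
        have hkl : k = l := by
          by_contra hkl
          simp only [hkl, if_false] at hl
          omega
        subst hkl
        simp only [if_true] at hl
        refine Or.inr ⟨fun j hj => ?_, ?_⟩
        · have hj1 := mem_remaining.1 (Finset.mem_inter.1 hj).2
          have hj2 := hkmin j (mem_uneliminated.1 (Finset.mem_inter.1 hj).1).1
          have hj3 : numDone h k ≤ numDone h j := by exact_mod_cast hj2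
          rw [numDone_runNext] at hj1 ⊢
          omega
        · rw [numDone_runNext_self]
          omega
  -- The leader is already exhausted: `k` runs its last job and drops out, while the counts of `l`
  -- and of the other candidates, and hence their comparisons, do not change.
  · have hkl : k ≠ l := by
      rintro rfl
      have := h3 k hkA
      omega
    have h7 : ∀ j ∈ uneliminated n p (runNext h k) A ∩ remaining n (runNext h k),
        j ∈ A ∧ k ≠ j := fun j hj => by
      refine ⟨(mem_uneliminated.1 (Finset.mem_inter.1 hj).1).1, ?_⟩
      rintro rfl
      have hj1 := mem_remaining.1 (Finset.mem_inter.1 hj).2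
      rw [numDone_runNext_self, h3 k hkA] at hj1
      omega
    refine ⟨l, h4, fun j hj hjl => ?_, Or.inr ⟨fun j hj => ?_, ?_⟩⟩
    · rw [Eliminates, numDone_runNext_of_ne _ hkl, numDone_runNext_of_ne _ (h7 j hj).2]
      exact h2 j (h7 j hj).1 hjl
    · rw [numDone_runNext_of_ne _ (h7 j hj).2]
      exact h3 j (h7 j hj).1
    · rw [numDone_runNext_of_ne _ hkl, h5]

theorem isLed_etcuRun (hG : AccurateComparisons n lam p) (hpos : ∀ k, 0 < lam k)
    (hmono : Monotone lam) {tie : List (Fin K × ℕ) → Finset (Fin K) → Fin K}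
    (htie : ∀ h S, S.Nonempty → tie h S ∈ S) {t : ℕ} (ht : t < K * n) :
    IsLed n p (etcuRun n tie p t).1
      (refill n p (etcuRun n tie p t).1 (etcuRun n tie p t).2) := by
  induction t with
  | zero =>
    refine isLed_refill hG hpos hmono IsHistory.nil (IsHistory.nil.remaining_nonempty ht) ?_
    exact fun h => absurd h (by simp [etcuRun])
  | succ t ih =>
    obtain ⟨h1, h2, h3⟩ := etcuRun_isHistory (n := n) htie p (t := t) (by omega)
    obtain ⟨k, hk, hkr, h4⟩ := etcuStep_spec htie p h3 (h1.remaining_nonempty (by omega))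
    obtain ⟨h1', h2', -⟩ := etcuRun_isHistory htie p ht.le
    refine isLed_refill hG hpos hmono h1' (h1'.remaining_nonempty (by omega)) fun _ => ?_
    rw [etcuRun, h4]
    exact isLed_step hG hpos hmono h1 (refill_subset h3) (ih (by omega)) hk

-- Only the pair of the running type `k` and its leader `l` is charged. The remaining types below
-- `k` lie in `Finset.Ico l k`, candidates or not, and each costs at most `n * (lam k - lam l)`.
-- Since `l` has at least as many completed jobs as `k`, their last comparison used exactly the
-- completed jobs of `k`.
open Classical in
theorem excess_etcuRun_le (hG : AccurateComparisons n lam p) (hpos : ∀ k, 0 < lam k)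
    (hmono : Monotone lam) {tie : List (Fin K × ℕ) → Finset (Fin K) → Fin K}
    (htie : ∀ h S, S.Nonempty → tie h S ∈ S) :
    excess (fun k _ => lam k) (etcuRun n tie p (K * n)).1 ≤
      ∑ k : Fin K, ∑ m ∈ Finset.range n, ∑ l : Fin K with l < k,
        n * (((k : ℕ) : ℝ) - ((l : ℕ) : ℝ)) * (lam k - lam l)
          * if EliminatesAt n p l k m then 0 else 1 := by
  refine (isAlgorithm_etcuRun htie).excess_run_le p lam
    (fun k m => ∑ l : Fin K with l < k, n * (((k : ℕ) : ℝ) - ((l : ℕ) : ℝ)) * (lam k - lam l)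
          * if EliminatesAt n p l k m then 0 else 1) fun t ht k _ hstep => ?_
  obtain ⟨h1, h2, h3⟩ := etcuRun_isHistory htie p (t := t) ht.le
  obtain ⟨k', hk', hkr, h4⟩ := etcuStep_spec htie p h3 (h1.remaining_nonempty (by omega))
  obtain rfl : k' = k := runNext_injective ((congrArg Prod.fst h4).symm.trans hstep)
  obtain ⟨l, hl, hl2, hl3⟩ := isLed_etcuRun hG hpos hmono htie ht
  set h := (etcuRun n tie p t).1
  obtain ⟨hkA, hkmin⟩ := mem_argminSet.1 hk'
  have hnonneg : ∀ l ∈ Finset.univ.filter (· < k'),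
      0 ≤ n * (((k' : ℕ) : ℝ) - ((l : ℕ) : ℝ)) * (lam k' - lam l)
          * if EliminatesAt n p l k' (numDone h k') then 0 else 1 := by
    intro l hl
    have h5 : l < k' := (Finset.mem_filter.1 hl).2
    have h6 : ((l : ℕ) : ℝ) ≤ ((k' : ℕ) : ℝ) := by exact_mod_cast h5.le
    have h7 := hmono h5.le
    refine mul_nonneg (mul_nonneg (mul_nonneg (Nat.cast_nonneg n) (by linarith)) (by linarith)) ?_
    split_ifs <;> norm_num
  have hzero : ∀ u, k' ≤ u → max (lam k' - lam u) 0 = 0 := fun u hu =>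
    max_eq_right (by linarith [hmono hu])
  rcases (hl k' hkr).eq_or_lt with rfl | hlk
  · rw [Finset.sum_eq_zero fun u hu => by rw [hzero u (hl u hu), mul_zero]]
    exact Finset.sum_nonneg hnonneg
  · refine le_trans ?_ (Finset.single_le_sum hnonneg
      (Finset.mem_filter.2 ⟨Finset.mem_univ l, hlk⟩))
    have hmin : min (numDone h l) (numDone h k') = numDone h k' := by
      refine min_eq_right ?_
      rcases hl3 with hl3 | ⟨-, hl4⟩
      · exact_mod_cast hkmin l hl3
      · rw [hl4]
        exact h1.numDone_le k'
    have h5 := hl2 k' hkA hlk.ne'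
    rw [Eliminates, hmin] at h5
    rw [if_neg (show ¬ EliminatesAt n p l k' (numDone h k') from h5), mul_one]
    have h6 : ∑ u ∈ remaining n h, n * max (lam k' - lam u) 0
        ≤ ∑ u ∈ Finset.Ico l k', n * (lam k' - lam l) := by
      have h7 : ∑ u ∈ remaining n h, (n : ℝ) * max (lam k' - lam u) 0
          ≤ ∑ u ∈ Finset.Ici l, (n : ℝ) * max (lam k' - lam u) 0 :=
        Finset.sum_le_sum_of_subset_of_nonneg (fun u hu => Finset.mem_Ici.2 (hl u hu))
          fun u _ _ => by positivity
      refine h7.trans ?_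
      rw [← Finset.sum_subset (s₁ := Finset.Ico l k')]
      · refine Finset.sum_le_sum fun u hu => ?_
        rw [Finset.mem_Ico] at hu
        refine mul_le_mul_of_nonneg_left (max_le ?_ ?_) (Nat.cast_nonneg n)
        · linarith [hmono hu.1]
        · linarith [hmono hlk.le]
      · intro u hu
        exact Finset.mem_Ici.2 (Finset.mem_Ico.1 hu).1
      · intro u hu hu'
        rw [Finset.mem_Ici] at hu
        rw [hzero u, mul_zero]
        by_contra hku
        exact hu' (Finset.mem_Ico.2 ⟨hu, not_le.1 hku⟩)
    refine h6.trans (le_of_eq ?_)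
    rw [Finset.sum_const, Fin.card_Ico, nsmul_eq_mul, Nat.cast_sub (by exact_mod_cast hlk.le)]
    ring

end ETCGood

/-- Crude bound that holds for every run, used where the comparisons of ETC-U fail to be accurate:
each job of type `k` pays for all of the at most `K - 1` earlier types. -/
theorem excess_le_of_history {K n : ℕ} {lam : Fin K → ℝ} (hpos : ∀ k, 0 < lam k)
    (hmono : Monotone lam) {run : (Fin K → ℕ → ℝ) → ℕ → List (Fin K × ℕ)}
    (hrun : IsAlgorithm n run) (p : Fin K → ℕ → ℝ) :
    excess (fun k _ => lam k) (run p (K * n)) ≤ (n : ℝ) ^ 2 * ((K - 1) * ∑ k, lam k) := by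
  have h1 := hrun.excess_run_le p lam (fun k _ => ∑ l : Fin K with l < k, n * (lam k - lam l))
    fun t _ k _ _ => ?_
  · refine h1.trans ?_
    simp only [Finset.sum_const, Finset.card_range, nsmul_eq_mul]
    rw [← Finset.mul_sum, sq, mul_assoc]
    refine mul_le_mul_of_nonneg_left ?_ (Nat.cast_nonneg n)
    simp only [← Finset.mul_sum]
    refine mul_le_mul_of_nonneg_left ?_ (Nat.cast_nonneg n)
    rw [Finset.mul_sum]
    refine Finset.sum_le_sum fun k _ => ?_
    refine (Finset.sum_le_sum (g := fun _ => lam k) fun l _ => by linarith [hpos l]).trans ?_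
    rw [Finset.sum_const, nsmul_eq_mul]
    refine mul_le_mul_of_nonneg_right ?_ (hpos k).le
    have h2 : (Finset.univ.filter (· < k)).card = (k : ℕ) := by
      have : Finset.univ.filter (· < k) = Finset.Iio k := by ext; simp
      rw [this, Fin.card_Iio]
    have h3 : ((k : ℕ) : ℝ) + 1 ≤ K := by exact_mod_cast k.2
    rw [h2]
    linarith
  · rw [Finset.sum_filter]
    refine (Finset.sum_le_sum_of_subset_of_nonneg (Finset.subset_univ _)
      fun _ _ _ => by positivity).trans (Finset.sum_le_sum fun l _ => ?_)
    split_ifs with hl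
    · rw [max_eq_left (by linarith [hmono hl.le])]
    · rw [max_eq_right (by linarith [hmono (not_lt.1 hl)]), mul_zero]

/-! ### The Gamma distribution -/

theorem integral_gammaMeasure {a r : ℝ} (ha : 0 < a) (hr : 0 < r) (f : ℝ → ℝ) :
    ∫ x, f x ∂gammaMeasure a r
      = ∫ x in Set.Ioi 0, (r ^ a / Real.Gamma a * x ^ (a - 1) * Real.exp (-(r * x))) * f x := by
  rw [gammaMeasure, integral_withDensity_eq_integral_toReal_smul (f := gammaPDF a r)
    ((measurable_gammaPDFReal a r).ennreal_ofReal) (by simp [gammaPDF]), ← integral_Ici_eq_integral_Ioi,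
    ← integral_indicator measurableSet_Ici]
  congr 1
  ext x
  rw [gammaPDF, ENNReal.toReal_ofReal (gammaPDFReal_nonneg ha hr x), gammaPDFReal]
  by_cases hx : 0 ≤ x <;> simp [hx]

theorem integrable_gammaMeasure_iff {a r : ℝ} (ha : 0 < a) (hr : 0 < r) (f : ℝ → ℝ) :
    Integrable f (gammaMeasure a r) ↔
      IntegrableOn (fun x => (r ^ a / Real.Gamma a * x ^ (a - 1) * Real.exp (-(r * x))) * f x)
        (Set.Ioi 0) := by
  rw [gammaMeasure, integrable_withDensity_iff_integrable_smul' (f := gammaPDF a r)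
    ((measurable_gammaPDFReal a r).ennreal_ofReal) (by simp [gammaPDF]), ← integrableOn_Ici_iff_integrableOn_Ioi,
    ← integrable_indicator_iff measurableSet_Ici]
  refine iff_of_eq (congrArg (fun g => Integrable g volume) ?_)
  ext x
  rw [gammaPDF, ENNReal.toReal_ofReal (gammaPDFReal_nonneg ha hr x), gammaPDFReal]
  by_cases hx : 0 ≤ x <;> simp [hx]

theorem mgf_gammaMeasure_of_lt {a r t : ℝ} (ha : 0 < a) (hr : 0 < r) (ht : t < r) :
    mgf id (gammaMeasure a r) t = (r / (r - t)) ^ a := by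
  have hrt : 0 < r - t := by linarith
  have h1 : ∀ x : ℝ, (r ^ a / Real.Gamma a * x ^ (a - 1) * Real.exp (-(r * x))) * Real.exp (t * id x)
      = r ^ a / Real.Gamma a * (x ^ (a - 1) * Real.exp (-((r - t) * x))) := fun x => by
    rw [mul_assoc, ← Real.exp_add, mul_assoc]
    congr 4
    simp only [id]
    ring
  rw [mgf, integral_gammaMeasure ha hr]
  simp only [h1]
  rw [integral_const_mul, Real.integral_rpow_mul_exp_neg_mul_Ioi ha hrt, Real.div_rpow hr.le hrt.le,
    Real.div_rpow zero_le_one hrt.le, Real.one_rpow]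
  have := (Real.Gamma_pos_of_pos ha).ne'
  field_simp

/-- Otherwise the integral would have the default value zero, whereas its closed form is positive.
-/
theorem integrable_exp_gammaMeasure {a r t : ℝ} (ha : 0 < a) (hr : 0 < r) (ht : t < r) :
    Integrable (fun x => Real.exp (t * id x)) (gammaMeasure a r) := by
  by_contra h
  have h1 := mgf_gammaMeasure_of_lt ha hr ht
  rw [mgf, integral_undef h] at h1
  have : 0 < (r / (r - t)) ^ a := Real.rpow_pos_of_pos (div_pos hr (by linarith)) _
  linarith

/-- The integral diverges, since its integrand dominates a multiple of `x ^ (a - 1)`, and so takes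
the default value. This range matters because laws are identified below through equality of moment
generating functions on the whole line. -/
theorem mgf_gammaMeasure_of_le {a r t : ℝ} (ha : 0 < a) (hr : 0 < r) (ht : r ≤ t) :
    mgf id (gammaMeasure a r) t = 0 := by
  refine integral_undef fun h => ?_
  rw [integrable_gammaMeasure_iff ha hr] at h
  have hc : 0 < r ^ a / Real.Gamma a :=
    div_pos (Real.rpow_pos_of_pos hr a) (Real.Gamma_pos_of_pos ha)
  refine not_integrableOn_Ioi_rpow (a - 1) ((h.const_mul (r ^ a / Real.Gamma a)⁻¹).mono' ?_ ?_)
  · exact (measurable_id.pow_const (a - 1)).aestronglyMeasurable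
  · refine (ae_restrict_iff' measurableSet_Ioi).2 (Filter.Eventually.of_forall fun x hx => ?_)
    have hx' : 0 < x := hx
    have h1 : 0 ≤ x ^ (a - 1) := Real.rpow_nonneg hx'.le _
    rw [Real.norm_of_nonneg h1]
    have h2 : (r ^ a / Real.Gamma a)⁻¹ *
        ((r ^ a / Real.Gamma a * x ^ (a - 1) * Real.exp (-(r * x))) * Real.exp (t * id x))
        = x ^ (a - 1) * Real.exp ((t - r) * x) := by
      rw [mul_assoc (r ^ a / Real.Gamma a * x ^ (a - 1)), ← Real.exp_add, mul_assoc (r ^ a / _),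
        inv_mul_cancel_left₀ hc.ne']
      congr 2
      simp only [id]
      ring
    rw [h2]
    refine le_mul_of_one_le_right h1 (Real.one_le_exp ?_)
    exact mul_nonneg (by linarith) hx'.le

theorem mgf_gammaMeasure_natCast {m : ℕ} (hm : m ≠ 0) {r : ℝ} (hr : 0 < r) (t : ℝ) :
    mgf id (gammaMeasure m r) t = mgf id (expMeasure r) t ^ m := by
  have hm' : (0 : ℝ) < m := by positivity
  rw [expMeasure]
  rcases lt_or_ge t r with h | h
  · rw [mgf_gammaMeasure_of_lt hm' hr h, mgf_gammaMeasure_of_lt one_pos hr h, Real.rpow_one,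
      Real.rpow_natCast]
  · rw [mgf_gammaMeasure_of_le hm' hr h, mgf_gammaMeasure_of_le one_pos hr h, zero_pow hm]

/-- A real random variable whose moment generating function is the one of a Gamma distribution has
this distribution. -/
theorem map_eq_gammaMeasure_of_mgf {Ω : Type*} [MeasurableSpace Ω] {μ : Measure Ω}
    [IsProbabilityMeasure μ] {X : Ω → ℝ} (hX : AEMeasurable X μ) {a r : ℝ} (ha : 0 < a) (hr : 0 < r)
    (h : mgf X μ = mgf id (gammaMeasure a r)) : μ.map X = gammaMeasure a r := by
  have := isProbabilityMeasure_gammaMeasure ha hr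
  have := Measure.isProbabilityMeasure_map hX
  refine Measure.ext_of_charFun (funext fun t => ?_)
  -- Equality of the real functions extends to the complex moment generating functions on a strip
  -- that contains the imaginary axis, where they are the characteristic functions.
  have h1 := eqOn_complexMGF_of_mgf (μ := gammaMeasure a r) (X := id) h.symm (x := t * Complex.I) (by
    have h2 : Set.Iio r ⊆ interior (integrableExpSet id (gammaMeasure a r)) :=
      interior_maximal (fun t ht => integrable_exp_gammaMeasure ha hr ht) isOpen_Iio
    exact h2 (by simpa using hr))
  rw [complexMGF_mul_I hX, complexMGF_mul_I aemeasurable_id, Measure.map_id] at h1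
  exact h1.symm

theorem map_const_mul_gammaMeasure {a r c : ℝ} (ha : 0 < a) (hr : 0 < r) (hc : 0 < c) :
    (gammaMeasure a r).map (fun x => c * x) = gammaMeasure a (r / c) := by
  have := isProbabilityMeasure_gammaMeasure ha hr
  refine map_eq_gammaMeasure_of_mgf (by fun_prop) ha (div_pos hr hc) (funext fun t => ?_)
  have h1 : mgf (fun x => c * x) (gammaMeasure a r) t = mgf id (gammaMeasure a r) (c * t) :=
    mgf_const_mul (X := id) c
  rw [h1]
  have h2 : c * t < r ↔ t < r / c := by rw [lt_div_iff₀ hc, mul_comm]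
  by_cases h : c * t < r
  · rw [mgf_gammaMeasure_of_lt ha hr h, mgf_gammaMeasure_of_lt ha (div_pos hr hc) (h2.1 h)]
    congr 1
    field_simp
  · rw [mgf_gammaMeasure_of_le ha hr (not_lt.1 h), mgf_gammaMeasure_of_le ha (div_pos hr hc)
      (not_lt.1 fun h' => h (h2.2 h'))]

theorem map_sum_eq_gammaMeasure {Ω ι : Type*} [MeasurableSpace Ω] {μ : Measure Ω}
    [IsProbabilityMeasure μ] {X : ι → Ω → ℝ} (hX : ∀ i, Measurable (X i)) (hind : iIndepFun X μ)
    {r : ℝ} (hr : 0 < r) {s : Finset ι} (hs : s.Nonempty)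
    (hlaw : ∀ i ∈ s, μ.map (X i) = expMeasure r) :
    μ.map (∑ i ∈ s, X i) = gammaMeasure s.card r := by
  have hs' : (0 : ℝ) < s.card := by exact_mod_cast hs.card_pos
  have hm : Measurable (∑ i ∈ s, X i) := by
    rw [Finset.sum_fn]
    exact Finset.measurable_sum s fun i _ => hX i
  refine map_eq_gammaMeasure_of_mgf (μ := μ) hm.aemeasurable hs' hr (funext fun t => ?_)
  rw [hind.mgf_sum hX, Finset.prod_congr rfl (g := fun _ => mgf id (expMeasure r) t),
    Finset.prod_const, mgf_gammaMeasure_natCast hs.card_pos.ne' hr]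
  intro i hi
  rw [← hlaw i hi, mgf_id_map (hX i).aemeasurable]

/-! ### Tail bounds -/

/-- Chernoff's bound. With `w = √(2 * L / m)` the threshold is `m * (1 + w + w ^ 2 / 2)`, and the
exponent `t = w / (1 + w)` turns the moment generating function into `(1 + w) ^ m`. -/
theorem gammaMeasure_ge_le {m L : ℝ} (hm : 0 < m) (hL : 0 ≤ L) :
    (gammaMeasure m 1).real {x | m + √(2 * m * L) + L ≤ x} ≤ Real.exp (-L) := by
  have := isProbabilityMeasure_gammaMeasure hm one_pos
  set w := √(2 * L / m) with hw
  have hw0 : 0 ≤ w := Real.sqrt_nonneg _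
  have hw2 : m * w ^ 2 = 2 * L := by
    rw [hw, Real.sq_sqrt (by positivity)]
    field_simp
  have hmw : √(2 * m * L) = m * w := by
    rw [show 2 * m * L = (m * w) ^ 2 by linear_combination (-m) * hw2,
      Real.sqrt_sq (by positivity)]
  have hs1 : w / (1 + w) < 1 := (div_lt_one (by positivity)).2 (by linarith)
  refine (measure_ge_le_exp_mul_mgf (X := id) _ (t := w / (1 + w)) (by positivity)
    (integrable_exp_gammaMeasure hm one_pos hs1)).trans ?_
  rw [mgf_gammaMeasure_of_lt hm one_pos hs1]
  have h1 : 1 / (1 - w / (1 + w)) = 1 + w := by field_simp; ring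
  rw [h1, Real.rpow_def_of_pos (by positivity), ← Real.exp_add, Real.exp_le_exp, hmw]
  -- This is `x ≤ sinh x` at `x = log (1 + w)`; it makes the total exponent exactly `-m * w ^ 2 / 2
  -- = -L`.
  have h2 : Real.log (1 + w) ≤ w / (1 + w) + w ^ 2 / (2 * (1 + w)) := by
    have h5 := Real.self_le_sinh_iff.2 (Real.log_nonneg (by linarith : 1 ≤ 1 + w))
    rw [Real.sinh_eq, Real.exp_neg, Real.exp_log (by linarith)] at h5
    refine h5.trans (le_of_eq ?_)
    field_simp
    ring
  have h3 : Real.log (1 + w) * m ≤ (w / (1 + w) + w ^ 2 / (2 * (1 + w))) * m :=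
    mul_le_mul_of_nonneg_right h2 hm.le
  refine (add_le_add_right h3 _).trans (le_of_eq ?_)
  have h4 : L = m * w ^ 2 / 2 := by linarith
  rw [h4]
  field_simp
  ring

/-- Chernoff's bound with `t = -w`, where `m * w ^ 2 = 2 * L`; it rests on `w - w ^ 2 / 2 ≤ log (1 +
w)`. -/
theorem gammaMeasure_le_le {m L : ℝ} (hm : 0 < m) (hL : 0 ≤ L) :
    (gammaMeasure m 1).real {x | x ≤ m - √(2 * m * L)} ≤ Real.exp (-L) := by
  have := isProbabilityMeasure_gammaMeasure hm one_pos
  set w := √(2 * L / m) with hw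
  have hw0 : 0 ≤ w := Real.sqrt_nonneg _
  have hw2 : m * w ^ 2 = 2 * L := by
    rw [hw, Real.sq_sqrt (by positivity)]
    field_simp
  have hmw : √(2 * m * L) = m * w := by
    rw [show 2 * m * L = (m * w) ^ 2 by linear_combination (-m) * hw2,
      Real.sqrt_sq (by positivity)]
  refine (measure_le_le_exp_mul_mgf (X := id) _ (t := -w) (by linarith)
    (integrable_exp_gammaMeasure hm one_pos (by linarith))).trans ?_
  rw [mgf_gammaMeasure_of_lt hm one_pos (by linarith), Real.rpow_def_of_pos
    (one_div_pos.2 (by linarith)), ← Real.exp_add, Real.exp_le_exp, hmw]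
  have h2 : Real.log (1 / (1 - -w)) ≤ -w + w ^ 2 / 2 := by
    rw [sub_neg_eq_add, one_div, Real.log_inv]
    have h5 := Real.le_log_one_add_of_nonneg hw0
    have h6 : w - w ^ 2 / 2 ≤ 2 * w / (w + 2) := by
      rw [le_div_iff₀ (by linarith)]
      nlinarith [pow_nonneg hw0 3]
    linarith
  have h3 := mul_le_mul_of_nonneg_right h2 hm.le
  nlinarith

theorem gammaMeasure_Iic_zero (a r : ℝ) : gammaMeasure a r (Set.Iic 0) = 0 := by
  rw [gammaMeasure, withDensity_apply _ measurableSet_Iic,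
    setLIntegral_congr Iio_ae_eq_Iic.symm, lintegral_gammaPDF_of_nonpos le_rfl]

theorem ae_pos_gammaMeasure (a r : ℝ) : ∀ᵐ x ∂gammaMeasure a r, 0 < x := by
  rw [ae_iff]
  refine measure_mono_null (fun x hx => ?_) (gammaMeasure_Iic_zero a r)
  simpa using hx

/-! ### Quantiles of the `χ²` distribution -/

section Quantile

variable {m : ℕ} {q : ℝ}

theorem chiSqMeasure_two_mul (m : ℕ) : chiSqMeasure (2 * m) = gammaMeasure m (1 / 2) := by
  rw [chiSqMeasure]
  congr 1
  push_cast
  ring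

theorem nonneg_of_le_cdf_chiSqMeasure (hm : m ≠ 0) (hq : 0 < q) {x : ℝ}
    (hx : q ≤ cdf (chiSqMeasure (2 * m)) x) : 0 < x := by
  rw [chiSqMeasure_two_mul] at hx
  have := isProbabilityMeasure_gammaMeasure (a := m) (by positivity) (one_half_pos (α := ℝ))
  by_contra hx0
  have h1 : (gammaMeasure m (1 / 2)) (Set.Iic x) = 0 :=
    measure_mono_null (Set.Iic_subset_Iic.2 (not_lt.1 hx0)) (gammaMeasure_Iic_zero _ _)
  rw [cdf_eq_real, measureReal_def, h1] at hx
  simp at hx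
  linarith

theorem chiSqQuantile_le (hm : m ≠ 0) (hq : 0 < q) {x : ℝ}
    (hx : q ≤ cdf (chiSqMeasure (2 * m)) x) : chiSqQuantile (2 * m) q ≤ x :=
  csInf_le ⟨0, fun _ hy => (nonneg_of_le_cdf_chiSqMeasure hm hq hy).le⟩ hx

/-- The infimum that defines the quantile is attained, by right continuity of the distribution
function; `q < 1` makes the set nonempty. -/
theorem le_cdf_chiSqQuantile (hq1 : q < 1) :
    q ≤ cdf (chiSqMeasure (2 * m)) (chiSqQuantile (2 * m) q) := by
  have hne : {x : ℝ | q ≤ cdf (chiSqMeasure (2 * m)) x}.Nonempty := by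
    have h1 := tendsto_cdf_atTop (chiSqMeasure (2 * m))
    exact (h1.eventually (eventually_ge_nhds hq1)).exists
  refine ge_of_tendsto
    (((cdf (chiSqMeasure (2 * m))).right_continuous (chiSqQuantile (2 * m) q)).mono_left
      (nhdsWithin_mono _ Set.Ioi_subset_Ici_self)) ?_
  filter_upwards [self_mem_nhdsWithin] with y hy
  obtain ⟨z, hz, hzy⟩ := exists_lt_of_csInf_lt hne (show sInf _ < y from hy)
  exact le_trans hz (monotone_cdf _ hzy.le)

theorem chiSqQuantile_pos (hm : m ≠ 0) (hq : 0 < q) (hq1 : q < 1) :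
    0 < chiSqQuantile (2 * m) q :=
  nonneg_of_le_cdf_chiSqMeasure hm hq (le_cdf_chiSqQuantile (m := m) hq1)

theorem chiSqMeasure_Ioi_chiSqQuantile_le (hm : m ≠ 0) (hq1 : q < 1) :
    (chiSqMeasure (2 * m)).real (Set.Ioi (chiSqQuantile (2 * m) q)) ≤ 1 - q := by
  have h1 := le_cdf_chiSqQuantile (m := m) hq1
  have : IsProbabilityMeasure (chiSqMeasure (2 * m)) := by
    rw [chiSqMeasure_two_mul]
    exact isProbabilityMeasure_gammaMeasure (by positivity) one_half_pos
  rw [cdf_eq_real] at h1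
  rw [← Set.compl_Iic, probReal_compl_eq_one_sub measurableSet_Iic]
  linarith

/-- The upper tail bound for rate `1`, scaled by two: `χ²` with `2 * m` degrees of freedom is twice
a Gamma variable of shape `m`. -/
theorem chiSqQuantile_le_of_exp {L : ℝ} (hm : m ≠ 0) (hL : 0 < L) :
    chiSqQuantile (2 * m) (1 - Real.exp (-L)) ≤ 2 * (m + √(2 * m * L) + L) := by
  have hm' : (0 : ℝ) < m := by positivity
  have h0 : Real.exp (-L) < 1 := Real.exp_lt_one_iff.2 (by linarith)
  refine chiSqQuantile_le hm (by linarith) ?_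
  have h1 := gammaMeasure_ge_le hm' hL.le
  have h2 := map_const_mul_gammaMeasure hm' one_pos (two_pos (α := ℝ))
  have := isProbabilityMeasure_gammaMeasure hm' (one_half_pos (α := ℝ))
  have := isProbabilityMeasure_gammaMeasure hm' (one_pos (α := ℝ))
  rw [chiSqMeasure_two_mul, cdf_eq_real, ← h2,
    map_measureReal_apply (by fun_prop) measurableSet_Iic]
  have h3 : (fun x : ℝ => 2 * x) ⁻¹' Set.Iic (2 * (m + √(2 * m * L) + L))
      = Set.Iic (m + √(2 * m * L) + L) := by
    ext x
    simp
  rw [h3, ← compl_compl (Set.Iic _), probReal_compl_eq_one_sub measurableSet_Iic.compl,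
    Set.compl_Iic]
  have h4 := measureReal_mono (μ := gammaMeasure m 1)
    (s₁ := Set.Ioi (m + √(2 * m * L) + L)) (s₂ := {x | m + √(2 * m * L) + L ≤ x})
    (fun x hx => le_of_lt (Set.mem_Ioi.1 hx))
  linarith

end Quantile

/-! ### The exponential distribution -/

theorem expMeasure_real_Ioi {r t : ℝ} (hr : 0 < r) (ht : 0 ≤ t) :
    (expMeasure r).real (Set.Ioi t) = Real.exp (-(r * t)) := by
  have := isProbabilityMeasure_expMeasure hr
  have h1 := cdf_expMeasure_eq hr t
  rw [cdf_eq_real, if_pos ht] at h1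
  rw [← Set.compl_Iic, probReal_compl_eq_one_sub measurableSet_Iic, h1]
  ring

theorem integral_id_expMeasure {r : ℝ} (hr : 0 < r) : ∫ x, x ∂expMeasure r = r⁻¹ := by
  rw [expMeasure, integral_gammaMeasure one_pos hr]
  have h := Real.integral_rpow_mul_exp_neg_mul_Ioi (two_pos (α := ℝ)) hr
  have h1 : ∀ x : ℝ, r ^ (1 : ℝ) / Real.Gamma 1 * x ^ ((1 : ℝ) - 1) * Real.exp (-(r * x)) * x
      = r * (x ^ ((2 : ℝ) - 1) * Real.exp (-(r * x))) := fun x => by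
    norm_num
    ring
  simp only [h1]
  rw [integral_const_mul, h, Real.Gamma_two, mul_one, one_div, Real.inv_rpow hr.le]
  norm_num
  field_simp

theorem integrable_id_expMeasure {r : ℝ} (hr : 0 < r) : Integrable (fun x => x) (expMeasure r) := by
  by_contra h
  have h1 := integral_id_expMeasure hr
  rw [integral_undef h] at h1
  exact (inv_pos.2 hr).ne h1

section Pair

variable {Ω : Type*} [MeasurableSpace Ω] {μ : Measure Ω} {X Y : Ω → ℝ}
  {r s : ℝ}

/-- Layer-cake formula: by independence the minimum exceeds `t` with probability `exp (-(r + s) *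
t)`. -/
theorem integral_min_of_expMeasure (hX : Measurable X) (hY : Measurable Y) (hind : IndepFun X Y μ)
    (hr : 0 < r) (hs : 0 < s) (hXl : μ.map X = expMeasure r) (hYl : μ.map Y = expMeasure s) :
    ∫ ω, min (X ω) (Y ω) ∂μ = (r + s)⁻¹ := by
  have hiX : Integrable X μ := by
    have h := integrable_id_expMeasure hr
    rw [← hXl, integrable_map_measure (by fun_prop) hX.aemeasurable] at h
    exact h
  have hiY : Integrable Y μ := by
    have h := integrable_id_expMeasure hs
    rw [← hYl, integrable_map_measure (by fun_prop) hY.aemeasurable] at h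
    exact h
  have hX0 : ∀ᵐ ω ∂μ, 0 < X ω :=
    ae_of_ae_map hX.aemeasurable (by rw [hXl]; exact ae_pos_gammaMeasure _ _)
  have hY0 : ∀ᵐ ω ∂μ, 0 < Y ω :=
    ae_of_ae_map hY.aemeasurable (by rw [hYl]; exact ae_pos_gammaMeasure _ _)
  have hint : Integrable (fun ω => min (X ω) (Y ω)) μ := hiX.inf hiY
  rw [hint.integral_eq_integral_meas_lt (by
    filter_upwards [hX0, hY0] with ω h1 h2 using (lt_min h1 h2).le)]
  have h1 : ∀ t ∈ Set.Ioi (0 : ℝ), μ.real {a | t < min (X a) (Y a)}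
      = Real.exp (-(r + s) * t) := fun t ht => by
    have h2 : {a | t < min (X a) (Y a)} = X ⁻¹' Set.Ioi t ∩ Y ⁻¹' Set.Ioi t := by
      ext a; simp
    have h3 := hind.measure_inter_preimage_eq_mul _ _ (measurableSet_Ioi (a := t))
      (measurableSet_Ioi (a := t))
    have ht' : 0 ≤ t := le_of_lt ht
    rw [h2, measureReal_def, h3, ENNReal.toReal_mul, ← measureReal_def, ← measureReal_def,
      ← map_measureReal_apply hX measurableSet_Ioi, ← map_measureReal_apply hY measurableSet_Ioi,
      hXl, hYl, expMeasure_real_Ioi hr ht', expMeasure_real_Ioi hs ht', ← Real.exp_add]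
    congr 1
    ring
  rw [setIntegral_congr_fun measurableSet_Ioi h1, integral_exp_mul_Ioi (by linarith)]
  rw [mul_zero, Real.exp_zero, neg_div_neg_eq, one_div]

/-- Given `X`, the probability that `Y` is larger is `exp (-s * X)`; its mean is the moment
generating function of `X` at `-s`. -/
theorem measureReal_lt_of_expMeasure [IsProbabilityMeasure μ] (hX : Measurable X) (hY : Measurable Y)
    (hind : IndepFun X Y μ) (hr : 0 < r) (hs : 0 < s) (hXl : μ.map X = expMeasure r)
    (hYl : μ.map Y = expMeasure s) : μ.real {ω | X ω < Y ω} = r / (r + s) := by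
  have := isProbabilityMeasure_expMeasure hr
  have := isProbabilityMeasure_expMeasure hs
  have h1 := (indepFun_iff_map_prod_eq_prod_map_map hX.aemeasurable hY.aemeasurable).1 hind
  have hS : MeasurableSet {z : ℝ × ℝ | z.1 < z.2} := measurableSet_lt measurable_fst measurable_snd
  have h2 : {ω | X ω < Y ω} = (fun ω => (X ω, Y ω)) ⁻¹' {z : ℝ × ℝ | z.1 < z.2} := rfl
  rw [h2, ← map_measureReal_apply (hX.prodMk hY) hS, h1, hXl, hYl, measureReal_def,
    Measure.prod_apply hS]
  have h3 : ∫⁻ x, (expMeasure s) (Prod.mk x ⁻¹' {z : ℝ × ℝ | z.1 < z.2}) ∂expMeasure r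
      = ∫⁻ x, ENNReal.ofReal (Real.exp (-s * id x)) ∂expMeasure r := by
    refine lintegral_congr_ae ?_
    filter_upwards [ae_pos_gammaMeasure 1 r] with x hx
    have h4 : Prod.mk x ⁻¹' {z : ℝ × ℝ | z.1 < z.2} = Set.Ioi x := by ext; simp
    rw [h4, ← ENNReal.ofReal_toReal (measure_ne_top (expMeasure s) (Set.Ioi x)),
      ← measureReal_def, expMeasure_real_Ioi hs hx.le]
    congr 2
    simp
  have h5 := mgf_gammaMeasure_of_lt one_pos hr (by linarith : -s < r)
  rw [h3, expMeasure, ← ofReal_integral_eq_lintegral_ofReal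
    (integrable_exp_gammaMeasure one_pos hr (by linarith))
    (Filter.Eventually.of_forall fun _ => (Real.exp_pos _).le),
    ENNReal.toReal_ofReal (integral_nonneg fun _ => (Real.exp_pos _).le)]
  rw [mgf, Real.rpow_one, sub_neg_eq_add] at h5
  exact h5

end Pair

/-! ### Measurability of functions with countably many values -/

section Fibers

variable {X S S' : Type*} [MeasurableSpace X]

theorem measurableSet_fiber_comp [Countable S] {f : X → S} {g : X → S → S'}
    (hf : ∀ s, MeasurableSet {x | f x = s}) (hg : ∀ s s', MeasurableSet {x | g x s = s'}) (s' : S') :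
    MeasurableSet {x | g x (f x) = s'} := by
  have : {x | g x (f x) = s'} = ⋃ s, {x | f x = s} ∩ {x | g x s = s'} := by
    ext x; simp
  rw [this]
  exact MeasurableSet.iUnion fun s => (hf s).inter (hg s s')

theorem measurable_comp_of_fiber {β : Type*} [MeasurableSpace β] [Countable S] {f : X → S}
    (hf : ∀ s, MeasurableSet {x | f x = s}) (g : S → β) : Measurable fun x => g (f x) := by
  intro B _
  have : (fun x => g (f x)) ⁻¹' B = ⋃ s ∈ g ⁻¹' B, {x | f x = s} := by
    ext x; simp
  rw [this]
  exact MeasurableSet.biUnion (Set.to_countable _) fun s _ => hf s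

/-- An iteration depends on the sizes only through the truth values of finitely many measurable
comparisons. -/
theorem measurableSet_fiber_of_decisions {ι : Type*} [Finite ι] {e : X → ι → Prop}
    (he : ∀ i, MeasurableSet {x | e x i}) (F : (ι → Prop) → S) (s : S) :
    MeasurableSet {x | F (e x) = s} := by
  have h1 : ∀ c : ι → Prop, MeasurableSet {x | e x = c} := fun c => by
    have : {x | e x = c} = ⋂ i, {x | e x i ↔ c i} := by
      ext x; simp [funext_iff]
    rw [this]
    exact MeasurableSet.iInter fun i => (he i).iff (MeasurableSet.const _)
  exact measurableSet_fiber_comp (g := fun _ c => F c) h1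
    (fun c s' => MeasurableSet.const _) s

end Fibers

/-! ### Measurability of the runs of ETC-U and UCB-U -/

section RunMeasurable

variable {K n : ℕ} {tie : List (Fin K × ℕ) → Finset (Fin K) → Fin K} {X : Type*}
  [MeasurableSpace X] {p : X → Fin K → ℕ → ℝ}

theorem measurable_rHat (hp : ∀ k i, Measurable fun x => p x k i) (k l : Fin K) (m : ℕ) :
    Measurable fun x => rHat (p x) k l m := by
  simp only [rHat_eq_sum]
  refine (Finset.measurable_sum _ fun i _ => ?_).div_const _
  exact (measurable_one.indicator measurableSet_Ioi).comp ((hp l i).sub (hp k i))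

theorem measurableSet_eliminatesAt (hp : ∀ k i, Measurable fun x => p x k i) (k l : Fin K) (m : ℕ) :
    MeasurableSet {x | EliminatesAt n (p x) k l m} :=
  measurableSet_lt measurable_const ((measurable_rHat hp k l m).sub_const _)

theorem measurableSet_uneliminated (hp : ∀ k i, Measurable fun x => p x k i)
    (h : List (Fin K × ℕ)) (S : Finset (Fin K)) (s : Finset (Fin K)) :
    MeasurableSet {x | uneliminated n (p x) h S = s} := by
  classical
  have h1 := measurableSet_fiber_of_decisions (S := Finset (Fin K))
    (e := fun x (q : Fin K × Fin K) => Eliminates n (p x) h q.1 q.2)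
    (fun q => measurableSet_eliminatesAt hp _ _ _)
    (fun e => S.filter fun l => ∀ k ∈ S, k ≠ l → ¬ e (k, l)) s
  convert! h1 using 4

theorem measurableSet_refill (hp : ∀ k i, Measurable fun x => p x k i)
    (h : List (Fin K × ℕ)) (A : Finset (Fin K)) (s : Finset (Fin K)) :
    MeasurableSet {x | refill n (p x) h A = s} := by
  classical
  exact measurableSet_fiber_comp (f := fun x => uneliminated n (p x) h (remaining n h))
    (g := fun _ c => if A.Nonempty then A else if c.Nonempty then c else remaining n h)
    (measurableSet_uneliminated hp h _) (fun _ _ => MeasurableSet.const _) s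

theorem measurableSet_etcuRun (hp : ∀ k i, Measurable fun x => p x k i) (t : ℕ)
    (s : List (Fin K × ℕ) × Finset (Fin K)) :
    MeasurableSet {x | etcuRun n tie (p x) t = s} := by
  classical
  induction t generalizing s with
  | zero => exact MeasurableSet.const ((([], ∅) : List (Fin K × ℕ) × Finset (Fin K)) = s)
  | succ t ih =>
    refine measurableSet_fiber_comp (g := fun x s => etcuStep n tie (p x) s) ih (fun s s' => ?_) s
    refine measurableSet_fiber_comp (f := fun x => refill n (p x) s.1 s.2)
      (g := fun x A =>
        let h := runNext s.1 (tie s.1 (argminSet A (fun k => (numDone s.1 k : ℝ))))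
        (h, uneliminated n (p x) h A ∩ remaining n h))
      (measurableSet_refill hp _ _) (fun A s' => ?_) s'
    exact measurableSet_fiber_comp (f := fun x => uneliminated n (p x) _ A)
      (g := fun _ B => (runNext s.1 (tie s.1 (argminSet A (fun k => (numDone s.1 k : ℝ)))),
        B ∩ remaining n _))
      (measurableSet_uneliminated hp _ _) (fun _ _ => MeasurableSet.const _) s'

theorem measurable_ucbuIndex (hp : ∀ k i, Measurable fun x => p x k i) (k : Fin K) (m : ℕ) :
    Measurable fun x => ucbuIndex n (p x) k m :=
  ((Finset.measurable_sum _ fun i _ => hp k i).const_mul 2).div_const _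

theorem measurableSet_ucbuRun (hp : ∀ k i, Measurable fun x => p x k i) (t : ℕ)
    (s : List (Fin K × ℕ)) : MeasurableSet {x | ucbuRun n tie (p x) t = s} := by
  classical
  induction t generalizing s with
  | zero => exact MeasurableSet.const (([] : List (Fin K × ℕ)) = s)
  | succ t ih =>
    refine measurableSet_fiber_comp (g := fun x h => ucbuStep n tie (p x) h) ih (fun h s' => ?_) s
    have h1 := measurableSet_fiber_of_decisions (S := List (Fin K × ℕ))
      (e := fun x (q : Fin K × Fin K) =>
        ucbuIndex n (p x) q.1 (numDone h q.1) ≤ ucbuIndex n (p x) q.2 (numDone h q.2))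
      (fun q => measurableSet_le (measurable_ucbuIndex hp _ _) (measurable_ucbuIndex hp _ _))
      (fun e => runNext h (tie h ((remaining n h).filter fun k => ∀ j ∈ remaining n h, e (k, j)))) s'
    convert! h1 using 5

end RunMeasurable

/-! ### The law of the job sizes -/

/-- The job sizes given by a point of the product space, extended by zero. -/
def sizesOf {K n : ℕ} (x : Fin K × Fin n → ℝ) (k : Fin K) (i : ℕ) : ℝ :=
  if h : i < n then x (k, ⟨i, h⟩) else 0

/-- The joint law of the job sizes. -/
noncomputable def jobLaw {K : ℕ} (n : ℕ) (lam : Fin K → ℝ) : Measure (Fin K × Fin n → ℝ) :=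
  Measure.pi fun q => expMeasure (lam q.1)⁻¹

theorem sizesOf_coe {K n : ℕ} (x : Fin K × Fin n → ℝ) (k : Fin K) (i : Fin n) :
    sizesOf x k i = x (k, i) := by
  simp [sizesOf]

theorem sizesOf_of_lt {K n : ℕ} (x : Fin K × Fin n → ℝ) (k : Fin K) {i : ℕ} (hi : i < n) :
    sizesOf x k i = x (k, ⟨i, hi⟩) := by
  simp [sizesOf, hi]

theorem measurable_sizesOf {K n : ℕ} (k : Fin K) (i : ℕ) :
    Measurable fun x : Fin K × Fin n → ℝ => sizesOf x k i := by
  unfold sizesOf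
  split_ifs
  · exact measurable_pi_apply _
  · exact measurable_const

/-- A function of some of the coordinates factors measurably through the restriction to them: the
other coordinates may be set to zero. -/
theorem indepFun_of_dependsOn {ι : Type*} [Fintype ι] {μ : ι → Measure ℝ}
    [∀ i, IsProbabilityMeasure (μ i)] {S T : Finset ι} (hST : Disjoint S T)
    {φ ψ : (ι → ℝ) → ℝ} (hφ : Measurable φ) (hψ : Measurable ψ)
    (hφS : DependsOn φ (S : Set ι)) (hψT : DependsOn ψ (T : Set ι)) :
    IndepFun φ ψ (Measure.pi μ) := by
  classical
  have h1 : iIndepFun (fun i (x : ι → ℝ) => x i) (Measure.pi μ) :=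
    iIndepFun_pi (X := fun _ y => y) fun i => aemeasurable_id
  have h2 := h1.indepFun_finset S T hST fun i => measurable_pi_apply i
  have key : ∀ (U : Finset ι) (f : (ι → ℝ) → ℝ), Measurable f → DependsOn f (U : Set ι) →
      ∃ g : (U → ℝ) → ℝ, Measurable g ∧ f = g ∘ fun x i => x i := by
    intro U f hf hfU
    refine ⟨fun y => f fun i => if h : i ∈ U then y ⟨i, h⟩ else 0, hf.comp ?_, ?_⟩
    · refine measurable_pi_lambda _ fun i => ?_
      split_ifs
      · exact measurable_pi_apply _
      · exact measurable_const
    · funext x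
      refine hfU fun i hi => ?_
      simp [Finset.mem_coe.1 hi]
  obtain ⟨g, hg, rfl⟩ := key S φ hφ hφS
  obtain ⟨g', hg', rfl⟩ := key T ψ hψ hψT
  exact h2.comp hg hg'

section JobLaw

variable {K n : ℕ} {lam : Fin K → ℝ}

theorem isProbabilityMeasure_jobLaw (hpos : ∀ k, 0 < lam k) :
    IsProbabilityMeasure (jobLaw n lam) := by
  have (q : Fin K × Fin n) : IsProbabilityMeasure (expMeasure (lam q.1)⁻¹) :=
    isProbabilityMeasure_expMeasure (inv_pos.2 (hpos q.1))
  unfold jobLaw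
  infer_instance

theorem map_eval_jobLaw (hpos : ∀ k, 0 < lam k) (q : Fin K × Fin n) :
    (jobLaw n lam).map (fun x => x q) = expMeasure (lam q.1)⁻¹ := by
  have (q : Fin K × Fin n) : IsProbabilityMeasure (expMeasure (lam q.1)⁻¹) :=
    isProbabilityMeasure_expMeasure (inv_pos.2 (hpos q.1))
  exact (measurePreserving_eval (fun q : Fin K × Fin n => expMeasure (lam q.1)⁻¹) q).map_eq

theorem integrable_eval_jobLaw (hpos : ∀ k, 0 < lam k) (q : Fin K × Fin n) :
    Integrable (fun x => x q) (jobLaw n lam) := by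
  have h := integrable_id_expMeasure (inv_pos.2 (hpos q.1))
  rw [← map_eval_jobLaw hpos q] at h
  exact (integrable_map_measure (f := fun x : Fin K × Fin n → ℝ => x q) (g := fun y : ℝ => y)
    (by fun_prop) (measurable_pi_apply q).aemeasurable).1 h

theorem integral_eval_jobLaw (hpos : ∀ k, 0 < lam k) (q : Fin K × Fin n) :
    ∫ x, x q ∂jobLaw n lam = lam q.1 := by
  have h := integral_id_expMeasure (inv_pos.2 (hpos q.1))
  rw [← map_eval_jobLaw hpos q, integral_map (measurable_pi_apply q).aemeasurable (by fun_prop),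
    inv_inv] at h
  exact h

theorem indepFun_jobLaw (hpos : ∀ k, 0 < lam k) {S T : Finset (Fin K × Fin n)}
    (hST : Disjoint S T) {φ ψ : (Fin K × Fin n → ℝ) → ℝ} (hφ : Measurable φ) (hψ : Measurable ψ)
    (hφS : DependsOn φ (S : Set (Fin K × Fin n))) (hψT : DependsOn ψ (T : Set (Fin K × Fin n))) :
    IndepFun φ ψ (jobLaw n lam) := by
  have (q : Fin K × Fin n) : IsProbabilityMeasure (expMeasure (lam q.1)⁻¹) :=
    isProbabilityMeasure_expMeasure (inv_pos.2 (hpos q.1))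
  exact indepFun_of_dependsOn hST hφ hψ hφS hψT

theorem dependsOn_eval (q : Fin K × Fin n) :
    DependsOn (fun x : Fin K × Fin n → ℝ => x q) (({q} : Finset (Fin K × Fin n)) : Set _) :=
  fun _ _ h => h q (by simp)

theorem indepFun_eval_jobLaw (hpos : ∀ k, 0 < lam k) {q q' : Fin K × Fin n} (hq : q ≠ q') :
    IndepFun (fun x => x q) (fun x => x q') (jobLaw n lam) :=
  indepFun_jobLaw hpos (S := {q}) (T := {q'}) (by simpa using hq) (measurable_pi_apply q)
    (measurable_pi_apply q') (dependsOn_eval q) (dependsOn_eval q')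

/-- The expected flow time of a non-anticipating schedule does not change if all job sizes are
replaced by their means. -/
theorem integral_flowTime_jobLaw (hpos : ∀ k, 0 < lam k)
    {L : (Fin K × Fin n → ℝ) → List (Fin K × ℕ)} (hperm : ∀ x, (L x).Perm (allJobs K n))
    (hmeas : ∀ s, MeasurableSet {x | L x = s})
    (hidx : ∀ (q : Fin K × Fin n) (x y : Fin K × Fin n → ℝ), (∀ q', q' ≠ q → x q' = y q') →
      (L x).idxOf (q.1, (q.2 : ℕ)) = (L y).idxOf (q.1, (q.2 : ℕ))) :
    Integrable (fun x => flowTime (sizesOf x) (L x)) (jobLaw n lam) ∧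
    Integrable (fun x => flowTime (fun k _ => lam k) (L x)) (jobLaw n lam) ∧
    ∫ x, flowTime (sizesOf x) (L x) ∂jobLaw n lam
      = ∫ x, flowTime (fun k _ => lam k) (L x) ∂jobLaw n lam := by
  classical
  have := isProbabilityMeasure_jobLaw (n := n) hpos
  set c : Fin K × Fin n → (Fin K × Fin n → ℝ) → ℝ :=
    fun q x => ((L x).length : ℝ) - ((L x).idxOf (q.1, (q.2 : ℕ)) : ℝ) with hc
  have hinj : Function.Injective fun q : Fin K × Fin n => (q.1, (q.2 : ℕ)) := by
    rintro ⟨k, i⟩ ⟨l, j⟩ h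
    simp only [Prod.mk.injEq] at h
    rw [h.1, Fin.ext h.2]
  have hflow : ∀ (p : Fin K → ℕ → ℝ) (x : Fin K × Fin n → ℝ),
      flowTime p (L x) = ∑ q : Fin K × Fin n, c q x * p q.1 q.2 := by
    intro p x
    rw [flowTime_eq_sum p ((hperm x).nodup_iff.2 (nodup_allJobs K n))
      (Finset.univ.image fun q : Fin K × Fin n => (q.1, (q.2 : ℕ))),
      Finset.sum_image fun _ _ _ _ h => hinj h]
    intro a ha
    rw [(hperm x).mem_iff, mem_allJobs] at ha
    exact Finset.mem_image.2 ⟨(a.1, ⟨a.2, ha⟩), Finset.mem_univ _, rfl⟩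
  have hcm : ∀ q, Measurable (c q) := fun q =>
    measurable_comp_of_fiber hmeas fun l => (l.length : ℝ) - (l.idxOf (q.1, (q.2 : ℕ)) : ℝ)
  have hlen : ∀ x, (L x).length = (allJobs K n).length := fun x => (hperm x).length_eq
  have hcint : ∀ q, Integrable (c q) (jobLaw n lam) := fun q => by
    refine Integrable.of_bound (hcm q).aestronglyMeasurable ((allJobs K n).length : ℝ)
      (Filter.Eventually.of_forall fun x => ?_)
    have h1 : ((L x).idxOf (q.1, (q.2 : ℕ)) : ℝ) ≤ (L x).length := by
      exact_mod_cast List.idxOf_le_length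
    rw [Real.norm_of_nonneg (by simp only [hc]; linarith), ← hlen x]
    simp only [hc]
    linarith [Nat.cast_nonneg (α := ℝ) ((L x).idxOf (q.1, (q.2 : ℕ)))]
  -- The weight of a job is a function of the sizes of the other jobs only, by `hidx` and because
  -- all lists have the same length.
  have hind : ∀ q, IndepFun (c q) (fun x => x q) (jobLaw n lam) := fun q => by
    refine indepFun_jobLaw hpos (S := Finset.univ.erase q) (T := {q}) (by simp) (hcm q)
      (measurable_pi_apply q) (fun x y h => ?_) (dependsOn_eval q)
    simp only [hc, hlen]
    rw [hidx q x y fun q' hq' => h q' (by simpa using hq')]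
  have hint : ∀ q, Integrable (fun x => c q x * x q) (jobLaw n lam) := fun q =>
    (hind q).integrable_mul (hcint q) (integrable_eval_jobLaw hpos q)
  simp only [hflow, sizesOf_coe]
  refine ⟨integrable_finsetSum _ fun q _ => hint q,
    integrable_finsetSum _ fun q _ => (hcint q).mul_const _, ?_⟩
  rw [integral_finsetSum _ fun q _ => hint q,
    integral_finsetSum _ fun q _ => (hcint q).mul_const _]
  refine Finset.sum_congr rfl fun q _ => ?_
  rw [integral_mul_const, ← integral_eval_jobLaw hpos q]
  exact (hind q).integral_fun_mul_eq_mul_integral (hcm q).aestronglyMeasurable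
    (measurable_pi_apply q).aestronglyMeasurable

theorem integral_costFTPP_jobLaw (hpos : ∀ k, 0 < lam k) :
    Integrable (fun x => costFTPP K n (sizesOf x)) (jobLaw n lam) ∧
    ∫ x, costFTPP K n (sizesOf x) ∂jobLaw n lam
      = flowTime (fun k _ => lam k) (allJobs K n) := by
  have := isProbabilityMeasure_jobLaw (n := n) hpos
  obtain ⟨h1, -, h2⟩ := integral_flowTime_jobLaw (n := n) hpos (L := fun _ => allJobs K n)
    (fun _ => List.Perm.refl _) (fun _ => MeasurableSet.const _) fun _ _ _ _ => rfl
  refine ⟨h1, h2.trans ?_⟩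
  simp

/-- The expected cost of an algorithm is the one of FTPP plus the expected excess. -/
theorem integral_run_jobLaw (hpos : ∀ k, 0 < lam k) (hmono : Monotone lam)
    {run : (Fin K → ℕ → ℝ) → ℕ → List (Fin K × ℕ)} (hrun : IsAlgorithm n run)
    (hmeas : ∀ s, MeasurableSet {x : Fin K × Fin n → ℝ | run (sizesOf x) (K * n) = s}) :
    Integrable (fun x => flowTime (sizesOf x) (run (sizesOf x) (K * n))) (jobLaw n lam) ∧
    Integrable (fun x => excess (fun k _ => lam k) (run (sizesOf x) (K * n))) (jobLaw n lam) ∧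
    ∫ x, flowTime (sizesOf x) (run (sizesOf x) (K * n)) ∂jobLaw n lam
      = ∫ x, costFTPP K n (sizesOf x) ∂jobLaw n lam
        + ∫ x, excess (fun k _ => lam k) (run (sizesOf x) (K * n)) ∂jobLaw n lam := by
  have := isProbabilityMeasure_jobLaw (n := n) hpos
  obtain ⟨h1, h2, h3⟩ := integral_flowTime_jobLaw (n := n) hpos
    (L := fun x => run (sizesOf x) (K * n)) (fun x => hrun.perm_allJobs _) hmeas
    fun q x y hxy => by
      refine hrun.idxOf_congr le_rfl fun b hb => ?_
      unfold sizesOf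
      split_ifs with hi
      · refine (hxy _ fun h => hb ?_).symm
        rw [← h]
      · rfl
  have h4 : ∀ x : Fin K × Fin n → ℝ, flowTime (fun k _ => lam k) (run (sizesOf x) (K * n))
      = flowTime (fun k _ => lam k) (allJobs K n)
        + excess (fun k _ => lam k) (run (sizesOf x) (K * n)) := fun x =>
    flowTime_eq_allJobs_add_excess hmono (hrun.perm_allJobs _)
  simp only [h4] at h2 h3
  have h5 := (integrable_const_add_iff (f := fun x : Fin K × Fin n → ℝ =>
    excess (fun k _ => lam k) (run (sizesOf x) (K * n)))).1 h2
  refine ⟨h1, h5, ?_⟩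
  rw [h3, integral_add (integrable_const _) h5, (integral_costFTPP_jobLaw hpos).2]
  simp

theorem pairMinSum_allJobs (x : Fin K × Fin n → ℝ) :
    pairMinSum (sizesOf x) (allJobs K n)
      = ∑ q : Fin K × Fin n, ∑ q' : Fin K × Fin n, min (x q) (x q') + ∑ q, x q := by
  have h1 : ∀ f : Fin K × ℕ → ℝ,
      ((allJobs K n).map f).sum = ∑ q : Fin K × Fin n, f (q.1, (q.2 : ℕ)) := fun f => by
    rw [sum_map_allJobs, Fintype.sum_prod_type]
    exact Finset.sum_congr rfl fun k _ => (Fin.sum_univ_eq_sum_range (fun i => f (k, i)) n).symm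
  simp only [pairMinSum, h1, sizesOf_coe, Prod.mk.eta]

theorem integral_min_jobLaw (hpos : ∀ k, 0 < lam k) {q q' : Fin K × Fin n} (hq : q ≠ q') :
    ∫ x, min (x q) (x q') ∂jobLaw n lam = ((lam q.1)⁻¹ + (lam q'.1)⁻¹)⁻¹ :=
  integral_min_of_expMeasure (measurable_pi_apply q) (measurable_pi_apply q')
    (indepFun_eval_jobLaw hpos hq) (inv_pos.2 (hpos q.1)) (inv_pos.2 (hpos q'.1))
    (map_eval_jobLaw hpos q) (map_eval_jobLaw hpos q')

/-- Only pairs of the same type are kept. The minimum of two independent sizes of mean `lam k` has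
mean `lam k / 2`, so type `k` contributes `n * (n - 1) / 2 * (lam k / 2) + n * lam k`. -/
theorem integral_costOPT_jobLaw (hpos : ∀ k, 0 < lam k) :
    Integrable (fun x => costOPT K n (sizesOf x)) (jobLaw n lam) ∧
    (n : ℝ) * (n + 3) / 4 * ∑ k, lam k ≤ ∫ x, costOPT K n (sizesOf x) ∂jobLaw n lam := by
  classical
  have := isProbabilityMeasure_jobLaw (n := n) hpos
  have hi1 : ∀ q, Integrable (fun x => x q) (jobLaw n lam) := integrable_eval_jobLaw hpos
  have hi2 : ∀ q q', Integrable (fun x => min (x q) (x q')) (jobLaw n lam) :=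
    fun q q' => (hi1 q).inf (hi1 q')
  have hi3 : Integrable (fun x => ∑ q : Fin K × Fin n, ∑ q' : Fin K × Fin n, min (x q) (x q'))
      (jobLaw n lam) := integrable_finsetSum _ fun q _ => integrable_finsetSum _ fun q' _ => hi2 q q'
  have hi4 : Integrable (fun x => ∑ q : Fin K × Fin n, x q) (jobLaw n lam) :=
    integrable_finsetSum _ fun q _ => hi1 q
  simp only [costOPT_eq, pairMinSum_allJobs]
  refine ⟨(hi3.add hi4).const_mul _, ?_⟩
  rw [integral_const_mul, integral_add hi3 hi4,
    integral_finsetSum _ fun q _ => integrable_finsetSum _ fun q' _ => hi2 q q',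
    integral_finsetSum _ fun q _ => hi1 q]
  simp only [integral_finsetSum _ fun q' _ => hi2 _ q', integral_eval_jobLaw hpos]
  have h1 : ∀ q : Fin K × Fin n, (n + 1) / 2 * lam q.1
      ≤ ∑ q' : Fin K × Fin n, ∫ x, min (x q) (x q') ∂jobLaw n lam := by
    rintro ⟨k, i⟩
    have hnn : ∀ q', 0 ≤ ∫ x, min (x (k, i)) (x q') ∂jobLaw n lam := by
      intro q'
      by_cases hq : (k, i) = q'
      · subst hq
        simp only [min_self, integral_eval_jobLaw hpos]
        exact (hpos k).le
      · rw [integral_min_jobLaw hpos hq]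
        have := hpos k
        have := hpos q'.1
        positivity
    have h2 : ∑ j : Fin n, ∫ x, min (x (k, i)) (x (k, j)) ∂jobLaw n lam
        ≤ ∑ q' : Fin K × Fin n, ∫ x, min (x (k, i)) (x q') ∂jobLaw n lam := by
      rw [Fintype.sum_prod_type]
      exact Finset.single_le_sum
        (f := fun l => ∑ j : Fin n, ∫ x, min (x (k, i)) (x (l, j)) ∂jobLaw n lam)
        (fun l _ => Finset.sum_nonneg fun j _ => hnn _) (Finset.mem_univ k)
    refine le_trans (le_of_eq ?_) h2
    have h3 : ∀ j : Fin n, ∫ x, min (x (k, i)) (x (k, j)) ∂jobLaw n lam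
        = lam k / 2 + if i = j then lam k / 2 else 0 := by
      intro j
      by_cases hij : i = j
      · subst hij
        simp only [min_self, integral_eval_jobLaw hpos, if_true]
        ring
      · have hne : (k, i) ≠ (k, j) := fun h => hij (congrArg Prod.snd h)
        rw [integral_min_jobLaw hpos hne, if_neg hij]
        have := (hpos k).ne'
        field_simp
        ring
    simp only [h3, Finset.sum_add_distrib, Finset.sum_const, Finset.card_univ, Fintype.card_fin,
      nsmul_eq_mul, Finset.sum_ite_eq, Finset.mem_univ, if_true]
    ring
  have h2 := Finset.sum_le_sum fun q (_ : q ∈ Finset.univ) => h1 q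
  rw [← Finset.mul_sum] at h2
  have h3 : ∑ q : Fin K × Fin n, lam q.1 = n * ∑ k, lam k := by
    rw [Fintype.sum_prod_type, Finset.mul_sum]
    simp
  rw [h3] at h2 ⊢
  linarith

end JobLaw

/-! ### Accuracy of the comparisons of ETC-U -/

section Comparisons

variable {K n : ℕ} {lam : Fin K → ℝ}

/-- The indicator of a job of type `l` being shorter than the one of type `k`. -/
noncomputable def shorter (l k : Fin K) (i : ℕ) (x : Fin K × Fin n → ℝ) : ℝ :=
  (Set.Ioi (0 : ℝ)).indicator 1 (sizesOf x k i - sizesOf x l i)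

theorem measurable_shorter (l k : Fin K) (i : ℕ) :
    Measurable (shorter l k i : (Fin K × Fin n → ℝ) → ℝ) :=
  (measurable_one.indicator measurableSet_Ioi).comp
    ((measurable_sizesOf k i).sub (measurable_sizesOf l i))

theorem shorter_mem_Icc (l k : Fin K) (i : ℕ) (x : Fin K × Fin n → ℝ) :
    shorter l k i x ∈ Set.Icc (0 : ℝ) 1 := by
  unfold shorter
  by_cases h : sizesOf x k i - sizesOf x l i ∈ Set.Ioi (0 : ℝ) <;>
    simp only [Set.indicator_apply, h, if_true, if_false] <;> norm_num

theorem integral_shorter (hpos : ∀ k, 0 < lam k) {l k : Fin K} (hlk : l ≠ k) {i : ℕ}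
    (hi : i < n) : ∫ x, shorter l k i x ∂jobLaw n lam = lam k / (lam k + lam l) := by
  have := isProbabilityMeasure_jobLaw (n := n) hpos
  have h1 : (shorter l k i : (Fin K × Fin n → ℝ) → ℝ)
      = {x : Fin K × Fin n → ℝ | x (l, ⟨i, hi⟩) < x (k, ⟨i, hi⟩)}.indicator 1 := by
    funext x
    simp [shorter, Set.indicator_apply, sizesOf_of_lt x _ hi]
  have hne : ((l, ⟨i, hi⟩) : Fin K × Fin n) ≠ (k, ⟨i, hi⟩) := fun h => hlk (congrArg Prod.fst h)
  have hS : MeasurableSet {x : Fin K × Fin n → ℝ | x (l, ⟨i, hi⟩) < x (k, ⟨i, hi⟩)} :=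
    measurableSet_lt (measurable_pi_apply _) (measurable_pi_apply _)
  rw [h1, integral_indicator_one hS,
    measureReal_lt_of_expMeasure (measurable_pi_apply _) (measurable_pi_apply _)
    (indepFun_eval_jobLaw hpos hne) (inv_pos.2 (hpos l)) (inv_pos.2 (hpos k))
    (map_eval_jobLaw hpos _) (map_eval_jobLaw hpos _)]
  have := hpos l
  have := hpos k
  field_simp

/-- Hoeffding's lemma gives parameter `1 / 4` for each indicator, and these add up because different
`i` involve disjoint sets of jobs. -/
theorem hasSubgaussianMGF_shorter (hpos : ∀ k, 0 < lam k) {l k : Fin K} (hlk : l ≠ k) {m : ℕ}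
    (hm : m ≤ n) :
    HasSubgaussianMGF
      (fun x => ∑ i ∈ Finset.range m, (lam k / (lam k + lam l) - shorter l k i x))
      (m * (1 / 4)) (jobLaw n lam) := by
  classical
  have := isProbabilityMeasure_jobLaw (n := n) hpos
  induction m with
  | zero => simp
  | succ m ih =>
    have h1 := (hasSubgaussianMGF_of_mem_Icc (μ := jobLaw n lam) (X := shorter l k m)
      (measurable_shorter l k m).aemeasurable
      (Filter.Eventually.of_forall (shorter_mem_Icc l k m))).neg
    rw [integral_shorter hpos hlk hm] at h1
    have hd : ∀ i < n, ∀ x y : Fin K × Fin n → ℝ,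
        (∀ q : Fin K × Fin n, (q.2 : ℕ) = i → x q = y q) → shorter l k i x = shorter l k i y := by
      intro i hi x y hxy
      simp only [shorter, sizesOf_of_lt _ _ hi]
      rw [hxy (k, ⟨i, hi⟩) rfl, hxy (l, ⟨i, hi⟩) rfl]
    have hind : IndepFun
        (fun x => ∑ i ∈ Finset.range m, (lam k / (lam k + lam l) - shorter l k i x))
        (-fun x => shorter l k m x - lam k / (lam k + lam l)) (jobLaw n lam) := by
      refine indepFun_jobLaw hpos (S := Finset.univ.filter fun q => (q.2 : ℕ) < m)
        (T := Finset.univ.filter fun q => (q.2 : ℕ) = m) ?_ ?_ ?_ ?_ ?_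
      · rw [Finset.disjoint_filter]
        intro q _ h
        exact h.ne
      · exact Finset.measurable_sum _ fun i _ => (measurable_shorter l k i).const_sub _
      · exact ((measurable_shorter l k m).sub_const _).neg
      · intro x y hxy
        refine Finset.sum_congr rfl fun i hi => ?_
        have hi' := Finset.mem_range.1 hi
        rw [hd i (by omega) x y fun q hq => hxy q (by simp [hq, hi'])]
      · intro x y hxy
        simp only [Pi.neg_apply]
        rw [hd m hm x y fun q hq => hxy q (by simp [hq])]
    have h2 := (ih (by omega)).add_of_indepFun h1 hind
    have hc : ((m + 1 : ℕ) : NNReal) * (1 / 4)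
        = m * (1 / 4) + (‖(1 : ℝ) - 0‖₊ / 2) ^ 2 := by
      rw [sub_zero, nnnorm_one]
      push_cast
      rw [add_mul]
      norm_num
    rw [hc]
    refine h2.congr (Filter.Eventually.of_forall fun x => ?_)
    simp only [Finset.sum_range_succ, Pi.neg_apply]
    ring

theorem rHat_eq_sum_shorter (l k : Fin K) (m : ℕ) (x : Fin K × Fin n → ℝ) :
    rHat (sizesOf x) l k m = (∑ i ∈ Finset.range m, shorter l k i x) / m :=
  rHat_eq_sum _ _ _ _

/-- Hoeffding's inequality for the comparisons of two types. -/
theorem measureReal_rHat_le (hpos : ∀ k, 0 < lam k) {l k : Fin K} (hlk : l ≠ k) {m : ℕ}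
    (hm0 : 0 < m) (hm : m ≤ n) {ε : ℝ} (hε : 0 ≤ ε) :
    (jobLaw n lam).real {x | rHat (sizesOf x) l k m ≤ lam k / (lam k + lam l) - ε}
      ≤ Real.exp (-(2 * m * ε ^ 2)) := by
  have := isProbabilityMeasure_jobLaw (n := n) hpos
  have hm' : (0 : ℝ) < m := by exact_mod_cast hm0
  have h1 := (hasSubgaussianMGF_shorter hpos hlk hm).measure_ge_le (ε := m * ε) (by positivity)
  have h2 : {x : Fin K × Fin n → ℝ | rHat (sizesOf x) l k m ≤ lam k / (lam k + lam l) - ε}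
      = {x | m * ε ≤ ∑ i ∈ Finset.range m, (lam k / (lam k + lam l) - shorter l k i x)} := by
    ext x
    simp only [Set.mem_ofPred_eq, rHat_eq_sum_shorter, Finset.sum_sub_distrib, Finset.sum_const,
      Finset.card_range, nsmul_eq_mul, div_le_iff₀ hm']
    constructor <;> intro h <;> linarith
  rw [h2]
  refine h1.trans (le_of_eq ?_)
  congr 1
  push_cast
  field_simp
  ring

theorem one_le_of_pos_mul {a b : ℕ} (hn : 1 ≤ n) (hK : 1 ≤ K) :
    1 ≤ (n : ℝ) ^ a * (K : ℝ) ^ b :=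
  one_le_mul_of_one_le_of_one_le (one_le_pow₀ (by exact_mod_cast hn))
    (one_le_pow₀ (by exact_mod_cast hK))

theorem log_comparisons_pos (hn : 1 ≤ n) (hK : 1 ≤ K) :
    0 < Real.log (2 * (n : ℝ) ^ 2 * (K : ℝ) ^ 3) := by
  refine Real.log_pos ?_
  have := one_le_of_pos_mul (a := 2) (b := 3) hn hK
  rw [mul_assoc]
  linarith

theorem exp_neg_log_comparisons (hn : 1 ≤ n) (hK : 1 ≤ K) :
    Real.exp (-Real.log (2 * (n : ℝ) ^ 2 * (K : ℝ) ^ 3)) = (2 * (n : ℝ) ^ 2 * (K : ℝ) ^ 3)⁻¹ := by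
  have hn' : (0 : ℝ) < n := by exact_mod_cast hn
  have hK' : (0 : ℝ) < K := by exact_mod_cast hK
  rw [Real.exp_neg, Real.exp_log (by positivity)]

theorem two_mul_mul_confWidth_sq (hn : 1 ≤ n) (hK : 1 ≤ K) {m : ℕ} (hm : 0 < m) :
    2 * m * confWidth K n m ^ 2 = Real.log (2 * (n : ℝ) ^ 2 * (K : ℝ) ^ 3) := by
  have hm' : (0 : ℝ) < m := by exact_mod_cast hm
  have := log_comparisons_pos hn hK
  rw [confWidth, Real.sq_sqrt (by positivity)]
  field_simp

/-- Union bound over `n * K * (K - 1) / 2` triples; the confidence width is chosen so that each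
fails with probability at most `1 / (2 * n ^ 2 * K ^ 3)`. -/
theorem measureReal_not_accurateComparisons_le (hpos : ∀ k, 0 < lam k) (hn : 1 ≤ n) (hK : 1 ≤ K) :
    (jobLaw n lam).real {x | ¬ AccurateComparisons n lam (sizesOf x)}
      ≤ (K - 1) / (4 * n * K ^ 2) := by
  classical
  have := isProbabilityMeasure_jobLaw (n := n) hpos
  have hn' : (0 : ℝ) < n := by exact_mod_cast hn
  have hK' : (0 : ℝ) < K := by exact_mod_cast hK
  set I : Finset (Σ _ : Fin K, Fin K × ℕ) :=
    Finset.univ.sigma fun k => (Finset.Iio k) ×ˢ Finset.Icc 1 n with hI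
  have h1 : {x : Fin K × Fin n → ℝ | ¬ AccurateComparisons n lam (sizesOf x)} ⊆
      ⋃ z ∈ I, {x | rHat (sizesOf x) z.2.1 z.1 z.2.2
        ≤ lam z.1 / (lam z.1 + lam z.2.1) - confWidth K n z.2.2} := by
    intro x hx
    simp only [AccurateComparisons, Set.mem_ofPred_eq, not_forall, not_lt] at hx
    obtain ⟨l, k, hlk, m, hm, h⟩ := hx
    have hz : (⟨k, l, m⟩ : Σ _ : Fin K, Fin K × ℕ) ∈ I := Finset.mem_sigma.2
      ⟨Finset.mem_univ _, Finset.mem_product.2 ⟨Finset.mem_Iio.2 hlk, hm⟩⟩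
    exact Set.mem_iUnion₂.2 ⟨_, hz, h⟩
  refine (measureReal_mono h1 (measure_ne_top _ _)).trans ((measureReal_biUnion_finset_le _ _).trans ?_)
  have h2 : ∀ z ∈ I, (jobLaw n lam).real {x | rHat (sizesOf x) z.2.1 z.1 z.2.2
        ≤ lam z.1 / (lam z.1 + lam z.2.1) - confWidth K n z.2.2}
      ≤ (2 * (n : ℝ) ^ 2 * (K : ℝ) ^ 3)⁻¹ := by
    rintro ⟨k, l, m⟩ hz
    obtain ⟨hl, hm⟩ := Finset.mem_product.1 (Finset.mem_sigma.1 hz).2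
    rw [Finset.mem_Icc] at hm
    refine (measureReal_rHat_le hpos (Finset.mem_Iio.1 hl).ne hm.1 hm.2
      (confWidth_nonneg K n m)).trans (le_of_eq ?_)
    rw [two_mul_mul_confWidth_sq hn hK hm.1, exp_neg_log_comparisons hn hK]
  refine (Finset.sum_le_sum h2).trans (le_of_eq ?_)
  have h3 : (I.card : ℝ) = K * (K - 1) / 2 * n := by
    rw [hI, Finset.card_sigma]
    simp only [Finset.card_product, Fin.card_Iio, Nat.card_Icc, Nat.add_sub_cancel]
    rw [← Finset.sum_mul, Fin.sum_univ_eq_sum_range (fun i => i) K]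
    push_cast
    have h4 : ((∑ i ∈ Finset.range K, i : ℕ) : ℝ) * 2 = K * (K - 1) := by
      have := Finset.sum_range_id_mul_two K
      rw [← Nat.cast_pred (by omega)]
      exact_mod_cast this
    push_cast at h4
    linear_combination (n : ℝ) / 2 * h4
  rw [Finset.sum_const, nsmul_eq_mul, h3]
  field_simp
  ring

theorem confWidth_eq_div (hn : 1 ≤ n) (hK : 1 ≤ K) {m : ℕ} (hm : 0 < m) :
    √(2 * m) * confWidth K n m = √(Real.log (2 * (n : ℝ) ^ 2 * (K : ℝ) ^ 3)) := by
  rw [← two_mul_mul_confWidth_sq hn hK hm, 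
    Real.sqrt_mul (x := 2 * (m : ℝ)) (by positivity), Real.sqrt_sq (confWidth_nonneg _ _ _)]

/-- The number of comparisons after which two types are told apart. -/
noncomputable def separationBound (c a b L : ℝ) : ℝ := c * L * ((b + a) / (b - a)) ^ 2

theorem le_separationBound {c a b L : ℝ} (hc : 0 ≤ c) (ha : 0 < a) (hab : a < b) (hL : 0 ≤ L) :
    c * L ≤ separationBound c a b L := by
  refine le_mul_of_one_le_right (by positivity) (one_le_pow₀ ?_)
  rw [one_le_div (by linarith)]
  linarith

/-- Half of the gap to `1 / 2`, in units of the confidence width. -/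
theorem sqrt_mul_gap {a b L m : ℝ} (ha : 0 < a) (hab : a < b) (hL : 0 < L) (hm : 0 ≤ m) :
    √(2 * m) * (b / (b + a) - 1 / 2) = 2 * √L * √(m / separationBound 8 a b L) := by
  have hba : 0 < b - a := by linarith
  have hs : 0 < b + a := by linarith
  have h1 : b / (b + a) - 1 / 2 = (b - a) / (2 * (b + a)) := by
    field_simp
    ring
  rw [h1]
  have h2 : 0 ≤ (b - a) / (2 * (b + a)) := by positivity
  have h3 : 0 < separationBound 8 a b L := by
    unfold separationBound
    positivity
  refine (sq_eq_sq₀ (by positivity) (by positivity)).1 ?_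
  rw [mul_pow, mul_pow, mul_pow, Real.sq_sqrt (by positivity), Real.sq_sqrt hL.le,
    Real.sq_sqrt (by positivity)]
  unfold separationBound
  field_simp
  ring

/-- From the separation bound on, the winning probability exceeds `1 / 2` by at least two confidence
widths: one is lost to the estimation, the other to the elimination criterion. -/
theorem AccurateComparisons.eliminatesAt {p : Fin K → ℕ → ℝ} (hG : AccurateComparisons n lam p)
    (hpos : ∀ k, 0 < lam k) (hn : 1 ≤ n) (hK : 1 ≤ K) {l k : Fin K} (hlk : l < k)
    (hlam : lam l < lam k) {m : ℕ} (hm : m ≤ n)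
    (hx : separationBound 8 (lam l) (lam k) (Real.log (2 * (n : ℝ) ^ 2 * (K : ℝ) ^ 3)) ≤ m) :
    EliminatesAt n p l k m := by
  have hL := log_comparisons_pos hn hK
  have h0 := le_separationBound (c := 8) (by norm_num) (hpos l) hlam hL.le
  have hm' : (0 : ℝ) < m := by linarith
  have hm0 : 0 < m := by exact_mod_cast hm'
  have h1 := hG l k hlk m (Finset.mem_Icc.2 ⟨hm0, hm⟩)
  have h2 := sqrt_mul_gap (hpos l) hlam hL hm'.le
  have h3 := confWidth_eq_div hn hK hm0
  have h4 : 1 ≤ √(m / separationBound 8 (lam l) (lam k)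
      (Real.log (2 * (n : ℝ) ^ 2 * (K : ℝ) ^ 3))) := by
    rw [Real.one_le_sqrt, one_le_div (by linarith)]
    exact hx
  have h5 : √(2 * m) * (2 * confWidth K n m)
      ≤ √(2 * m) * (lam k / (lam k + lam l) - 1 / 2) := by
    rw [h2, mul_left_comm, h3]
    exact le_mul_of_one_le_right (by positivity) h4
  have h6 := le_of_mul_le_mul_left h5 (Real.sqrt_pos.2 (by linarith))
  rw [EliminatesAt]
  linarith

/-- Serves the single count `m` between `s - 1` and `s`, where accuracy need not imply elimination.
The gap is still well above one confidence width, so Hoeffding's inequality applies to the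
difference. -/
theorem measureReal_not_eliminatesAt_le (hpos : ∀ k, 0 < lam k) (hn : 1 ≤ n) {l k : Fin K}
    (hlk : l < k) (hlam : lam l < lam k) {m : ℕ} (hm : m ≤ n)
    (hx : separationBound 8 (lam l) (lam k) (Real.log (2 * (n : ℝ) ^ 2 * (K : ℝ) ^ 3)) - 1 ≤ m) :
    (jobLaw n lam).real {x | ¬ EliminatesAt n (sizesOf x) l k m} ≤ 3 / 4 / (n * K ^ 2) := by
  have hK2 : 2 ≤ K := by
    have := k.2
    have : (l : ℕ) < k := hlk
    omega
  have hK : 1 ≤ K := by omega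
  have hn' : (1 : ℝ) ≤ n := by exact_mod_cast hn
  have hK' : (2 : ℝ) ≤ K := by exact_mod_cast hK2
  set L := Real.log (2 * (n : ℝ) ^ 2 * (K : ℝ) ^ 3) with hLdef
  have hL := log_comparisons_pos hn hK
  rw [← hLdef] at hL
  -- Chosen so that `s ≥ 8 * L ≥ 11`, whence `m / s ≥ 10 / 11`.
  have hL2 : 11 / 8 ≤ L := by
    have h1 : (2 : ℝ) ^ 4 ≤ 2 * (n : ℝ) ^ 2 * (K : ℝ) ^ 3 := by
      have h2 : (2 : ℝ) ^ 3 ≤ (K : ℝ) ^ 3 := by gcongr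
      have h3 : (1 : ℝ) ≤ (n : ℝ) ^ 2 := one_le_pow₀ hn'
      nlinarith
    have h2 := Real.log_le_log (by norm_num) h1
    rw [Real.log_pow] at h2
    have h3 := Real.log_two_gt_d9
    push_cast at h2
    linarith
  set s := separationBound 8 (lam l) (lam k) L with hs
  have h0 : 8 * L ≤ s := le_separationBound (c := 8) (by norm_num) (hpos l) hlam hL.le
  have hs11 : 11 ≤ s := by linarith
  have hm' : (0 : ℝ) < m := by linarith
  have hm0 : 0 < m := by exact_mod_cast hm'
  set g := lam k / (lam k + lam l) - 1 / 2 with hg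
  have h2 : √(2 * m) * g = 2 * √L * √(m / s) := sqrt_mul_gap (hpos l) hlam hL hm'.le
  have h3 : √(2 * m) * confWidth K n m = √L := confWidth_eq_div hn hK hm0
  have h4 : 10 / 11 ≤ √(m / s) := by
    refine Real.le_sqrt_of_sq_le ?_
    rw [le_div_iff₀ (by linarith)]
    linarith
  have hsL : 0 < √L := Real.sqrt_pos.2 hL
  have h5 : √L * (9 / 11) ≤ √(2 * m) * (g - confWidth K n m) := by
    rw [mul_sub, h2, h3]
    nlinarith
  have h6 : 0 ≤ g - confWidth K n m := by
    by_contra h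
    have h7 : √(2 * m) * (g - confWidth K n m) ≤ 0 :=
      mul_nonpos_of_nonneg_of_nonpos (Real.sqrt_nonneg _) (le_of_lt (not_le.1 h))
    linarith
  -- The factor `9 / 11` is `2 * (10 / 11) - 1`, and its square is at least `2 / 3`.
  have h7 : 2 / 3 * L ≤ 2 * m * (g - confWidth K n m) ^ 2 := by
    have h8 : (√L * (9 / 11)) ^ 2 ≤ (√(2 * m) * (g - confWidth K n m)) ^ 2 := by gcongr
    rw [mul_pow, mul_pow, Real.sq_sqrt hL.le, Real.sq_sqrt (by positivity)] at h8
    linarith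
  have h8 : {x : Fin K × Fin n → ℝ | ¬ EliminatesAt n (sizesOf x) l k m}
      = {x | rHat (sizesOf x) l k m
        ≤ lam k / (lam k + lam l) - (g - confWidth K n m)} := by
    ext x
    simp only [EliminatesAt, Set.mem_ofPred_eq, hg, not_lt]
    constructor <;> intro h <;> linarith
  rw [h8]
  refine (measureReal_rHat_le hpos hlk.ne hm0 hm h6).trans ?_
  refine (Real.exp_le_exp.2 (neg_le_neg h7)).trans ?_
  -- Cubing turns `exp (-(2 / 3 * L))` into the rational expression `(2 * n ^ 2 * K ^ 3)⁻¹ ^ 2`.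
  refine le_of_pow_le_pow_left₀ (n := 3) (by norm_num) (by positivity) ?_
  rw [← Real.exp_nat_mul]
  have h9 : ((3 : ℕ) : ℝ) * -(2 / 3 * L) = -L + -L := by push_cast; ring
  rw [h9, Real.exp_add, exp_neg_log_comparisons hn hK, div_pow, ← one_div, div_mul_div_comm,
    div_le_div_iff₀ (by positivity) (by positivity)]
  have h10 : (n : ℝ) ^ 3 ≤ (n : ℝ) ^ 4 := pow_le_pow_right₀ hn' (by norm_num)
  have h11 : (0 : ℝ) < (K : ℝ) ^ 6 := by positivity
  nlinarith [mul_le_mul_of_nonneg_right h10 h11.le, pow_pos (show (0:ℝ) < n by linarith) 4]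

end Comparisons

/-! ### Accuracy of the indices of UCB-U -/

section Indices

variable {K n : ℕ} {lam : Fin K → ℝ}

theorem map_sum_sizesOf_jobLaw (hpos : ∀ k, 0 < lam k) (k : Fin K) {m : ℕ} (hm0 : m ≠ 0)
    (hm : m ≤ n) :
    (jobLaw n lam).map (fun x => ∑ i ∈ Finset.range m, sizesOf x k i)
      = gammaMeasure m (lam k)⁻¹ := by
  have := isProbabilityMeasure_jobLaw (n := n) hpos
  have (q : Fin K × Fin n) : IsProbabilityMeasure (expMeasure (lam q.1)⁻¹) :=
    isProbabilityMeasure_expMeasure (inv_pos.2 (hpos q.1))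
  have h1 : iIndepFun (fun (i : Fin n) (x : Fin K × Fin n → ℝ) => x (k, i)) (jobLaw n lam) := by
    have h2 : iIndepFun (fun (q : Fin K × Fin n) (x : Fin K × Fin n → ℝ) => x q) (jobLaw n lam) :=
      iIndepFun_pi (X := fun _ y => y) fun i => aemeasurable_id
    exact h2.precomp (g := fun i => (k, i)) fun i j h => congrArg Prod.snd h
  have hcard : (Finset.univ.filter fun i : Fin n => (i : ℕ) < m).card = m := by
    rw [Fin.card_filter_val_lt, min_eq_right hm]
  have h3 := map_sum_eq_gammaMeasure (μ := jobLaw n lam)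
    (fun i => measurable_pi_apply (k, i)) h1 (inv_pos.2 (hpos k))
    (s := Finset.univ.filter fun i : Fin n => (i : ℕ) < m)
    (Finset.card_pos.1 (by omega)) fun i _ => map_eval_jobLaw hpos (k, i)
  rw [hcard] at h3
  rw [← h3]
  congr 1
  funext x
  rw [Finset.sum_apply, Finset.sum_filter]
  have h4 : ∀ i : Fin n, (if (i : ℕ) < m then x (k, i) else 0)
      = (fun j : ℕ => if j < m then sizesOf x k j else 0) i := fun i => by simp [sizesOf_coe]
  simp only [h4]
  rw [Fin.sum_univ_eq_sum_range (fun j : ℕ => if j < m then sizesOf x k j else 0) n,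
    ← Finset.sum_filter]
  refine Finset.sum_congr ?_ fun _ _ => rfl
  ext i
  simp only [Finset.mem_range, Finset.mem_filter]
  omega

theorem map_const_mul_sum_sizesOf_jobLaw (hpos : ∀ k, 0 < lam k) (k : Fin K) {m : ℕ} (hm0 : m ≠ 0)
    (hm : m ≤ n) {c : ℝ} (hc : 0 < c) :
    (jobLaw n lam).map (fun x => c * ∑ i ∈ Finset.range m, sizesOf x k i)
      = gammaMeasure m ((lam k)⁻¹ / c) := by
  rw [← map_const_mul_gammaMeasure (by positivity) (inv_pos.2 (hpos k)) hc,
    ← map_sum_sizesOf_jobLaw hpos k hm0 hm, Measure.map_map (by fun_prop)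
    (Finset.measurable_sum _ fun i _ => measurable_sizesOf k i)]
  rfl

theorem log_indices_pos (hn : 1 ≤ n) (hK : 1 ≤ K) :
    0 < Real.log (2 * (n : ℝ) ^ 2 * (K : ℝ) ^ 2) := by
  refine Real.log_pos ?_
  have := one_le_of_pos_mul (a := 2) (b := 2) hn hK
  rw [mul_assoc]
  linarith

theorem exp_neg_log_indices (hn : 1 ≤ n) (hK : 1 ≤ K) :
    Real.exp (-Real.log (2 * (n : ℝ) ^ 2 * (K : ℝ) ^ 2)) = 1 / (2 * (n : ℝ) ^ 2 * (K : ℝ) ^ 2) := by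
  have hn' : (0 : ℝ) < n := by exact_mod_cast hn
  have hK' : (0 : ℝ) < K := by exact_mod_cast hK
  rw [Real.exp_neg, Real.exp_log (by positivity), one_div]

theorem level_mem_Ioo (hn : 1 ≤ n) (hK : 1 ≤ K) :
    1 - 1 / (2 * (n : ℝ) ^ 2 * (K : ℝ) ^ 2) ∈ Set.Ioo (0 : ℝ) 1 := by
  rw [← exp_neg_log_indices hn hK]
  have h1 := Real.exp_pos (-Real.log (2 * (n : ℝ) ^ 2 * (K : ℝ) ^ 2))
  have h2 := Real.exp_lt_one_iff.2 (neg_lt_zero.2 (log_indices_pos hn hK))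
  exact ⟨by linarith, by linarith⟩

/-- The index of a type exceeds its mean with small probability only. -/
theorem measureReal_lt_ucbuIndex_le (hpos : ∀ k, 0 < lam k) (hn : 1 ≤ n) (hK : 1 ≤ K) (l : Fin K)
    {m : ℕ} (hm : m ≤ n) :
    (jobLaw n lam).real {x | lam l < ucbuIndex n (sizesOf x) l m}
      ≤ 1 / (2 * (n : ℝ) ^ 2 * (K : ℝ) ^ 2) := by
  have := isProbabilityMeasure_jobLaw (n := n) hpos
  rcases Nat.eq_zero_or_pos m with rfl | hm0
  · have : {x : Fin K × Fin n → ℝ | lam l < ucbuIndex n (sizesOf x) l 0} = ∅ := by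
      ext x
      simp [ucbuIndex, (hpos l).le]
    rw [this, measureReal_empty]
    positivity
  · obtain ⟨hα0, hα1⟩ := level_mem_Ioo hn hK
    have hl := hpos l
    set q := chiSqQuantile (2 * m) (1 - 1 / (2 * (n : ℝ) ^ 2 * (K : ℝ) ^ 2)) with hq
    have hq0 : 0 < q := chiSqQuantile_pos hm0.ne' hα0 hα1
    have h1 := map_const_mul_sum_sizesOf_jobLaw hpos l hm0.ne' hm (c := 2 / lam l) (by positivity)
    have h2 : (lam l)⁻¹ / (2 / lam l) = 1 / 2 := by field_simp
    rw [h2, ← chiSqMeasure_two_mul] at h1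
    have h3 : {x : Fin K × Fin n → ℝ | lam l < ucbuIndex n (sizesOf x) l m}
        = (fun x => 2 / lam l * ∑ i ∈ Finset.range m, sizesOf x l i) ⁻¹' Set.Ioi q := by
      ext x
      simp only [ucbuIndex, Set.mem_ofPred_eq, Set.mem_preimage, Set.mem_Ioi]
      rw [← hq, lt_div_iff₀ hq0, div_mul_eq_mul_div, lt_div_iff₀ hl, mul_comm]
    rw [h3, ← map_measureReal_apply (((Finset.measurable_sum _ fun i _ =>
      measurable_sizesOf l i)).const_mul _) measurableSet_Ioi, h1]
    refine (chiSqMeasure_Ioi_chiSqQuantile_le hm0.ne' hα1).trans (le_of_eq ?_)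
    ring

/-- On the left is `a` times half the upper bound of the `χ²` quantile, on the right the lower
deviation bound for a sum of `m` sizes of mean `b`. So an index at most `a` forces the sum into its
lower tail. -/
theorem tail_separation {a b L m : ℝ} (ha : 0 < a) (hab : a < b) (hL : 2 ≤ L) (hm : 0 < m)
    (hx : separationBound 3 a b L - 1 ≤ m) :
    a * (m + √(2 * m * L) + L) ≤ b * (m - √(2 * m * L)) := by
  set D := (b - a) / (b + a) with hD
  have hs : 0 < b + a := by linarith
  have hD0 : 0 < D := div_pos (by linarith) hs
  have hD1 : D ≤ 1 := (div_le_one hs).2 (by linarith)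
  set w := √(2 * L / m) with hw
  have hw0 : 0 ≤ w := Real.sqrt_nonneg _
  have hw2 : m * w ^ 2 = 2 * L := by
    rw [hw, Real.sq_sqrt (by positivity)]
    field_simp
  have hmw : √(2 * m * L) = m * w := by
    rw [show 2 * m * L = (m * w) ^ 2 by linear_combination (-m) * hw2,
      Real.sqrt_sq (by positivity)]
  have hsep : separationBound 3 a b L = 3 * L / D ^ 2 := by
    rw [separationBound, hD]
    have : b - a ≠ 0 := by linarith
    field_simp
  rw [hsep] at hx
  have h1 : 3 * L ≤ (m + 1) * D ^ 2 := by
    rw [← div_le_iff₀ (by positivity)]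
    linarith
  have hD2 : D ^ 2 ≤ 1 := pow_le_one₀ hD0.le hD1
  -- Replacing `m + 1` by `m` loses at most `D ^ 2 ≤ 1 ≤ L / 2`.
  have h2 : 5 / 2 * L ≤ m * D ^ 2 := by nlinarith
  have h3 : w ^ 2 ≤ 4 / 5 * D ^ 2 := by
    refine le_of_mul_le_mul_left ?_ hm
    rw [hw2]
    linarith
  have h4 : w ≤ 9 / 10 * D := by
    refine le_of_pow_le_pow_left₀ two_ne_zero (by positivity) ?_
    nlinarith
  have hDs : D * (b + a) = b - a := by
    rw [hD]
    field_simp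
  have ha' : a = (b + a) * (1 - D) / 2 := by linear_combination (1 / 2 : ℝ) * hDs
  have hb' : b = (b + a) * (1 + D) / 2 := by linear_combination (-1 / 2 : ℝ) * hDs
  have h5 : a * (1 + w + w ^ 2 / 2) ≤ b * (1 - w) := by
    -- After expansion this reads `2 * w + (1 - D) * w ^ 2 / 2 ≤ 2 * D`, for which `w ≤ 9 / 10 * D`
    -- leaves enough room.
    have h6 : (1 - D) * (1 + w + w ^ 2 / 2) ≤ (1 + D) * (1 - w) := by
      have h7 : (1 - D) * w ^ 2 ≤ (1 - D) * (4 / 5 * D ^ 2) :=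
        mul_le_mul_of_nonneg_left h3 (by linarith)
      nlinarith [mul_nonneg hD0.le (sq_nonneg (D - 1 / 2))]
    have h7 := mul_le_mul_of_nonneg_left h6 (show 0 ≤ (b + a) / 2 by linarith)
    calc a * (1 + w + w ^ 2 / 2) = (b + a) / 2 * ((1 - D) * (1 + w + w ^ 2 / 2)) := by
          linear_combination (1 + w + w ^ 2 / 2) * ha'
      _ ≤ _ := h7
      _ = b * (1 - w) := by linear_combination -(1 - w) * hb'
  rw [hmw]
  have h6 := mul_le_mul_of_nonneg_left h5 hm.le
  have h7 : L = m * w ^ 2 / 2 := by linarith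
  rw [h7]
  linarith

/-- After sufficiently many jobs, the index of a type is not below a smaller mean. -/
theorem measureReal_ucbuIndex_le_le (hpos : ∀ k, 0 < lam k) (hn : 1 ≤ n) {l k : Fin K}
    (hlk : l < k) (hlam : lam l < lam k) {m : ℕ} (hm0 : m ≠ 0) (hm : m ≤ n)
    (hx : separationBound 3 (lam l) (lam k) (Real.log (2 * (n : ℝ) ^ 2 * (K : ℝ) ^ 2)) - 1 ≤ m) :
    (jobLaw n lam).real {x | ucbuIndex n (sizesOf x) k m ≤ lam l}
      ≤ 1 / (2 * (n : ℝ) ^ 2 * (K : ℝ) ^ 2) := by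
  have := isProbabilityMeasure_jobLaw (n := n) hpos
  have hK2 : 2 ≤ K := by
    have := k.2
    have : (l : ℕ) < k := hlk
    omega
  have hK : 1 ≤ K := by omega
  have hn' : (1 : ℝ) ≤ n := by exact_mod_cast hn
  have hK' : (2 : ℝ) ≤ K := by exact_mod_cast hK2
  obtain ⟨hα0, hα1⟩ := level_mem_Ioo hn hK
  have hexp := exp_neg_log_indices hn hK
  have hL := log_indices_pos hn hK
  set L := Real.log (2 * (n : ℝ) ^ 2 * (K : ℝ) ^ 2) with hLdef
  have hL2 : 2 ≤ L := by
    have h1 : (2 : ℝ) ^ 3 ≤ 2 * (n : ℝ) ^ 2 * (K : ℝ) ^ 2 := by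
      have h2 : (2 : ℝ) ^ 2 ≤ (K : ℝ) ^ 2 := by gcongr
      have h3 : (1 : ℝ) ≤ (n : ℝ) ^ 2 := one_le_pow₀ hn'
      nlinarith
    have h2 := Real.log_le_log (by norm_num) h1
    rw [Real.log_pow] at h2
    have h3 := Real.log_two_gt_d9
    push_cast at h2
    linarith
  have hm' : (0 : ℝ) < m := by positivity
  have hk := hpos k
  have hl := hpos l
  have h1 := map_const_mul_sum_sizesOf_jobLaw hpos k hm0 hm (c := (lam k)⁻¹) (by positivity)
  rw [div_self (by positivity)] at h1
  have h2 : {x : Fin K × Fin n → ℝ | ucbuIndex n (sizesOf x) k m ≤ lam l} ⊆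
      (fun x => (lam k)⁻¹ * ∑ i ∈ Finset.range m, sizesOf x k i) ⁻¹'
        Set.Iic (m - √(2 * m * L)) := by
    intro x hx'
    have hq0 := chiSqQuantile_pos hm0 hα0 hα1
    have hq := chiSqQuantile_le_of_exp hm0 hL
    rw [hexp] at hq
    simp only [ucbuIndex, Set.mem_ofPred_eq] at hx'
    rw [div_le_iff₀ hq0] at hx'
    have h3 := mul_le_mul_of_nonneg_left hq hl.le
    have h4 := tail_separation hl hlam hL2 hm' hx
    simp only [Set.mem_preimage, Set.mem_Iic]
    rw [inv_mul_le_iff₀ hk]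
    linarith
  refine (measureReal_mono h2 (measure_ne_top _ _)).trans ?_
  rw [← map_measureReal_apply (((Finset.measurable_sum _ fun i _ =>
      measurable_sizesOf k i)).const_mul _) measurableSet_Iic, h1, ← hexp]
  exact gammaMeasure_le_le hm' hL.le

end Indices

/-! ### Upper bounds of expectations -/

/-- The function `g` is integrable and its integral is at most `b`. -/
def IntegralLE {X : Type*} [MeasurableSpace X] (μ : Measure X) (g : X → ℝ) (b : ℝ) : Prop :=
  Integrable g μ ∧ ∫ x, g x ∂μ ≤ b

namespace IntegralLE

variable {X ι : Type*} [MeasurableSpace X] {μ : Measure X} {g g' : X → ℝ} {b b' : ℝ}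

theorem sum {J : Finset ι} {f : ι → X → ℝ} {c : ι → ℝ} (h : ∀ j ∈ J, IntegralLE μ (f j) (c j)) :
    IntegralLE μ (fun x => ∑ j ∈ J, f j x) (∑ j ∈ J, c j) := by
  refine ⟨integrable_finsetSum _ fun j hj => (h j hj).1, ?_⟩
  rw [integral_finsetSum _ fun j hj => (h j hj).1]
  exact Finset.sum_le_sum fun j hj => (h j hj).2

theorem add (h : IntegralLE μ g b) (h' : IntegralLE μ g' b') :
    IntegralLE μ (fun x => g x + g' x) (b + b') :=
  ⟨h.1.add h'.1, (integral_add h.1 h'.1).trans_le (add_le_add h.2 h'.2)⟩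

theorem const_mul (h : IntegralLE μ g b) {c : ℝ} (hc : 0 ≤ c) :
    IntegralLE μ (fun x => c * g x) (c * b) :=
  ⟨h.1.const_mul c, (integral_const_mul c g).trans_le (mul_le_mul_of_nonneg_left h.2 hc)⟩

theorem const [IsProbabilityMeasure μ] (c : ℝ) : IntegralLE μ (fun _ => c) c :=
  ⟨integrable_const c, by simp⟩

theorem ite [IsFiniteMeasure μ] {p : X → Prop} [DecidablePred p] (hp : MeasurableSet {x | p x})
    (h : μ.real {x | p x} ≤ b) : IntegralLE μ (fun x => if p x then 1 else 0) b := by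
  have h1 : (fun x => if p x then (1 : ℝ) else 0) = {x | p x}.indicator 1 := by
    funext x
    simp [Set.indicator_apply]
  rw [h1]
  exact ⟨(integrable_const 1).indicator hp, (integral_indicator_one hp).trans_le h⟩

theorem integral_le (h : IntegralLE μ g b) (hg' : Integrable g' μ) (hle : ∀ x, g' x ≤ g x) :
    ∫ x, g' x ∂μ ≤ b :=
  (integral_mono hg' h.1 hle).trans h.2

end IntegralLE

/-! ### Sums over pairs of types -/

section Pairs

variable {K : ℕ}

theorem sum_filter_lt_eq_sum_range (f : ℕ → ℝ) (k : Fin K) :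
    ∑ l : Fin K with l < k, f l = ∑ i ∈ Finset.range k, f i := by
  rw [Finset.sum_filter]
  have h1 : ∀ l : Fin K, (if l < k then f l else 0)
      = (fun i : ℕ => if i < (k : ℕ) then f i else 0) l := fun l => by
    simp only [Fin.lt_def]
  simp only [h1]
  rw [Fin.sum_univ_eq_sum_range (fun i : ℕ => if i < (k : ℕ) then f i else 0) K,
    ← Finset.sum_filter]
  refine Finset.sum_congr ?_ fun _ _ => rfl
  ext i
  have := k.2
  simp only [Finset.mem_range, Finset.mem_filter]
  omega

/-- Collects the coefficient of `g k`: type `k` is the later member of the pairs with `l < k` and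
the earlier member of `K - 1 - k` pairs. -/
theorem sum_sum_filter_lt (f g : Fin K → ℝ) :
    ∑ k : Fin K, ∑ l : Fin K with l < k, f l * (g k + g l)
      = ∑ k : Fin K, (∑ l : Fin K with l < k, f l + (K - 1 - (k : ℕ)) * f k) * g k := by
  have h1 : ∑ k : Fin K, ∑ l : Fin K with l < k, f l * g l
      = ∑ l : Fin K, ((K : ℝ) - 1 - (l : ℕ)) * f l * g l := by
    rw [Finset.sum_comm' (t' := Finset.univ) (s' := fun l => Finset.Ioi l) (by simp)]
    refine Finset.sum_congr rfl fun l _ => ?_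
    rw [Finset.sum_const, Fin.card_Ioi, nsmul_eq_mul, mul_assoc, Nat.sub_sub,
      Nat.cast_sub (by have := l.2; omega)]
    push_cast
    ring
  simp only [mul_add, add_mul, Finset.sum_add_distrib, h1, Finset.sum_mul]

theorem sum_pairs_add (g : Fin K → ℝ) :
    ∑ k : Fin K, ∑ l : Fin K with l < k, (g k + g l) = (K - 1) * ∑ k, g k := by
  have h := sum_sum_filter_lt (fun _ => 1) g
  simp only [one_mul] at h
  rw [h, Finset.mul_sum]
  refine Finset.sum_congr rfl fun k _ => ?_
  rw [sum_filter_lt_eq_sum_range (fun _ => 1)]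
  simp

theorem sum_pairs_weighted (g : Fin K → ℝ) :
    ∑ k : Fin K, ∑ l : Fin K with l < k, ((K : ℝ) - ((l : ℕ) + 1)) * (g k + g l)
      = ∑ k : Fin K, (1 / 2 * (((k : ℕ) + 1 : ℝ) - 1) * (2 * (K : ℝ) - ((k : ℕ) + 1 : ℝ))
          + ((K : ℝ) - ((k : ℕ) + 1 : ℝ)) ^ 2) * g k := by
  rw [sum_sum_filter_lt (fun l => (K : ℝ) - ((l : ℕ) + 1))]
  refine Finset.sum_congr rfl fun k _ => ?_
  rw [sum_filter_lt_eq_sum_range (fun l => (K : ℝ) - ((l : ℕ) + 1))]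
  have h1 : ∀ m : ℕ, ∑ i ∈ Finset.range m, ((K : ℝ) - ((i : ℕ) + 1))
      = 1 / 2 * m * (2 * K - (m + 1)) := by
    intro m
    induction m with
    | zero => simp
    | succ m ih => rw [Finset.sum_range_succ, ih]; push_cast; ring
  rw [h1]
  ring

theorem card_filter_lt_le (k : Fin K) (p : Fin K → Prop) [DecidablePred p] :
    ((Finset.univ.filter fun l => l < k ∧ p l).card : ℝ) ≤ K - 1 := by
  have h1 : (Finset.univ.filter fun l => l < k ∧ p l) ⊆ Finset.Iio k := fun l hl =>
    Finset.mem_Iio.2 (Finset.mem_filter.1 hl).2.1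
  have h2 := Finset.card_le_card h1
  rw [Fin.card_Iio] at h2
  have h3 : (Finset.univ.filter fun l => l < k ∧ p l).card + 1 ≤ K := by
    have := k.2
    omega
  have : ((Finset.univ.filter fun l => l < k ∧ p l).card : ℝ) + 1 ≤ K := by exact_mod_cast h3
  linarith

theorem sum_filter_lt_and_le {f : Fin K → Fin K → ℝ} {p : Fin K → Fin K → Prop}
    [∀ k, DecidablePred (p k)] (hf : ∀ k l, l < k → 0 ≤ f k l) :
    ∑ k : Fin K, ∑ l : Fin K with l < k ∧ p k l, f k l
      ≤ ∑ k : Fin K, ∑ l : Fin K with l < k, f k l := by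
  refine Finset.sum_le_sum fun k _ => Finset.sum_le_sum_of_subset_of_nonneg ?_ ?_
  · exact Finset.monotone_filter_right _ fun l _ h => h.1
  · exact fun l hl _ => hf k l (Finset.mem_filter.1 hl).2

end Pairs

/-! ### From numbers of charges to gap-free and gap-dependent bounds -/

section Separation

variable {a b c L N y : ℝ}

/-- The two bounds on `N` combine to `N ^ 2 ≤ y * separationBound c a b L`, in which the squared gap
cancels. -/
theorem gap_mul_le_sqrt (ha : 0 < a) (hab : a < b) (hN : 0 ≤ N) (hNy : N ≤ y)
    (hNs : N ≤ separationBound c a b L) : (b - a) * N ≤ (b + a) * √(c * y * L) := by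
  have hs : 0 < b + a := by linarith
  have hd : 0 < b - a := by linarith
  rw [← Real.sqrt_sq hs.le, ← Real.sqrt_mul (by positivity)]
  refine Real.le_sqrt_of_sq_le ?_
  have h1 : N ^ 2 ≤ y * separationBound c a b L := by
    rw [sq]
    exact mul_le_mul hNy hNs hN (hN.trans hNy)
  calc ((b - a) * N) ^ 2 = (b - a) ^ 2 * N ^ 2 := by ring
    _ ≤ (b - a) ^ 2 * (y * separationBound c a b L) :=
        mul_le_mul_of_nonneg_left h1 (by positivity)
    _ = (b + a) ^ 2 * (c * y * L) := by
        unfold separationBound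
        field_simp

theorem gap_mul_le_div (hab : a < b) (hNs : N ≤ separationBound c a b L) :
    (b - a) * N ≤ (b + a) ^ 2 / (b - a) * (c * L) := by
  have hd : 0 < b - a := by linarith
  refine (mul_le_mul_of_nonneg_left hNs hd.le).trans (le_of_eq ?_)
  unfold separationBound
  field_simp

/-- The number of jobs of a type that are charged for not having been told apart. -/
noncomputable def separationCount (s : ℝ) : ℕ := ⌈s⌉₊ - 1

theorem separationCount_le {s : ℝ} (hs : 0 < s) : (separationCount s : ℝ) ≤ s := by
  have h1 := Nat.ceil_pos.2 hs
  exact (Nat.lt_ceil.1 (by unfold separationCount; omega)).le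

theorem le_separationCount_add_one {s : ℝ} (hs : 0 < s) : s ≤ separationCount s + 1 := by
  have h1 := Nat.ceil_pos.2 hs
  have h2 : separationCount s + 1 = ⌈s⌉₊ := by unfold separationCount; omega
  have h3 := Nat.le_ceil s
  rw [← h2] at h3
  exact_mod_cast h3

theorem sum_range_ite_lt (n M : ℕ) :
    ∑ m ∈ Finset.range n, (if m < M then (1 : ℝ) else 0) = min (n : ℝ) M := by
  rw [← Finset.sum_filter, Finset.sum_const, nsmul_eq_mul, mul_one, ← Nat.cast_min]
  congr 1
  rw [← Finset.card_range (min n M)]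
  congr 1
  ext m
  simp only [Finset.mem_filter, Finset.mem_range]
  omega

end Separation

/-! ### Expected excess of the algorithms -/

section Expectation

variable {K n : ℕ} {lam : Fin K → ℝ} {tie : List (Fin K × ℕ) → Finset (Fin K) → Fin K}

theorem sum_filter_lt_eq_filter_and {f : Fin K → ℝ} (hmono : Monotone lam) (k : Fin K)
    (hf : ∀ l, lam l = lam k → f l = 0) :
    ∑ l : Fin K with l < k, f l = ∑ l : Fin K with l < k ∧ lam l < lam k, f l := by
  rw [← Finset.filter_filter]
  refine (Finset.sum_filter_of_ne fun l hl hne => ?_).symm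
  exact lt_of_le_of_ne (hmono (Finset.mem_filter.1 hl).2.le) fun h => hne (hf l h)

theorem integral_excess_etcuRun_le (hpos : ∀ k, 0 < lam k) (hmono : Monotone lam) (hn : 1 ≤ n)
    (hK : 1 ≤ K) (htie : ∀ h S, S.Nonempty → tie h S ∈ S)
    (hint : Integrable (fun x : Fin K × Fin n → ℝ =>
      excess (fun k _ => lam k) (etcuRun n tie (sizesOf x) (K * n)).1) (jobLaw n lam)) :
    ∃ N : Fin K → Fin K → ℝ, (∀ k l, l < k → lam l < lam k → 0 ≤ N k l ∧ N k l ≤ n ∧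
        N k l ≤ separationBound 8 (lam l) (lam k) (Real.log (2 * (n : ℝ) ^ 2 * (K : ℝ) ^ 3))) ∧
      ∫ x, excess (fun k _ => lam k) (etcuRun n tie (sizesOf x) (K * n)).1 ∂jobLaw n lam
        ≤ (n + 3) / 4 * ∑ k, lam k
          + ∑ k : Fin K, ∑ l : Fin K with l < k ∧ lam l < lam k,
            n * ((K : ℝ) - ((l : ℕ) + 1)) * ((lam k - lam l) * N k l) := by
  classical
  have := isProbabilityMeasure_jobLaw (n := n) hpos
  have hn' : (1 : ℝ) ≤ n := by exact_mod_cast hn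
  have hK' : (1 : ℝ) ≤ K := by exact_mod_cast hK
  set L := Real.log (2 * (n : ℝ) ^ 2 * (K : ℝ) ^ 3) with hLdef
  have hL : 0 < L := log_comparisons_pos hn hK
  set s : Fin K → Fin K → ℝ := fun k l => separationBound 8 (lam l) (lam k) L with hs
  have hs0 : ∀ k l, lam l < lam k → 0 < s k l := fun k l hlam => by
    have := le_separationBound (c := 8) (by norm_num) (hpos l) hlam hL.le
    simp only [hs]
    linarith
  set M : Fin K → Fin K → ℕ := fun k l => separationCount (s k l) with hM
  set c : Fin K → Fin K → ℝ :=
    fun k l => n * (((k : ℕ) : ℝ) - ((l : ℕ) : ℝ)) * (lam k - lam l) with hc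
  have hc0 : ∀ k l, l < k → 0 ≤ c k l := fun k l hlk => by
    have h1 : ((l : ℕ) : ℝ) ≤ ((k : ℕ) : ℝ) := by exact_mod_cast hlk.le
    have h2 := hmono hlk.le
    exact mul_nonneg (mul_nonneg (Nat.cast_nonneg n) (by linarith)) (by linarith)
  -- Counts the `m < M` with `M = ⌈s⌉₊ - 1`; subtracting one keeps this number at most `s`. On the
  -- accurate event, `m > M` is never charged, and the borderline `m = M` is charged only if
  -- elimination fails there.
  refine ⟨fun k l => min (n : ℝ) (M k l), fun k l _ hlam =>
    ⟨by positivity, min_le_left _ _, (min_le_right _ _).trans (separationCount_le (hs0 k l hlam))⟩,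
    ?_⟩
  have hle : ∀ x : Fin K × Fin n → ℝ,
      excess (fun k _ => lam k) (etcuRun n tie (sizesOf x) (K * n)).1 ≤
        (n : ℝ) ^ 2 * ((K - 1) * ∑ k, lam k)
            * (if ¬ AccurateComparisons n lam (sizesOf x) then 1 else 0)
          + ∑ k : Fin K, ∑ l : Fin K with l < k ∧ lam l < lam k,
            c k l * (min (n : ℝ) (M k l)
              + if M k l < n ∧ ¬ EliminatesAt n (sizesOf x) l k (M k l) then 1 else 0) := by
    intro x
    have hsum0 : 0 ≤ ∑ k : Fin K, ∑ l : Fin K with l < k ∧ lam l < lam k,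
            c k l * (min (n : ℝ) (M k l)
              + if M k l < n ∧ ¬ EliminatesAt n (sizesOf x) l k (M k l) then 1 else 0) := by
      refine Finset.sum_nonneg fun k _ => Finset.sum_nonneg fun l hl => ?_
      refine mul_nonneg (hc0 k l (Finset.mem_filter.1 hl).2.1) (add_nonneg (by positivity) ?_)
      split_ifs <;> norm_num
    by_cases hG : AccurateComparisons n lam (sizesOf x)
    · rw [if_neg (not_not.2 hG), mul_zero, zero_add]
      refine (excess_etcuRun_le hG hpos hmono htie).trans (Finset.sum_le_sum fun k _ => ?_)
      rw [Finset.sum_comm]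
      simp only [← Finset.mul_sum]
      rw [sum_filter_lt_eq_filter_and hmono k fun l hl => by rw [hl, sub_self]; ring]
      refine Finset.sum_le_sum fun l hl => ?_
      obtain ⟨hlk, hlam⟩ := (Finset.mem_filter.1 hl).2
      refine mul_le_mul_of_nonneg_left ?_ (hc0 k l hlk)
      have h1 : ∀ m ∈ Finset.range n, (if EliminatesAt n (sizesOf x) l k m then (0 : ℝ) else 1)
          ≤ (if m < M k l then 1 else 0) + if m = M k l then
            (if ¬ EliminatesAt n (sizesOf x) l k (M k l) then 1 else 0) else 0 := by
        intro m hm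
        rcases lt_trichotomy m (M k l) with h | h | h
        · rw [if_pos h, if_neg h.ne]
          split_ifs <;> norm_num
        · subst h
          simp only [lt_irrefl, if_false, if_true, ite_not, zero_add, le_refl]
        · have h2 : EliminatesAt n (sizesOf x) l k m := by
            refine hG.eliminatesAt hpos hn hK hlk hlam (Finset.mem_range.1 hm).le ?_
            refine (le_separationCount_add_one (hs0 k l hlam)).trans ?_
            exact_mod_cast h
          rw [if_pos h2]
          split_ifs <;> norm_num
      refine (Finset.sum_le_sum h1).trans (le_of_eq ?_)
      rw [Finset.sum_add_distrib, sum_range_ite_lt, Finset.sum_ite_eq']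
      simp only [Finset.mem_range, ite_and]
    · rw [if_pos hG, mul_one]
      have h1 := excess_le_of_history (n := n) hpos hmono (isAlgorithm_etcuRun (n := n) htie) (sizesOf x)
      linarith
  have hmeasE : ∀ l k m, MeasurableSet {x : Fin K × Fin n → ℝ | EliminatesAt n (sizesOf x) l k m} :=
    fun l k m => measurableSet_eliminatesAt measurable_sizesOf l k m
  have hmeasG : MeasurableSet {x : Fin K × Fin n → ℝ | ¬ AccurateComparisons n lam (sizesOf x)} := by
    refine MeasurableSet.compl (s := {x | AccurateComparisons n lam (sizesOf x)}) ?_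
    simp only [AccurateComparisons, Set.ofPred_forall]
    refine MeasurableSet.iInter fun l => MeasurableSet.iInter fun k => MeasurableSet.iInter fun _ =>
      MeasurableSet.iInter fun m => MeasurableSet.iInter fun _ => ?_
    exact measurableSet_lt measurable_const (measurable_rHat measurable_sizesOf l k m)
  have hbound := (((IntegralLE.ite hmeasG
    (measureReal_not_accurateComparisons_le hpos hn hK)).const_mul
      (c := (n : ℝ) ^ 2 * ((K - 1) * ∑ k, lam k)) (by
        have := Finset.sum_nonneg fun k (_ : k ∈ Finset.univ) => (hpos k).le
        have : (0 : ℝ) ≤ K - 1 := by linarith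
        positivity)).add
    (IntegralLE.sum (J := Finset.univ) fun k _ =>
      IntegralLE.sum (J := Finset.univ.filter fun l => l < k ∧ lam l < lam k) fun l hl =>
        (((IntegralLE.const (μ := jobLaw n lam) (min (n : ℝ) (M k l))).add
          (IntegralLE.ite (p := fun x => M k l < n ∧ ¬ EliminatesAt n (sizesOf x) l k (M k l))
            (b := 3 / 4 / (n * K ^ 2))
            ((MeasurableSet.const _).inter (hmeasE l k _).compl) (by
              obtain ⟨hlk, hlam⟩ := (Finset.mem_filter.1 hl).2
              by_cases hMn : M k l < n
              · simp only [hMn, true_and]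
                refine measureReal_not_eliminatesAt_le hpos hn hlk hlam hMn.le ?_
                have := le_separationCount_add_one (hs0 k l hlam)
                linarith
              · simp only [hMn, false_and, Set.ofPred_false, measureReal_empty]
                positivity))).const_mul
            (hc0 k l (Finset.mem_filter.1 hl).2.1)))).integral_le hint hle
  refine hbound.trans ?_
  have hS : 0 ≤ ∑ k, lam k := Finset.sum_nonneg fun k _ => (hpos k).le
  -- Cost of inaccurate comparisons: the crude excess bound times the failure probability.
  have h1 : (n : ℝ) ^ 2 * ((K - 1) * ∑ k, lam k) * ((K - 1) / (4 * n * K ^ 2))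
      ≤ n / 4 * ∑ k, lam k := by
    have h2 : (n : ℝ) ^ 2 * ((K - 1) * ∑ k, lam k) * ((K - 1) / (4 * n * K ^ 2))
        = n / 4 * (((K - 1) / K) ^ 2 * ∑ k, lam k) := by
      field_simp
    rw [h2]
    refine mul_le_mul_of_nonneg_left ?_ (by positivity)
    refine mul_le_of_le_one_left hS (pow_le_one₀ (div_nonneg (by linarith) (by linarith)) ?_)
    rw [div_le_one (by linarith)]
    linarith
  -- Cost of the borderline counts `m = M`. Together with the previous bound it gives the term `(n +
  -- 3) / 4 * ∑ k, lam k`.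
  have h2 : ∑ k : Fin K, ∑ l : Fin K with l < k ∧ lam l < lam k, c k l * (3 / 4 / (n * K ^ 2))
      ≤ 3 / 4 * ∑ k, lam k := by
    rw [Finset.mul_sum]
    refine Finset.sum_le_sum fun k _ => ?_
    have h3 : ∀ l ∈ Finset.univ.filter fun l => l < k ∧ lam l < lam k,
        c k l * (3 / 4 / (n * K ^ 2)) ≤ 3 / 4 * lam k / K := by
      intro l hl
      obtain ⟨hlk, hlam⟩ := (Finset.mem_filter.1 hl).2
      have h4 : ((k : ℕ) : ℝ) - ((l : ℕ) : ℝ) ≤ K := by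
        have h5 : ((k : ℕ) : ℝ) ≤ K := by exact_mod_cast k.2.le
        have h6 : (0 : ℝ) ≤ ((l : ℕ) : ℝ) := Nat.cast_nonneg _
        linarith
      have h7 : c k l ≤ n * K * lam k := by
        have := hpos l
        exact mul_le_mul (mul_le_mul_of_nonneg_left h4 (by positivity)) (by linarith)
          (by linarith) (by positivity)
      refine (mul_le_mul_of_nonneg_right h7 (by positivity)).trans (le_of_eq ?_)
      field_simp
    refine (Finset.sum_le_sum h3).trans ?_
    rw [Finset.sum_const, nsmul_eq_mul]
    have h4 := card_filter_lt_le k (fun l => lam l < lam k)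
    have h5 : 0 ≤ 3 / 4 * lam k / K := by
      have := hpos k
      positivity
    refine (mul_le_mul_of_nonneg_right (h4.trans (by linarith : (K : ℝ) - 1 ≤ K)) h5).trans
      (le_of_eq ?_)
    field_simp
  have h3 : ∑ k : Fin K, ∑ l : Fin K with l < k ∧ lam l < lam k, c k l * min (n : ℝ) (M k l)
      ≤ ∑ k : Fin K, ∑ l : Fin K with l < k ∧ lam l < lam k,
            n * ((K : ℝ) - ((l : ℕ) + 1)) * ((lam k - lam l) * min (n : ℝ) (M k l)) := by
    refine Finset.sum_le_sum fun k _ => Finset.sum_le_sum fun l hl => ?_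
    obtain ⟨hlk, hlam⟩ := (Finset.mem_filter.1 hl).2
    rw [← mul_assoc]
    refine mul_le_mul_of_nonneg_right ?_ (by positivity)
    refine mul_le_mul_of_nonneg_right ?_ (by linarith)
    refine mul_le_mul_of_nonneg_left ?_ (by positivity)
    have h5 : ((k : ℕ) : ℝ) + 1 ≤ K := by exact_mod_cast k.2
    linarith
  simp only [mul_add, Finset.sum_add_distrib]
  linarith

theorem integral_excess_ucbuRun_le (hpos : ∀ k, 0 < lam k) (hmono : Monotone lam) (hn : 1 ≤ n)
    (hK : 1 ≤ K) (htie : ∀ h S, S.Nonempty → tie h S ∈ S)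
    (hint : Integrable (fun x : Fin K × Fin n → ℝ =>
      excess (fun k _ => lam k) (ucbuRun n tie (sizesOf x) (K * n))) (jobLaw n lam)) :
    ∃ N : Fin K → Fin K → ℝ, (∀ k l, l < k → lam l < lam k → 0 ≤ N k l ∧ N k l ≤ n ∧
        N k l ≤ separationBound 3 (lam l) (lam k) (Real.log (2 * (n : ℝ) ^ 2 * (K : ℝ) ^ 2))) ∧
      ∫ x, excess (fun k _ => lam k) (ucbuRun n tie (sizesOf x) (K * n)) ∂jobLaw n lam
        ≤ (n + 3) / 2 * ∑ k, lam k
          + ∑ k : Fin K, ∑ l : Fin K with l < k ∧ lam l < lam k,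
            n * ((lam k - lam l) * N k l) := by
  classical
  have := isProbabilityMeasure_jobLaw (n := n) hpos
  have hn' : (1 : ℝ) ≤ n := by exact_mod_cast hn
  have hK' : (1 : ℝ) ≤ K := by exact_mod_cast hK
  set L := Real.log (2 * (n : ℝ) ^ 2 * (K : ℝ) ^ 2) with hLdef
  have hL : 0 < L := log_indices_pos hn hK
  set α : ℝ := 1 / (2 * (n : ℝ) ^ 2 * (K : ℝ) ^ 2) with hα
  have hα0 : 0 < α := by positivity
  set s : Fin K → Fin K → ℝ := fun k l => separationBound 3 (lam l) (lam k) L with hs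
  have hs0 : ∀ k l, lam l < lam k → 0 < s k l := fun k l hlam => by
    have := le_separationBound (c := 3) (by norm_num) (hpos l) hlam hL.le
    simp only [hs]
    linarith
  set M : Fin K → Fin K → ℕ := fun k l => separationCount (s k l) with hM
  refine ⟨fun k l => min (n : ℝ) (M k l), fun k l _ hlam =>
    ⟨by positivity, min_le_left _ _, (min_le_right _ _).trans (separationCount_le (hs0 k l hlam))⟩,
    ?_⟩
  have hmeas := fun k m => measurable_ucbuIndex (n := n) (measurable_sizesOf (K := K) (n := n)) k m
  have hbound := (IntegralLE.sum (μ := jobLaw n lam) (J := Finset.univ) fun k _ =>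
    IntegralLE.sum (J := Finset.range n) fun m hm =>
      IntegralLE.sum (J := Finset.univ) fun l _ =>
        ((IntegralLE.ite (p := fun x => ucbuIndex n (sizesOf x) k m ≤ lam l)
            (measurableSet_le (hmeas k m) measurable_const) le_rfl).add
          (IntegralLE.sum (J := Finset.range n) fun j hj =>
            IntegralLE.ite (p := fun x => lam l < ucbuIndex n (sizesOf x) l j)
              (measurableSet_lt measurable_const (hmeas l j))
              (measureReal_lt_ucbuIndex_le hpos hn hK l (Finset.mem_range.1 hj).le))).const_mul
          (c := n * max (lam k - lam l) 0) (by positivity)).integral_le hint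
    fun x => excess_ucbuRun_le htie (sizesOf x) lam
  refine hbound.trans ?_
  have hlt : ∀ k l, ¬ (l < k ∧ lam l < lam k) → max (lam k - lam l) 0 = 0 := by
    intro k l h
    refine max_eq_right ?_
    by_contra h'
    have h2 : lam l < lam k := by linarith
    exact h ⟨hmono.reflect_lt h2, h2⟩
  -- The rare events add `α` for each `m` and another `α` for each pair `(m, j)`, in total at most
  -- `2 * n ^ 2 * α = 1 / K ^ 2`.
  have hpair : ∀ k l, l < k → lam l < lam k → ∑ m ∈ Finset.range n,
      ((jobLaw n lam).real {x | ucbuIndex n (sizesOf x) k m ≤ lam l} + ∑ _j ∈ Finset.range n, α)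
      ≤ min (n : ℝ) (M k l) + 1 / K ^ 2 := by
    intro k l hlk hlam
    have h1 : ∀ m ∈ Finset.range n,
        (jobLaw n lam).real {x | ucbuIndex n (sizesOf x) k m ≤ lam l}
          ≤ (if m < M k l then 1 else 0) + α := by
      intro m hm
      by_cases h : m < M k l
      · rw [if_pos h]
        have := measureReal_le_one (μ := jobLaw n lam)
          (s := {x | ucbuIndex n (sizesOf x) k m ≤ lam l})
        linarith
      · rw [if_neg h, zero_add]
        have h2 := le_separationCount_add_one (hs0 k l hlam)
        have h3 : (M k l : ℝ) ≤ m := by exact_mod_cast not_lt.1 h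
        have h4 : s k l - 1 ≤ m := by
          simp only [hM] at h3
          linarith
        refine measureReal_ucbuIndex_le_le hpos hn hlk hlam ?_ (Finset.mem_range.1 hm).le h4
        -- An unsampled type has index zero, below every mean, so `m = 0` must be excluded: `s ≥ 3 *
        -- L > 1` contradicts `s - 1 ≤ 0`.
        rintro rfl
        have h5 := le_separationBound (c := 3) (by norm_num) (hpos l) hlam hL.le
        have h6 : 1 / 2 ≤ L := by
          have h7 : (2 : ℝ) ≤ 2 * (n : ℝ) ^ 2 * (K : ℝ) ^ 2 := by
            have := one_le_of_pos_mul (a := 2) (b := 2) hn hK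
            rw [mul_assoc]
            linarith
          have h8 := Real.log_le_log (by norm_num) h7
          have := Real.log_two_gt_d9
          linarith
        simp only [hs, Nat.cast_zero] at h4
        linarith
    rw [Finset.sum_add_distrib]
    have h2 := Finset.sum_le_sum h1
    rw [Finset.sum_add_distrib, sum_range_ite_lt] at h2
    simp only [Finset.sum_const, Finset.card_range, nsmul_eq_mul] at h2 ⊢
    have h3 : (n : ℝ) * α + n * (n * α) ≤ 1 / K ^ 2 := by
      have h4 : (n : ℝ) * α + n * (n * α) ≤ 2 * n ^ 2 * α := by
        have h5 : (n : ℝ) * α ≤ n * (n * α) := le_mul_of_one_le_left (by positivity) hn'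
        linarith [show 2 * (n : ℝ) ^ 2 * α = n * (n * α) + n * (n * α) by ring]
      refine h4.trans (le_of_eq ?_)
      rw [hα]
      field_simp
    linarith
  have hterm : ∀ k : Fin K, ∑ m ∈ Finset.range n, ∑ l, n * max (lam k - lam l) 0 *
      ((jobLaw n lam).real {x | ucbuIndex n (sizesOf x) k m ≤ lam l} + ∑ _j ∈ Finset.range n, α)
      ≤ ∑ l : Fin K with l < k ∧ lam l < lam k, (n * ((lam k - lam l) * min (n : ℝ) (M k l))
        + n * lam k / K ^ 2) := by
    intro k
    rw [Finset.sum_comm, Finset.sum_filter]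
    refine Finset.sum_le_sum fun l _ => ?_
    rw [← Finset.mul_sum]
    split_ifs with h
    · have h1 := hpair k l h.1 h.2
      rw [max_eq_left (by linarith [h.2])]
      have h2 := mul_le_mul_of_nonneg_left h1
        (show 0 ≤ n * (lam k - lam l) from mul_nonneg (by positivity) (by linarith [h.2]))
      refine h2.trans ?_
      have h3 : n * (lam k - lam l) * (1 / (K : ℝ) ^ 2) ≤ n * lam k / K ^ 2 := by
        rw [mul_one_div]
        have := hpos l
        gcongr
        linarith
      linarith
    · rw [hlt k l h]
      simp
  refine (Finset.sum_le_sum fun k _ => hterm k).trans ?_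
  simp only [Finset.sum_add_distrib]
  rw [add_comm]
  refine add_le_add ?_ le_rfl
  rw [Finset.mul_sum]
  refine Finset.sum_le_sum fun k _ => ?_
  rw [Finset.sum_const, nsmul_eq_mul]
  have hk := hpos k
  have h4 := card_filter_lt_le k (fun l => lam l < lam k)
  refine (mul_le_mul_of_nonneg_right h4 (by positivity)).trans ?_
  have h5 : ((K : ℝ) - 1) / K ^ 2 ≤ 1 / 2 := by
    rw [div_le_div_iff₀ (by positivity) two_pos]
    nlinarith [sq_nonneg ((K : ℝ) - 1)]
  calc ((K : ℝ) - 1) * (n * lam k / K ^ 2) = (K - 1) / K ^ 2 * (n * lam k) := by ring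
    _ ≤ 1 / 2 * (n * lam k) := mul_le_mul_of_nonneg_right h5 (by positivity)
    _ ≤ (n + 3) / 2 * lam k := by linarith

end Expectation

/-! ### The costs as functions of the relevant job sizes -/

theorem integrable_and_integral_eq_of_map_eq {Ω X : Type*} [MeasurableSpace Ω] [MeasurableSpace X]
    {μ : Measure Ω} {ν : Measure X} {Ψ : Ω → X} (hΨ : AEMeasurable Ψ μ) (hmap : μ.map Ψ = ν)
    {c : Ω → ℝ} {f : X → ℝ} (hc : ∀ ω, c ω = f (Ψ ω)) (hf : Integrable f ν) :
    Integrable c μ ∧ ∫ ω, c ω ∂μ = ∫ x, f x ∂ν := by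
  obtain rfl : c = f ∘ Ψ := funext hc
  subst hmap
  exact ⟨(integrable_map_measure hf.aestronglyMeasurable hΨ).1 hf,
    (integral_map hΨ hf.aestronglyMeasurable).symm⟩

theorem costFTPP_congr {K n : ℕ} {p p' : Fin K → ℕ → ℝ} (h : ∀ k, ∀ i < n, p k i = p' k i) :
    costFTPP K n p = costFTPP K n p' :=
  flowTime_congr fun a ha => h a.1 a.2 (mem_allJobs.1 ha)

theorem costOPT_congr {K n : ℕ} {p p' : Fin K → ℕ → ℝ} (h : ∀ k, ∀ i < n, p k i = p' k i) :
    costOPT K n p = costOPT K n p' := by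
  have h1 : ∀ a ∈ allJobs K n, p a.1 a.2 = p' a.1 a.2 := fun a ha =>
    h a.1 a.2 (mem_allJobs.1 ha)
  rw [costOPT_eq, costOPT_eq, pairMinSum, pairMinSum, List.map_congr_left h1,
    List.map_congr_left fun a ha => congrArg List.sum (List.map_congr_left fun b hb => by
      rw [h1 a ha, h1 b hb])]

/-! ### The four bounds -/

theorem mainTheorem1 {Ω : Type*} [MeasurableSpace Ω] (μ : Measure Ω) [IsProbabilityMeasure μ]
    (K n : ℕ) (hK : 1 ≤ K) (hn : 1 ≤ n)
    (lam : Fin K → ℝ) (hpos : ∀ k, 0 < lam k) (hmono : Monotone lam)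
    (P : Fin K → ℕ → Ω → ℝ)
    (hlaw : ∀ k : Fin K, ∀ i < n, HasLaw (P k i) (expMeasure (lam k)⁻¹) μ)
    (hindep : iIndepFun (fun (q : Fin K × Fin n) => P q.1 q.2) μ)
    (tie : List (Fin K × ℕ) → Finset (Fin K) → Fin K)
    (htie : ∀ h S, S.Nonempty → tie h S ∈ S) :
    Integrable (fun ω => costFTPP K n (fun k i => P k i ω)) μ ∧
    Integrable (fun ω => costOPT K n (fun k i => P k i ω)) μ ∧
    Integrable (fun ω => costETCU K n tie (fun k i => P k i ω)) μ ∧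
    Integrable (fun ω => costUCBU K n tie (fun k i => P k i ω)) μ ∧
    (∫ ω, costETCU K n tie (fun k i => P k i ω) ∂μ
      ≤ ∫ ω, costFTPP K n (fun k i => P k i ω) ∂μ
        + 1 / (n : ℝ) * ∫ ω, costOPT K n (fun k i => P k i ω) ∂μ
        + ∑ k : Fin K,
            (1 / 2 * (((k : ℕ) + 1 : ℝ) - 1) * (2 * (K : ℝ) - ((k : ℕ) + 1 : ℝ))
              + ((K : ℝ) - ((k : ℕ) + 1 : ℝ)) ^ 2)
            * lam k * (n : ℝ)
            * √(8 * (n : ℝ) * Real.log (2 * (n : ℝ) ^ 2 * (K : ℝ) ^ 3))) ∧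
    (∫ ω, costETCU K n tie (fun k i => P k i ω) ∂μ
      ≤ ∫ ω, costFTPP K n (fun k i => P k i ω) ∂μ
        + 1 / (n : ℝ) * ∫ ω, costOPT K n (fun k i => P k i ω) ∂μ
        + ∑ k : Fin K, ∑ l : Fin K with l < k ∧ lam l < lam k,
            ((K : ℝ) - ((l : ℕ) + 1 : ℝ)) * ((lam k + lam l) ^ 2 / (lam k - lam l))
            * (n : ℝ) * 8 * Real.log (2 * (n : ℝ) ^ 2 * (K : ℝ) ^ 3)) ∧
    (∫ ω, costUCBU K n tie (fun k i => P k i ω) ∂μ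
      ≤ ∫ ω, costFTPP K n (fun k i => P k i ω) ∂μ
        + (n : ℝ) * ((K : ℝ) - 1) * √(3 * (n : ℝ) * Real.log (2 * (n : ℝ) ^ 2 * (K : ℝ) ^ 2))
            * ∑ k : Fin K, lam k
        + 2 / (n : ℝ) * ∫ ω, costOPT K n (fun k i => P k i ω) ∂μ) ∧
    (∫ ω, costUCBU K n tie (fun k i => P k i ω) ∂μ
      ≤ ∫ ω, costFTPP K n (fun k i => P k i ω) ∂μ
        + ∑ l : Fin K, ∑ k : Fin K with l < k ∧ lam l < lam k,
            (lam k + lam l) ^ 2 / (lam k - lam l) * 3 * (n : ℝ)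
            * Real.log (2 * (n : ℝ) ^ 2 * (K : ℝ) ^ 2)
        + 2 / (n : ℝ) * ∫ ω, costOPT K n (fun k i => P k i ω) ∂μ) := by
  classical
  have hn0 : (0 : ℝ) < n := by exact_mod_cast hn
  have hae : ∀ q : Fin K × Fin n, AEMeasurable (P q.1 q.2) μ := fun q =>
    (hlaw q.1 q.2 q.2.2).aemeasurable
  -- The costs depend only on the sizes with `i < n`, whose joint law is the product measure
  -- `jobLaw`; all expectations are transferred there.
  set Ψ : Ω → Fin K × Fin n → ℝ := fun ω q => P q.1 q.2 ω
  have hΨ : AEMeasurable Ψ μ := aemeasurable_pi_lambda _ hae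
  have hmap : μ.map Ψ = jobLaw n lam := by
    rw [hindep.map_fun_eq_pi_map hae, jobLaw]
    exact congrArg Measure.pi (funext fun q => (hlaw q.1 q.2 q.2.2).map_eq)
  have hsizes : ∀ ω, ∀ k, ∀ i < n, P k i ω = sizesOf (Ψ ω) k i := fun ω k i hi =>
    (sizesOf_of_lt (Ψ ω) k hi).symm
  obtain ⟨hF1, hF2⟩ := integrable_and_integral_eq_of_map_eq hΨ hmap
    (fun ω => costFTPP_congr (hsizes ω)) (integral_costFTPP_jobLaw hpos).1
  obtain ⟨hO1, hO2⟩ := integrable_and_integral_eq_of_map_eq hΨ hmap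
    (fun ω => costOPT_congr (hsizes ω)) (integral_costOPT_jobLaw hpos).1
  have hOPT := (integral_costOPT_jobLaw (n := n) hpos).2
  rw [← hO2] at hOPT
  have halgE := isAlgorithm_etcuRun (n := n) htie
  have halgU := isAlgorithm_ucbuRun (n := n) htie
  obtain ⟨hE1, hE2, hE3⟩ := integral_run_jobLaw hpos hmono halgE fun s =>
    measurableSet_fiber_comp (measurableSet_etcuRun (tie := tie) measurable_sizesOf (K * n))
      (g := fun _ s => s.1) (fun _ _ => MeasurableSet.const _) s
  obtain ⟨hU1, hU2, hU3⟩ := integral_run_jobLaw hpos hmono halgU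
    (measurableSet_ucbuRun measurable_sizesOf (K * n))
  obtain ⟨hE4, hE5⟩ := integrable_and_integral_eq_of_map_eq hΨ hmap
    (fun ω => (halgE.flowTime_run_congr (hsizes ω)).symm) hE1
  obtain ⟨hU4, hU5⟩ := integrable_and_integral_eq_of_map_eq hΨ hmap
    (fun ω => (halgU.flowTime_run_congr (hsizes ω)).symm) hU1
  obtain ⟨N, hN, hNE⟩ := integral_excess_etcuRun_le hpos hmono hn hK htie hE2
  obtain ⟨N', hN', hNU⟩ := integral_excess_ucbuRun_le hpos hmono hn hK htie hU2
  have hE : ∫ ω, costETCU K n tie (fun k i => P k i ω) ∂μ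
      ≤ ∫ ω, costFTPP K n (fun k i => P k i ω) ∂μ
        + 1 / (n : ℝ) * ∫ ω, costOPT K n (fun k i => P k i ω) ∂μ
        + ∑ k : Fin K, ∑ l : Fin K with l < k ∧ lam l < lam k,
            n * ((K : ℝ) - ((l : ℕ) + 1)) * ((lam k - lam l) * N k l) := by
    have h1 : (n + 3) / 4 * ∑ k, lam k
        ≤ 1 / (n : ℝ) * ∫ ω, costOPT K n (fun k i => P k i ω) ∂μ := by
      rw [one_div, le_inv_mul_iff₀ hn0]
      exact le_of_eq_of_le (by ring) hOPT
    unfold costETCU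
    rw [hE5, hE3, hF2]
    linarith
  have hU : ∫ ω, costUCBU K n tie (fun k i => P k i ω) ∂μ
      ≤ ∫ ω, costFTPP K n (fun k i => P k i ω) ∂μ
        + ∑ k : Fin K, ∑ l : Fin K with l < k ∧ lam l < lam k, n * ((lam k - lam l) * N' k l)
        + 2 / (n : ℝ) * ∫ ω, costOPT K n (fun k i => P k i ω) ∂μ := by
    have h1 : (n + 3) / 2 * ∑ k, lam k
        ≤ 2 / (n : ℝ) * ∫ ω, costOPT K n (fun k i => P k i ω) ∂μ := by
      rw [div_eq_inv_mul 2 (n : ℝ), mul_assoc (n : ℝ)⁻¹, le_inv_mul_iff₀ hn0]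
      linarith
    unfold costUCBU
    rw [hU5, hU3, hF2]
    linarith
  have hcoef : ∀ l : Fin K, 0 ≤ (n : ℝ) * ((K : ℝ) - ((l : ℕ) + 1)) := fun l => by
    have : ((l : ℕ) : ℝ) + 1 ≤ K := by exact_mod_cast l.2
    exact mul_nonneg hn0.le (by linarith)
  refine ⟨hF1, hO1, hE4, hU4, hE.trans (add_le_add le_rfl ?_), hE.trans (add_le_add le_rfl ?_),
    hU.trans (add_le_add (add_le_add le_rfl ?_) le_rfl),
    hU.trans (add_le_add (add_le_add le_rfl ?_) le_rfl)⟩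
  · set R := √(8 * (n : ℝ) * Real.log (2 * (n : ℝ) ^ 2 * (K : ℝ) ^ 3))
    calc _ ≤ ∑ k : Fin K, ∑ l : Fin K with l < k ∧ lam l < lam k,
          n * ((K : ℝ) - ((l : ℕ) + 1)) * ((lam k + lam l) * R) := by
          refine Finset.sum_le_sum fun k _ => Finset.sum_le_sum fun l hl => ?_
          obtain ⟨hlk, hlam⟩ := (Finset.mem_filter.1 hl).2
          obtain ⟨h1, h2, h3⟩ := hN k l hlk hlam
          exact mul_le_mul_of_nonneg_left (gap_mul_le_sqrt (hpos l) hlam h1 h2 h3) (hcoef l)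
      _ ≤ ∑ k : Fin K, ∑ l : Fin K with l < k,
          n * ((K : ℝ) - ((l : ℕ) + 1)) * ((lam k + lam l) * R) :=
          sum_filter_lt_and_le fun k l _ => mul_nonneg (hcoef l)
            (mul_nonneg (add_pos (hpos k) (hpos l)).le (Real.sqrt_nonneg _))
      _ = n * R * ∑ k : Fin K, ∑ l : Fin K with l < k,
          ((K : ℝ) - ((l : ℕ) + 1)) * (lam k + lam l) := by
          simp only [Finset.mul_sum]
          exact Finset.sum_congr rfl fun k _ => Finset.sum_congr rfl fun l _ => by ring
      _ = _ := by
          rw [sum_pairs_weighted, Finset.mul_sum]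
          exact Finset.sum_congr rfl fun k _ => by ring
  · refine Finset.sum_le_sum fun k _ => Finset.sum_le_sum fun l hl => ?_
    obtain ⟨hlk, hlam⟩ := (Finset.mem_filter.1 hl).2
    refine (mul_le_mul_of_nonneg_left (gap_mul_le_div hlam (hN k l hlk hlam).2.2)
      (hcoef l)).trans (le_of_eq ?_)
    ring
  · set R := √(3 * (n : ℝ) * Real.log (2 * (n : ℝ) ^ 2 * (K : ℝ) ^ 2))
    calc _ ≤ ∑ k : Fin K, ∑ l : Fin K with l < k ∧ lam l < lam k,
          n * ((lam k + lam l) * R) := by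
          refine Finset.sum_le_sum fun k _ => Finset.sum_le_sum fun l hl => ?_
          obtain ⟨hlk, hlam⟩ := (Finset.mem_filter.1 hl).2
          obtain ⟨h1, h2, h3⟩ := hN' k l hlk hlam
          exact mul_le_mul_of_nonneg_left (gap_mul_le_sqrt (hpos l) hlam h1 h2 h3) hn0.le
      _ ≤ ∑ k : Fin K, ∑ l : Fin K with l < k, n * ((lam k + lam l) * R) :=
          sum_filter_lt_and_le fun k l _ => mul_nonneg hn0.le
            (mul_nonneg (add_pos (hpos k) (hpos l)).le (Real.sqrt_nonneg _))
      _ = n * R * ∑ k : Fin K, ∑ l : Fin K with l < k, (lam k + lam l) := by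
          simp only [Finset.mul_sum]
          exact Finset.sum_congr rfl fun k _ => Finset.sum_congr rfl fun l _ => by ring
      _ = _ := by
          rw [sum_pairs_add]
          ring
  · have hcomm : ∀ f : Fin K → Fin K → ℝ,
        ∑ l : Fin K, ∑ k : Fin K with l < k ∧ lam l < lam k, f k l
          = ∑ k : Fin K, ∑ l : Fin K with l < k ∧ lam l < lam k, f k l := fun f =>
      Finset.sum_comm' (by simp)
    rw [hcomm fun k l => (lam k + lam l) ^ 2 / (lam k - lam l) * 3 * (n : ℝ)
      * Real.log (2 * (n : ℝ) ^ 2 * (K : ℝ) ^ 2)]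
    refine Finset.sum_le_sum fun k _ => Finset.sum_le_sum fun l hl => ?_
    obtain ⟨hlk, hlam⟩ := (Finset.mem_filter.1 hl).2
    refine (mul_le_mul_of_nonneg_left (gap_mul_le_div hlam (hN' k l hlk hlam).2.2)
      hn0.le).trans (le_of_eq ?_)
    ring
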